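/- **Conventions.** Algorithms are deterministic programs for a random access machine with unit-cost operations. Its integer words are polynomially bounded (in $n$ for connectivity; in $n(2+\log(U)/\varepsilon)$ for weighted graphs), an operation that would overflow has no result, and a second memory holds real numbers (edge weights, $\varepsilon$, $U$) on which arithmetic and comparison have unit cost. A dynamic graph is a simple undirected graph on a fixed set of $n$ vertices, initially without edges, that undergoes edge insertions and edge deletions (any other initial graph is built by inserting its edges). A forest $F\subseteq G$ on the same vertex set is a *maximal spanning forest* of $G$ if $F$ and $G$ have the same connected components. A dynamic connectivity algorithm *provides query access to a maximal spanning forest with worst-case time $T(n)$* if at any time its memory determines a maximal spanning forest $F$ of the current graph, each update takes time at most $T(n)$, and for any vertices $u,v$ it can report in time at most $T(n)$, without changing $F$, whether $u$ and $v$ are connected and, if so, the midpoint of the path $F[u,v]$ (the vertex number $\lfloor \ell/2\rfloor$, counted from $u$ as number $0$, where $\ell$ is the number of edges of the path). **Corollary.** Let a dynamic connectivity algorithm be given that provides query access to a maximal spanning forest with worst-case time $T(n)$. Then there are an algorithm and constants $C, c$ such that for all $n$, all $\varepsilon\in(0,1]$ and all real $U\ge 1$ the following holds for every dynamic graph $G$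 on $n$ vertices whose edges carry real weights in $[1,U]$: after an initialization that depends only on $n,\varepsilon,U$, the algorithm explicitly maintains a $(1+\varepsilon)$-approximate minimum spanning forest of $G$, that is, a maximal spanning forest $F$ of $G$ with $w(F)\le(1+\varepsilon)\,w(F')$ for every maximal spanning forest $F'$ of $G$; each update of $G$ is processed in worst-case time at most $$C\,\log^{c}(n+2)\cdot T(n)\cdot\Bigl(1+\frac{\log U}{\varepsilon}\Bigr),$$ and the algorithm then outputs a list of at most $2$ edge insertions into and deletions from $F$ that leads to the new forest. In particular, if $T(n)=\tilde O(1)$, the worst-case update time is $\tilde O(1+\log(U)/\varepsilon)$, where $\tilde O$ hides factors polylogarithmic in $n$. -/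

import Mathlib

/-!
# Dynamic graph algorithms on a random access machine

The machine has an integer memory, whose words are the natural numbers `≤ W` for a word bound `W`,
and a real memory (used for edge weights and for the parameters `ε` and `U`), both addressed by
words. An integer operation whose result exceeds `W` has no result: the program is stuck.
Programs are built from assignments, sequencing, branching and loops, and the running time of a
program counts every executed assignment and test and every symbol of the expressions evaluated.
-/

namespace DynGraph

open SimpleGraph

/-- The memory of the machine: integer cells and real cells. -/
structure Mem where
  int : ℕ → ℕ
  real : ℕ → ℝ

namespace Mem

/-- Write `v` into the integer cell `i`. -/
def setInt (s : Mem) (i v : ℕ) : Mem := ⟨Function.update s.int i v, s.real⟩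

/-- Write `x` into the real cell `i`. -/
def setReal (s : Mem) (i : ℕ) (x : ℝ) : Mem := ⟨s.int, Function.update s.real i x⟩

/-- The memory with all cells equal to zero. -/
def zero : Mem := ⟨fun _ => 0, fun _ => 0⟩

/-- Pass two integer arguments, in the integer cells `0` and `1`. -/
def withArgs (s : Mem) (u v : ℕ) : Mem := (s.setInt 0 u).setInt 1 v

end Mem

/-- Integer expressions; `load a` is the content of the integer cell with address `a`. -/
inductive IExpr : Type
  | const (k : ℕ)
  | load (a : IExpr)
  | add (a b : IExpr)
  | sub (a b : IExpr)
  | mul (a b : IExpr)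
  | div (a b : IExpr)
  | mod (a b : IExpr)

/-- Real expressions; `load a` is the content of the real cell with address `a`. -/
inductive RExpr : Type
  | cast (a : IExpr)
  | load (a : IExpr)
  | add (x y : RExpr)
  | sub (x y : RExpr)
  | mul (x y : RExpr)
  | div (x y : RExpr)

/-- Tests. -/
inductive Cond : Type
  | le (a b : IExpr)
  | rle (x y : RExpr)
  | neg (b : Cond)
  | and (b c : Cond)

/-- Programs. -/
inductive Cmd : Type
  | skip
  | setInt (a e : IExpr)
  | setReal (a : IExpr) (x : RExpr)
  | seq (c d : Cmd)
  | ite (b : Cond) (c d : Cmd)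
  | loop (b : Cond) (c : Cmd)

/-- The value `v` if it fits into a word. -/
def word (W v : ℕ) : Option ℕ := if v ≤ W then some v else none

/-- Value of an integer expression (`none` on overflow). Subtraction is truncated at `0`, division
rounds down, and division by `0` follows the conventions of `ℕ`. -/
def IExpr.eval (W : ℕ) (s : Mem) : IExpr → Option ℕ
  | .const k => word W k
  | .load a => (a.eval W s).bind fun i => some (s.int i)
  | .add a b => (a.eval W s).bind fun i => (b.eval W s).bind fun j => word W (i + j)
  | .sub a b => (a.eval W s).bind fun i => (b.eval W s).bind fun j => word W (i - j)
  | .mul a b => (a.eval W s).bind fun i => (b.eval W s).bind fun j => word W (i * j)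
  | .div a b => (a.eval W s).bind fun i => (b.eval W s).bind fun j => word W (i / j)
  | .mod a b => (a.eval W s).bind fun i => (b.eval W s).bind fun j => word W (i % j)

/-- Value of a real expression (`none` if an address or a cast integer overflows). -/
noncomputable def RExpr.eval (W : ℕ) (s : Mem) : RExpr → Option ℝ
  | .cast a => (a.eval W s).bind fun i => some (i : ℝ)
  | .load a => (a.eval W s).bind fun i => some (s.real i)
  | .add x y => (x.eval W s).bind fun p => (y.eval W s).bind fun q => some (p + q)
  | .sub x y => (x.eval W s).bind fun p => (y.eval W s).bind fun q => some (p - q)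
  | .mul x y => (x.eval W s).bind fun p => (y.eval W s).bind fun q => some (p * q)
  | .div x y => (x.eval W s).bind fun p => (y.eval W s).bind fun q => some (p / q)

open Classical in
/-- Value of a test. -/
noncomputable def Cond.eval (W : ℕ) (s : Mem) : Cond → Option Bool
  | .le a b => (a.eval W s).bind fun i => (b.eval W s).bind fun j => some (decide (i ≤ j))
  | .rle x y => (x.eval W s).bind fun p => (y.eval W s).bind fun q => some (decide (p ≤ q))
  | .neg b => (b.eval W s).bind fun p => some (!p)
  | .and b c => (b.eval W s).bind fun p => (c.eval W s).bind fun q => some (p && q)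

/-- Number of symbols of an integer expression. -/
def IExpr.size : IExpr → ℕ
  | .const _ => 1
  | .load a => a.size + 1
  | .add a b => a.size + b.size + 1
  | .sub a b => a.size + b.size + 1
  | .mul a b => a.size + b.size + 1
  | .div a b => a.size + b.size + 1
  | .mod a b => a.size + b.size + 1

/-- Number of symbols of a real expression. -/
def RExpr.size : RExpr → ℕ
  | .cast a => a.size + 1
  | .load a => a.size + 1
  | .add x y => x.size + y.size + 1
  | .sub x y => x.size + y.size + 1
  | .mul x y => x.size + y.size + 1
  | .div x y => x.size + y.size + 1

/-- Number of symbols of a test. -/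
def Cond.size : Cond → ℕ
  | .le a b => a.size + b.size + 1
  | .rle x y => x.size + y.size + 1
  | .neg b => b.size + 1
  | .and b c => b.size + c.size + 1

/-- `Exec W c s s' t`: on the machine with word bound `W`, the program `c` started on the memory `s`
halts after `t` steps with the memory `s'`. -/
inductive Exec (W : ℕ) : Cmd → Mem → Mem → ℕ → Prop
  | skip (s : Mem) : Exec W .skip s s 1
  | setInt {s : Mem} {a e : IExpr} {i v : ℕ} :
      a.eval W s = some i → e.eval W s = some v →
      Exec W (.setInt a e) s (s.setInt i v) (1 + a.size + e.size)
  | setReal {s : Mem} {a : IExpr} {x : RExpr} {i : ℕ} {r : ℝ} :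
      a.eval W s = some i → x.eval W s = some r →
      Exec W (.setReal a x) s (s.setReal i r) (1 + a.size + x.size)
  | seq {c d : Cmd} {s s' s'' : Mem} {t t' : ℕ} :
      Exec W c s s' t → Exec W d s' s'' t' → Exec W (.seq c d) s s'' (t + t')
  | iteTrue {b : Cond} {c d : Cmd} {s s' : Mem} {t : ℕ} :
      b.eval W s = some true → Exec W c s s' t → Exec W (.ite b c d) s s' (1 + b.size + t)
  | iteFalse {b : Cond} {c d : Cmd} {s s' : Mem} {t : ℕ} :
      b.eval W s = some false → Exec W d s s' t → Exec W (.ite b c d) s s' (1 + b.size + t)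
  | loopStop {b : Cond} {c : Cmd} {s : Mem} :
      b.eval W s = some false → Exec W (.loop b c) s s (1 + b.size)
  | loopStep {b : Cond} {c : Cmd} {s s' s'' : Mem} {t t' : ℕ} :
      b.eval W s = some true → Exec W c s s' t → Exec W (.loop b c) s' s'' t' →
      Exec W (.loop b c) s s'' (1 + b.size + t + t')

/-! ## Spanning forests -/

/-- `F` is a maximal spanning forest of `G`: an acyclic subgraph on the same vertex set with the
same connected components. -/
def IsMaximalSpanningForest {V : Type*} (G F : SimpleGraph V) : Prop :=
  F ≤ G ∧ F.IsAcyclic ∧ ∀ u v, F.Reachable u v ↔ G.Reachable u v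

/-- A weighted graph with vertices `0, …, n - 1`; only the weights of the edges matter. -/
structure WGraph (n : ℕ) where
  graph : SimpleGraph (Fin n)
  weight : Sym2 (Fin n) → ℝ

namespace WGraph

variable {n : ℕ}

open Classical in
/-- The total weight of the edges of `F`. -/
noncomputable def totalWeight (G : WGraph n) (F : SimpleGraph (Fin n)) : ℝ :=
  ∑ e ∈ F.edgeFinset, G.weight e

/-- `F` is a `(1 + ε)`-approximate minimum spanning forest of `G`. -/
def IsApproxMSF (G : WGraph n) (ε : ℝ) (F : SimpleGraph (Fin n)) : Prop :=
  IsMaximalSpanningForest G.graph F ∧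
    ∀ F', IsMaximalSpanningForest G.graph F' → G.totalWeight F ≤ (1 + ε) * G.totalWeight F'

/-- The graph without edges. -/
def empty (n : ℕ) : WGraph n := ⟨⊥, fun _ => 0⟩

/-- Insert the edge `uv` with weight `x`. -/
def insertEdge (G : WGraph n) (u v : Fin n) (x : ℝ) : WGraph n :=
  ⟨G.graph ⊔ edge u v, Function.update G.weight s(u, v) x⟩

/-- Delete the edge `uv`. -/
def deleteEdge (G : WGraph n) (u v : Fin n) : WGraph n :=
  ⟨G.graph.deleteEdges {s(u, v)}, G.weight⟩

end WGraph

/-! ## Dynamic connectivity with query access to a maximal spanning forest -/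

/-- The programs of a dynamic connectivity data structure. The memory persists from one operation to
the next. The number of vertices is passed to `init`, on an otherwise zero memory, in the integer
cell `0`; the two vertices are passed to the other operations in the integer cells `0` and `1`. -/
structure ConnAlg where
  init : Cmd
  insert : Cmd
  delete : Cmd
  query : Cmd

/-- `r` is a correct answer to the query `(u, v)` for the forest `F`: it is `0` if `u` and `v` are
not connected, and otherwise it is `z + 1` for the midpoint `z` of the path from `u` to `v` in `F`,
that is, for its vertex number `⌊ℓ / 2⌋`, where `ℓ` is the number of edges of the path and the
vertices are numbered from `u`, which has number `0`. -/
def IsAnswer {n : ℕ} (F : SimpleGraph (Fin n)) (u v : Fin n) (r : ℕ) : Prop :=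
  (¬ F.Reachable u v ∧ r = 0) ∨
    ∃ p : F.Walk u v, p.IsPath ∧ r = (p.getVert (p.length / 2) : ℕ) + 1

namespace ConnAlg

/-- The memory at the start. -/
def start (n : ℕ) : Mem := Mem.zero.setInt 0 n

/-- `A.Reach W n G s`: some sequence of edge insertions, edge deletions and queries, starting from
the graph with `n` vertices and no edges, leads to the graph `G` and leaves the data structure with
the memory `s`. -/
inductive Reach (A : ConnAlg) (W n : ℕ) : SimpleGraph (Fin n) → Mem → Prop
  | init {s : Mem} {t : ℕ} : Exec W A.init (start n) s t → Reach A W n ⊥ s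
  | insert {G : SimpleGraph (Fin n)} {s s' : Mem} {t : ℕ} {u v : Fin n} :
      Reach A W n G s → u ≠ v → ¬ G.Adj u v → Exec W A.insert (s.withArgs u v) s' t →
      Reach A W n (G ⊔ edge u v) s'
  | delete {G : SimpleGraph (Fin n)} {s s' : Mem} {t : ℕ} {u v : Fin n} :
      Reach A W n G s → G.Adj u v → Exec W A.delete (s.withArgs u v) s' t →
      Reach A W n (G.deleteEdges {s(u, v)}) s'
  | query {G : SimpleGraph (Fin n)} {s s' : Mem} {t : ℕ} {u v : Fin n} :
      Reach A W n G s → Exec W A.query (s.withArgs u v) s' t → Reach A W n G s'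

/-- On graphs with `n` vertices and with word bound `W`, the data structure maintains, implicitly, a
maximal spanning forest `forest s` determined by its memory `s`; it answers all queries according to
this forest, queries do not change the forest, and every update and every query takes at most `τ`
steps. -/
def Maintains (A : ConnAlg) (W n : ℕ) (τ : ℝ) : Prop :=
  (∃ s t, Exec W A.init (start n) s t) ∧
  ∃ forest : Mem → SimpleGraph (Fin n), ∀ G s, A.Reach W n G s →
    IsMaximalSpanningForest G (forest s) ∧
    (∀ u v : Fin n, u ≠ v → ¬ G.Adj u v →
      ∃ s' t, Exec W A.insert (s.withArgs u v) s' t ∧ (t : ℝ) ≤ τ) ∧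
    (∀ u v : Fin n, G.Adj u v →
      ∃ s' t, Exec W A.delete (s.withArgs u v) s' t ∧ (t : ℝ) ≤ τ) ∧
    (∀ u v : Fin n,
      ∃ s' t, Exec W A.query (s.withArgs u v) s' t ∧ (t : ℝ) ≤ τ ∧
        IsAnswer (forest s) u v (s'.int 0) ∧ forest s' = forest s)

/-- `A` is a dynamic connectivity algorithm with query access to a maximal spanning forest and with
worst-case time at most `T n` per operation on graphs with `n` vertices, on a machine with words
that are polynomially bounded in `n`. -/
def IsDynamicConnectivity (A : ConnAlg) (T : ℕ → ℝ) : Prop :=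
  ∃ w : ℕ, ∀ n, A.Maintains ((n + 2) ^ w) n (T n)

end ConnAlg

/-! ## Explicit maintenance of an approximate minimum spanning forest -/

/-- A change of the forest that is maintained. -/
inductive Change (n : ℕ) : Type
  | add (u v : Fin n)
  | remove (u v : Fin n)

namespace Change

variable {n : ℕ}

/-- The effect of a change on the forest. -/
def apply (F : SimpleGraph (Fin n)) : Change n → SimpleGraph (Fin n)
  | .add u v => F ⊔ edge u v
  | .remove u v => F.deleteEdges {s(u, v)}

/-- The three words by which a change is written. -/
def encode : Change n → ℕ × ℕ × ℕ
  | .add u v => (1, u, v)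
  | .remove u v => (0, u, v)

end Change

/-- The list `cs` of changes is written in the integer cells `0, 1, 2, …`: first its length, then
three words for each change. -/
def Mem.Outputs {n : ℕ} (s : Mem) (cs : List (Change n)) : Prop :=
  s.int 0 = cs.length ∧
    ∀ i (h : i < cs.length),
      (s.int (3 * i + 1), s.int (3 * i + 2), s.int (3 * i + 3)) = (cs[i]'h).encode

/-- The programs of a data structure that maintains a spanning forest of a weighted graph
explicitly. The memory persists from one operation to the next. The number of vertices is passed to
`init` in the integer cell `0` and the numbers `ε` and `U` in the real cells `0` and `1`; the
endpoints of an edge are passed to the updates in the integer cells `0` and `1`, and the weight of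
an inserted edge in the real cell `0`. After every update, the changes of the forest are written to
the integer memory. -/
structure MSFAlg where
  init : Cmd
  insert : Cmd
  delete : Cmd

namespace MSFAlg

/-- The memory at the start. -/
def start (n : ℕ) (ε U : ℝ) : Mem := ((Mem.zero.setInt 0 n).setReal 0 ε).setReal 1 U

/-- `B.Reach W n ε U G F s`: some sequence of edge insertions (with weights in `[1, U]`) and edge
deletions, starting from the graph with `n` vertices and no edges, leads to the weighted graph `G`
and leaves the data structure with the memory `s`, and the changes that were output lead from the
forest without edges to `F`. -/
inductive Reach (B : MSFAlg) (W n : ℕ) (ε U : ℝ) :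
    WGraph n → SimpleGraph (Fin n) → Mem → Prop
  | init {s : Mem} {t : ℕ} :
      Exec W B.init (start n ε U) s t → Reach B W n ε U (WGraph.empty n) ⊥ s
  | insert {G : WGraph n} {F : SimpleGraph (Fin n)} {s s' : Mem} {t : ℕ} {u v : Fin n} {x : ℝ}
      {cs : List (Change n)} :
      Reach B W n ε U G F s → u ≠ v → ¬ G.graph.Adj u v → 1 ≤ x → x ≤ U →
      Exec W B.insert ((s.withArgs u v).setReal 0 x) s' t → s'.Outputs cs →
      Reach B W n ε U (G.insertEdge u v x) (cs.foldl Change.apply F) s'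
  | delete {G : WGraph n} {F : SimpleGraph (Fin n)} {s s' : Mem} {t : ℕ} {u v : Fin n}
      {cs : List (Change n)} :
      Reach B W n ε U G F s → G.graph.Adj u v →
      Exec W B.delete (s.withArgs u v) s' t → s'.Outputs cs →
      Reach B W n ε U (G.deleteEdge u v) (cs.foldl Change.apply F) s'

/-- On graphs with `n` vertices and weights in `[1, U]`, and with word bound `W`, the forest that is
maintained explicitly is at any time a `(1 + ε)`-approximate minimum spanning forest, and every
update takes at most `τ` steps and changes the forest by at most two edge updates. -/
def Maintains (B : MSFAlg) (W n : ℕ) (ε U τ : ℝ) : Prop :=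
  (∃ s t, Exec W B.init (start n ε U) s t) ∧
  ∀ G F s, B.Reach W n ε U G F s →
    G.IsApproxMSF ε F ∧
    (∀ (u v : Fin n) (x : ℝ), u ≠ v → ¬ G.graph.Adj u v → 1 ≤ x → x ≤ U →
      ∃ s' t, Exec W B.insert ((s.withArgs u v).setReal 0 x) s' t ∧ (t : ℝ) ≤ τ ∧
        ∃ cs : List (Change n), s'.Outputs cs ∧ cs.length ≤ 2) ∧
    (∀ u v : Fin n, G.graph.Adj u v →
      ∃ s' t, Exec W B.delete (s.withArgs u v) s' t ∧ (t : ℝ) ≤ τ ∧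
        ∃ cs : List (Change n), s'.Outputs cs ∧ cs.length ≤ 2)

end MSFAlg

end DynGraph

/-! Weights are rounded up to powers of `1 + ε`: an edge of weight `x` gets as its class the least
`i` with `x ≤ (1 + ε) ^ i`. The classes run from `0` to `K = weightClass ε U`, and `K < 2 log U / ε
+ 1` because `log (1 + ε) ≥ ε / 2`. Rounding costs a factor of at most `1 + ε`, so it suffices to
maintain a forest that is minimum with respect to the classes. Such a forest can be characterised by
connectivity alone: for every `j`, its edges of class at most `j` span the graph `level G c j`
(`IsLevelForest`). By an exchange argument it minimises the sum of every monotone function of the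
class (`IsLevelForest.sum_le`).

The algorithm runs one copy of the connectivity structure for each of the `K + 1` levels and one
more for the explicit forest `F`. Since `F` is acyclic, the forest that the last copy maintains
implicitly is `F` itself, so its queries give midpoints of paths of `F`. Let `j₀` be the lowest
level that connects `u` and `v`. When `uv` is inserted, it joins `F` if `j₀` does not exist, and is
ignored if `j₀` is at most its class; otherwise the path of `F` from `u` to `v` has an edge whose
ends are not connected at level `j₀ - 1`, and `uv` replaces it. When an edge `uv` of `F` is deleted
and `j₀` exists afterwards, a path at level `j₀` has an edge whose ends are not connected in `F -
uv`, and this edge replaces `uv`. Either edge is found by bisection: if the ends of a path are not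
connected in another graph, then the midpoint is not connected there to one of the ends. So an
update needs `O(K + log n)` calls of the given structure.

On the machine, the `K + 2` copies share one memory by interleaving their cells with stride `K +
32`; the given programs are rewritten to address one of the interleaved memories, at a constant
factor in time (`Exec.reloc`). The invariant is `ConnAlg.Represents`; it is established by
`runs_initMSF` and preserved by `runs_insertMSF` and `runs_deleteMSF`, and determinism carries it
over to every reachable state. -/

namespace DynGraph

open SimpleGraph

/-! ## Reachability and single edges -/

section Graph

variable {V : Type*}

/-- A walk may cross the new edge several times; by induction along the walk, the crossings reduce
to at most one. -/
theorem reachable_sup_edge_iff {H : SimpleGraph V} {u v a b : V} :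
    (H ⊔ edge u v).Reachable a b ↔ H.Reachable a b ∨ (H.Reachable a u ∧ H.Reachable v b) ∨
      (H.Reachable a v ∧ H.Reachable u b) := by
  constructor
  · rintro ⟨p⟩
    induction p with
    | nil => exact Or.inl (Reachable.refl _)
    | cons h p ih =>
      rw [sup_adj, edge_adj] at h
      rcases h with h | ⟨⟨rfl, rfl⟩ | ⟨rfl, rfl⟩, -⟩
      · rcases ih with ih | ⟨h1, h2⟩ | ⟨h1, h2⟩
        · exact Or.inl (h.reachable.trans ih)
        · exact Or.inr (Or.inl ⟨h.reachable.trans h1, h2⟩)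
        · exact Or.inr (Or.inr ⟨h.reachable.trans h1, h2⟩)
      · rcases ih with ih | ⟨h1, h2⟩ | ⟨h1, h2⟩
        · exact Or.inr (Or.inl ⟨Reachable.refl _, ih⟩)
        · exact Or.inr (Or.inl ⟨Reachable.refl _, h2⟩)
        · exact Or.inl h2
      · rcases ih with ih | ⟨h1, h2⟩ | ⟨h1, h2⟩
        · exact Or.inr (Or.inr ⟨Reachable.refl _, ih⟩)
        · exact Or.inl h2
        · exact Or.inr (Or.inr ⟨Reachable.refl _, h2⟩)
  · have hm : ∀ {a b}, H.Reachable a b → (H ⊔ edge u v).Reachable a b :=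
      fun h => h.mono le_sup_left
    have he : (H ⊔ edge u v).Reachable u v := by
      by_cases huv : u = v
      · rw [huv]
      · exact Adj.reachable (by simp [edge_adj, huv])
    rintro (h | ⟨h1, h2⟩ | ⟨h1, h2⟩)
    · exact hm h
    · exact (hm h1).trans (he.trans (hm h2))
    · exact (hm h1).trans (he.symm.trans (hm h2))

theorem reachable_sup_edge_of_reachable {H : SimpleGraph V} {u v : V} (h : H.Reachable u v)
    (a b : V) : (H ⊔ edge u v).Reachable a b ↔ H.Reachable a b := by
  rw [reachable_sup_edge_iff]
  constructor
  · rintro (h' | ⟨h1, h2⟩ | ⟨h1, h2⟩)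
    · exact h'
    · exact h1.trans (h.trans h2)
    · exact h1.trans (h.symm.trans h2)
  · exact Or.inl

theorem reachable_sup_edge_congr {H H' : SimpleGraph V}
    (h : ∀ a b, H.Reachable a b ↔ H'.Reachable a b) (u v a b : V) :
    (H ⊔ edge u v).Reachable a b ↔ (H' ⊔ edge u v).Reachable a b := by
  simp only [reachable_sup_edge_iff, h]

/-- Exchanging the edge that joins two components for another one that joins the same ones. -/
theorem reachable_exchange {H : SimpleGraph V} {u v x y : V} (h : ¬ H.Reachable u v)
    (h' : (H ⊔ edge x y).Reachable u v) (a b : V) :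
    (H ⊔ edge u v).Reachable a b ↔ (H ⊔ edge x y).Reachable a b := by
  have hs : ∀ {a b}, H.Reachable a b → H.Reachable b a := fun h => h.symm
  have ht : ∀ {a b c}, H.Reachable a b → H.Reachable b c → H.Reachable a c :=
    fun h h' => h.trans h'
  rw [reachable_sup_edge_iff] at h'
  rw [reachable_sup_edge_iff, reachable_sup_edge_iff]
  rcases h' with h' | ⟨h1, h2⟩ | ⟨h1, h2⟩
  · exact absurd h' h
  · constructor
    · rintro (h | ⟨h3, h4⟩ | ⟨h3, h4⟩)
      · exact Or.inl h
      · exact Or.inr (Or.inl ⟨ht h3 h1, ht h2 h4⟩)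
      · exact Or.inr (Or.inr ⟨ht h3 (hs h2), ht (hs h1) h4⟩)
    · rintro (h | ⟨h3, h4⟩ | ⟨h3, h4⟩)
      · exact Or.inl h
      · exact Or.inr (Or.inl ⟨ht h3 (hs h1), ht (hs h2) h4⟩)
      · exact Or.inr (Or.inr ⟨ht h3 h2, ht h1 h4⟩)
  · constructor
    · rintro (h | ⟨h3, h4⟩ | ⟨h3, h4⟩)
      · exact Or.inl h
      · exact Or.inr (Or.inr ⟨ht h3 h1, ht h2 h4⟩)
      · exact Or.inr (Or.inl ⟨ht h3 (hs h2), ht (hs h1) h4⟩)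
    · rintro (h | ⟨h3, h4⟩ | ⟨h3, h4⟩)
      · exact Or.inl h
      · exact Or.inr (Or.inr ⟨ht h3 h2, ht h1 h4⟩)
      · exact Or.inr (Or.inl ⟨ht h3 (hs h1), ht (hs h2) h4⟩)

theorem edge_le_of_adj {G : SimpleGraph V} {u v : V} (h : G.Adj u v) : edge u v ≤ G := by
  intro a b hab
  rw [edge_adj] at hab
  rcases hab with ⟨⟨rfl, rfl⟩ | ⟨rfl, rfl⟩, -⟩
  exacts [h, h.symm]

theorem deleteEdges_sup_edge {G : SimpleGraph V} {u v : V} (h : G.Adj u v) :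
    G.deleteEdges {s(u, v)} ⊔ edge u v = G := by
  ext a b
  simp only [sup_adj, deleteEdges_adj, edge_adj, Set.mem_singleton_iff, Sym2.eq_iff]
  constructor
  · rintro (h' | ⟨⟨rfl, rfl⟩ | ⟨rfl, rfl⟩, -⟩)
    · exact h'.1
    · exact h
    · exact h.symm
  · intro h'
    by_cases hc : (a = u ∧ b = v) ∨ (a = v ∧ b = u)
    · exact Or.inr ⟨by tauto, h'.ne⟩
    · exact Or.inl ⟨h', hc⟩

theorem IsAcyclic.not_reachable_deleteEdges {F : SimpleGraph V} (hF : F.IsAcyclic) {x y : V}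
    (h : F.Adj x y) : ¬ (F.deleteEdges {s(x, y)}).Reachable x y :=
  isBridge_iff.1 (isAcyclic_iff_forall_adj_isBridge.1 hF h)

/-- Every edge of an acyclic graph is a bridge, so none can be dropped without losing a connection.
This identifies the implicit forest of the copy that holds `F` with `F` itself. -/
theorem eq_of_le_of_isAcyclic {F F' : SimpleGraph V} (hle : F' ≤ F) (hF : F.IsAcyclic)
    (h : ∀ a b, F.Reachable a b → F'.Reachable a b) : F' = F := by
  refine le_antisymm hle fun a b hab => ?_
  by_contra hn
  refine IsAcyclic.not_reachable_deleteEdges hF hab ((h a b hab.reachable).mono fun x y hxy => ?_)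
  rw [deleteEdges_adj]
  refine ⟨hle hxy, fun hs => hn ?_⟩
  rw [Set.mem_singleton_iff, Sym2.eq_iff] at hs
  rcases hs with ⟨rfl, rfl⟩ | ⟨rfl, rfl⟩
  exacts [hxy, hxy.symm]

/-- Removing an edge of a path of a forest separates the ends of the path. -/
theorem IsAcyclic.not_reachable_deleteEdges_of_mem {F : SimpleGraph V} (hF : F.IsAcyclic)
    {u v : V} {p : F.Walk u v} (hp : p.IsPath) {e : Sym2 V} (he : e ∈ p.edges) :
    ¬ (F.deleteEdges {e}).Reachable u v := by
  classical
  rintro h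
  obtain ⟨q, hq⟩ := h.exists_isPath
  have hle : F.deleteEdges {e} ≤ F := deleteEdges_le _
  -- Paths in a forest are unique, so a path avoiding `e` would coincide with `p`, which uses `e`.
  have := (hF.subsingleton_path u v).elim ⟨p, hp⟩ ⟨q.mapLe hle, hq.mapLe hle⟩
  have hpq : p = q.mapLe hle := congrArg Subtype.val this
  rw [hpq] at he
  have : e ∈ q.edges := by simpa using he
  have := q.edges_subset_edgeSet this
  simp at this

/-- Otherwise the edges of a walk in `F` would chain up to a connection in `H`. This supplies the
edge across a cut in the exchange argument. -/
theorem Walk.exists_boundary_adj {F H : SimpleGraph V} {x y : V} (h : F.Reachable x y)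
    (hn : ¬ H.Reachable x y) : ∃ a b, F.Adj a b ∧ ¬ H.Reachable a b := by
  by_contra! hc
  apply hn
  obtain ⟨p⟩ := h
  induction p with
  | nil => exact Reachable.refl _
  | cons h p ih => exact (hc _ _ h).trans (by
      by_contra hh
      exact hh (ih hh))

/-! ## Minimum spanning forests with respect to classes of edges -/

/-- The edges of `G` of class at most `j`. -/
def level (G : SimpleGraph V) (c : Sym2 V → ℕ) (j : ℕ) : SimpleGraph V where
  Adj a b := G.Adj a b ∧ c s(a, b) ≤ j
  symm := ⟨fun a b h => ⟨h.1.symm, by rw [Sym2.eq_swap]; exact h.2⟩⟩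
  loopless := ⟨fun a h => G.loopless.irrefl a h.1⟩

theorem level_adj {G : SimpleGraph V} {c : Sym2 V → ℕ} {j : ℕ} {a b : V} :
    (level G c j).Adj a b ↔ G.Adj a b ∧ c s(a, b) ≤ j := Iff.rfl

theorem level_le (G : SimpleGraph V) (c : Sym2 V → ℕ) (j : ℕ) : level G c j ≤ G :=
  fun _ _ h => h.1

theorem level_mono {G H : SimpleGraph V} (h : H ≤ G) (c : Sym2 V → ℕ) {i j : ℕ} (hij : i ≤ j) :
    level H c i ≤ level G c j :=
  fun _ _ h' => ⟨h h'.1, h'.2.trans hij⟩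

theorem level_congr {G : SimpleGraph V} {c c' : Sym2 V → ℕ}
    (h : ∀ a b, G.Adj a b → c s(a, b) = c' s(a, b)) (j : ℕ) : level G c j = level G c' j := by
  ext a b
  simp only [level_adj]
  exact and_congr_right fun hab => by rw [h a b hab]

theorem level_eq_self {G : SimpleGraph V} {c : Sym2 V → ℕ} {j : ℕ}
    (h : ∀ a b, G.Adj a b → c s(a, b) ≤ j) : level G c j = G :=
  le_antisymm (level_le _ _ _) fun a b hab => ⟨hab, h a b hab⟩

theorem level_sup_edge (G : SimpleGraph V) (c : Sym2 V → ℕ) (j : ℕ) (u v : V) :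
    level (G ⊔ edge u v) c j = if c s(u, v) ≤ j then level G c j ⊔ edge u v else level G c j := by
  have hs : s(v, u) = s(u, v) := Sym2.eq_swap
  split_ifs with h <;> ext a b <;> simp only [level_adj, sup_adj, edge_adj]
  · constructor
    · tauto
    · rintro (h' | ⟨⟨rfl, rfl⟩ | ⟨rfl, rfl⟩, hne⟩)
      · tauto
      · tauto
      · rw [hs]; tauto
  · constructor
    · rintro ⟨h' | ⟨⟨rfl, rfl⟩ | ⟨rfl, rfl⟩, hne⟩, hc⟩
      · tauto
      · tauto
      · rw [hs] at hc; tauto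
    · tauto

theorem level_deleteEdges (G : SimpleGraph V) (c : Sym2 V → ℕ) (j : ℕ) (e : Sym2 V) :
    level (G.deleteEdges {e}) c j = (level G c j).deleteEdges {e} := by
  ext a b
  simp only [level_adj, deleteEdges_adj]
  tauto

theorem level_deleteEdges_of_lt {G : SimpleGraph V} {c : Sym2 V → ℕ} {j : ℕ} {e : Sym2 V}
    (h : j < c e) : level (G.deleteEdges {e}) c j = level G c j := by
  ext a b
  simp only [level_adj, deleteEdges_adj, Set.mem_singleton_iff]
  constructor
  · tauto
  · rintro ⟨h1, h2⟩
    refine ⟨⟨h1, ?_⟩, h2⟩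
    rintro rfl
    omega

/-- `F` is a spanning forest of `G` all of whose levels span the levels of `G`: a minimum spanning
forest for all weights that increase with the class. -/
structure IsLevelForest (c : Sym2 V → ℕ) (G F : SimpleGraph V) : Prop where
  le : F ≤ G
  acyclic : F.IsAcyclic
  span : ∀ j a b, (level G c j).Reachable a b → (level F c j).Reachable a b

namespace IsLevelForest

variable {c : Sym2 V → ℕ} {G F : SimpleGraph V}

theorem reachable_iff (h : IsLevelForest c G F) (j : ℕ) (a b : V) :
    (level F c j).Reachable a b ↔ (level G c j).Reachable a b :=
  ⟨fun h' => h'.mono (level_mono h.le c le_rfl), h.span j a b⟩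

theorem congr {c' : Sym2 V → ℕ} (h : IsLevelForest c G F)
    (hc : ∀ a b, G.Adj a b → c s(a, b) = c' s(a, b)) : IsLevelForest c' G F :=
  ⟨h.le, h.acyclic, fun j a b hab => by
    rw [← level_congr (fun a b hab => hc a b (h.le hab)) j]
    rw [← level_congr hc j] at hab
    exact h.span j a b hab⟩

theorem bot (c : Sym2 V → ℕ) : IsLevelForest c (⊥ : SimpleGraph V) ⊥ :=
  ⟨le_rfl, isAcyclic_bot, fun _ _ _ h => h⟩

/-- On a finite vertex set the classes are bounded, and at the bound the level is the whole graph.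
-/
theorem isMaximalSpanningForest [Finite V] (h : IsLevelForest c G F) :
    IsMaximalSpanningForest G F := by
  refine ⟨h.le, h.acyclic, fun u v => ⟨fun h' => h'.mono h.le, fun h' => ?_⟩⟩
  have : ∃ m, ∀ e, c e ≤ m := by
    obtain ⟨m, hm⟩ := (Set.finite_range c).bddAbove
    exact ⟨m, fun e => hm ⟨e, rfl⟩⟩
  obtain ⟨m, hm⟩ := this
  have h2 := h.span m u v
  rw [level_eq_self fun a b _ => hm _, level_eq_self fun a b _ => hm _] at h2
  exact h2 h'

-- Removing an edge `xy` of `F'` outside `F` separates `x` from `y` in `F'`, while `F` joins them by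
-- edges of class at most that of `xy`, one of which crosses the cut. Trading `xy` for that edge
-- does not increase the sum, as `f` is monotone, and leaves one edge fewer of `F'` outside `F`.
open Classical in
theorem sum_le [Fintype V] (h : IsLevelForest c G F) {f : ℕ → ℝ} (hf : Monotone f)
    {F' : SimpleGraph V} (h' : IsMaximalSpanningForest G F') :
    ∑ e ∈ F.edgeFinset, f (c e) ≤ ∑ e ∈ F'.edgeFinset, f (c e) := by
  generalize hm : (F'.edgeFinset \ F.edgeFinset).card = m
  induction m generalizing F' with
  | zero =>
    rw [Finset.card_eq_zero, Finset.sdiff_eq_empty_iff_subset, edgeFinset_subset_edgeFinset] at hm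
    rw [eq_of_le_of_isAcyclic hm h.acyclic fun a b hab => (h'.2.2 a b).2 (hab.mono h.le)]
  | succ m ih =>
    have : (F'.edgeFinset \ F.edgeFinset).Nonempty := by
      rw [← Finset.card_pos]; omega
    obtain ⟨e, he⟩ := this
    induction e with | _ x y
    simp only [Finset.mem_sdiff, mem_edgeFinset, mem_edgeSet] at he
    obtain ⟨hxy, hnxy⟩ := he
    set H := F'.deleteEdges {s(x, y)} with hH
    have hHle : H ≤ F' := deleteEdges_le _
    have hnH : ¬ H.Reachable x y := IsAcyclic.not_reachable_deleteEdges h'.2.1 hxy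
    have hFr : (level F c (c s(x, y))).Reachable x y :=
      h.span _ _ _ (Adj.reachable ⟨h'.1 hxy, le_rfl⟩)
    obtain ⟨a, b, hab, hnab⟩ := Walk.exists_boundary_adj hFr hnH
    have hsup : H ⊔ edge x y = F' := deleteEdges_sup_edge hxy
    have hr : (H ⊔ edge x y).Reachable a b := by
      rw [hsup, h'.2.2]
      exact (h.le hab.1).reachable
    have hnadj : ¬ H.Adj a b := fun h => hnab h.reachable
    obtain ⟨H', hH'⟩ : ∃ H', H' = H ⊔ edge a b := ⟨_, rfl⟩
    have hspan : IsMaximalSpanningForest G H' := by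
      rw [hH']
      refine ⟨sup_le (hHle.trans h'.1) ?_, ?_, fun u v => ?_⟩
      · exact edge_le_of_adj (h.le hab.1)
      · exact (h'.2.1.anti hHle).sup_edge_of_not_reachable hnab
      · rw [reachable_exchange hnab hr, hsup, h'.2.2]
    have hE : H.edgeFinset = F'.edgeFinset.erase s(x, y) := by
      ext e
      simp [hH, edgeSet_deleteEdges, and_comm]
    have hE' : H'.edgeFinset = insert s(a, b) H.edgeFinset := by
      ext e
      simp [hH', edgeSet_edge_of_ne hab.1.ne]
    have hmem : s(x, y) ∈ F'.edgeFinset := by simpa using hxy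
    have hnot : s(a, b) ∉ H.edgeFinset := by simpa using hnadj
    have hlt := ih hspan (by
      rw [hE', Finset.insert_sdiff_of_mem _ (by simpa using hab.1), hE, Finset.erase_sdiff_comm,
        Finset.card_erase_of_mem (by simp [hxy, hnxy]), hm, Nat.add_sub_cancel])
    refine hlt.trans ?_
    rw [hE', Finset.sum_insert hnot, hE, ← Finset.add_sum_erase _ _ hmem]
    gcongr
    exact hf hab.2

/-- Below the class of `uv` nothing changes; from that class on, `uv` is added to two graphs with
the same components. -/
theorem sup_edge_of_not_reachable (h : IsLevelForest c G F) {u v : V} (huv : ¬ F.Reachable u v) :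
    IsLevelForest c (G ⊔ edge u v) (F ⊔ edge u v) := by
  refine ⟨sup_le_sup_right h.le _, h.acyclic.sup_edge_of_not_reachable huv, fun j a b => ?_⟩
  rw [level_sup_edge, level_sup_edge]
  split_ifs
  · rw [reachable_sup_edge_congr (h.reachable_iff j)]
    exact id
  · exact h.span j a b

/-- Every level that receives the edge connects its ends already, so no components merge. -/
theorem sup_edge_of_reachable (h : IsLevelForest c G F) {u v : V}
    (huv : (level G c (c s(u, v))).Reachable u v) : IsLevelForest c (G ⊔ edge u v) F := by
  refine ⟨h.le.trans le_sup_left, h.acyclic, fun j a b => ?_⟩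
  rw [level_sup_edge]
  split_ifs with hj
  · rw [reachable_sup_edge_of_reachable (huv.mono (level_mono le_rfl c hj))]
    exact h.span j a b
  · exact h.span j a b

/-- The new edge `uv` replaces the edge `xy`, which lies between `u` and `v` in the forest and is of
larger class. -/
theorem sup_edge_exchange (h : IsLevelForest c G F) {u v x y : V} {j₀ : ℕ}
    (hxy : F.Adj x y) (hsep : ¬ (F.deleteEdges {s(x, y)}).Reachable u v)
    (hj₀ : j₀ < c s(x, y))
    (hhigh : (level G c (j₀ + 1)).Reachable u v) (hc : c s(u, v) ≤ j₀) :
    IsLevelForest c (G ⊔ edge u v) (F.deleteEdges {s(x, y)} ⊔ edge u v) := by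
  have hle : F.deleteEdges {s(x, y)} ≤ F := deleteEdges_le _
  refine ⟨sup_le_sup_right (hle.trans h.le) _,
    (h.acyclic.anti hle).sup_edge_of_not_reachable hsep, fun j a b => ?_⟩
  rw [level_sup_edge, level_sup_edge]
  -- Below the class of `xy` the forest loses nothing. From that class on, `u` and `v` are already
  -- connected in the level, and exchanging `xy` for `uv` keeps the components of the forest.
  by_cases hjx : j < c s(x, y)
  · rw [level_deleteEdges_of_lt hjx]
    split_ifs
    · rw [reachable_sup_edge_congr (h.reachable_iff j)]
      exact id
    · exact h.span j a b
  · have hcj : c s(u, v) ≤ j := by omega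
    rw [if_pos hcj, if_pos hcj, level_deleteEdges]
    have huv : (level G c j).Reachable u v := hhigh.mono (level_mono le_rfl c (by omega))
    rw [reachable_sup_edge_of_reachable huv, ← h.reachable_iff j]
    have hxyj : (level F c j).Adj x y := ⟨hxy, by omega⟩
    have hn : ¬ ((level F c j).deleteEdges {s(x, y)}).Reachable u v := fun h' =>
      hsep (h'.mono (deleteEdges_mono (level_le F c j)))
    rw [reachable_exchange hn (by rw [deleteEdges_sup_edge hxyj, h.reachable_iff]; exact huv),
      deleteEdges_sup_edge hxyj]
    exact id

theorem deleteEdges_of_not_adj (h : IsLevelForest c G F) {u v : V} (huv : ¬ F.Adj u v) :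
    IsLevelForest c (G.deleteEdges {s(u, v)}) F := by
  have hle : F ≤ G.deleteEdges {s(u, v)} := fun a b hab => by
    rw [deleteEdges_adj]
    refine ⟨h.le hab, fun he => huv ?_⟩
    rwa [← mem_edgeSet, ← Set.mem_singleton_iff.1 he, mem_edgeSet]
  exact ⟨hle, h.acyclic, fun j a b hab =>
    h.span j a b (hab.mono (level_mono (deleteEdges_le _) c le_rfl))⟩

/-- At the levels at which `u` and `v` are separated, removing the edge `uv` needs no replacement. -/
theorem reachable_deleteEdges (h : IsLevelForest c G F) {u v : V} (huv : F.Adj u v) {j : ℕ}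
    (hj : j < c s(u, v) ∨ ¬ (level (G.deleteEdges {s(u, v)}) c j).Reachable u v) {a b : V}
    (hab : (level (G.deleteEdges {s(u, v)}) c j).Reachable a b) :
    (level (F.deleteEdges {s(u, v)}) c j).Reachable a b := by
  by_cases hc : j < c s(u, v)
  · rw [level_deleteEdges_of_lt hc] at hab ⊢
    exact h.span j a b hab
  · have hn := hj.resolve_left hc
    by_contra hnab
    have huvj : (level F c j).Adj u v := ⟨huv, by omega⟩
    have h1 : (level (F.deleteEdges {s(u, v)}) c j ⊔ edge u v).Reachable a b := by
      rw [level_deleteEdges, deleteEdges_sup_edge huvj]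
      exact h.span j a b (hab.mono (level_mono (deleteEdges_le _) c le_rfl))
    -- If the remaining forest failed to connect `a` and `b`, then adding `ab` to it would have the
    -- same effect as putting `uv` back, and so would join `u` and `v`. But `ab` is redundant in the
    -- remaining graph, which would thus connect `u` and `v` itself.
    have h2 := (reachable_exchange hnab h1 u v).2 (by
      rw [level_deleteEdges, deleteEdges_sup_edge huvj]
      exact huvj.reachable)
    apply hn
    rw [← reachable_sup_edge_of_reachable hab]
    exact h2.mono (sup_le_sup_right
      (level_mono (deleteEdges_mono h.le) c le_rfl) _)

theorem deleteEdges_of_not_reachable (h : IsLevelForest c G F) {u v : V} (huv : F.Adj u v)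
    (hn : ¬ (G.deleteEdges {s(u, v)}).Reachable u v) :
    IsLevelForest c (G.deleteEdges {s(u, v)}) (F.deleteEdges {s(u, v)}) :=
  ⟨deleteEdges_mono h.le, h.acyclic.anti (deleteEdges_le _), fun _ _ _ hab =>
    h.reachable_deleteEdges huv (Or.inr fun h' => hn (h'.mono (level_le _ _ _))) hab⟩

/-- The edge `xy` of smallest possible class replaces the edge `uv`. -/
theorem deleteEdges_exchange (h : IsLevelForest c G F) {u v x y : V} {j₀ : ℕ} (huv : F.Adj u v)
    (hlow : ∀ j < j₀, ¬ (level (G.deleteEdges {s(u, v)}) c j).Reachable u v)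
    (hxy : (level (G.deleteEdges {s(u, v)}) c j₀).Adj x y)
    (hsep : ¬ (F.deleteEdges {s(u, v)}).Reachable x y) :
    IsLevelForest c (G.deleteEdges {s(u, v)}) (F.deleteEdges {s(u, v)} ⊔ edge x y) := by
  have hle : F.deleteEdges {s(u, v)} ⊔ edge x y ≤ G.deleteEdges {s(u, v)} :=
    sup_le (deleteEdges_mono h.le) (edge_le_of_adj hxy.1)
  refine ⟨hle, (h.acyclic.anti (deleteEdges_le _)).sup_edge_of_not_reachable hsep,
    fun j a b hab => ?_⟩
  by_cases hj : j < c s(u, v) ∨ ¬ (level (G.deleteEdges {s(u, v)}) c j).Reachable u v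
  · exact (h.reachable_deleteEdges huv hj hab).mono (level_mono le_sup_left c le_rfl)
  -- At these levels the graph still connects `u` and `v`. So `j₀ ≤ j`, the edge `xy` is present,
  -- and it rejoins the two parts into which the removal of `uv` splits a tree.
  · push Not at hj
    have hjj : j₀ ≤ j := not_lt.1 fun h' => hlow j h' hj.2
    have huvj : (level F c j).Adj u v := ⟨huv, hj.1⟩
    have hFj : level (F.deleteEdges {s(u, v)}) c j ⊔ edge u v = level F c j := by
      rw [level_deleteEdges, deleteEdges_sup_edge huvj]
    have hGj : ∀ {a b}, (level (G.deleteEdges {s(u, v)}) c j).Reachable a b →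
        (level F c j).Reachable a b := fun hab =>
      h.span j _ _ (hab.mono (level_mono (deleteEdges_le _) c le_rfl))
    rw [level_sup_edge, if_pos (hxy.2.trans hjj),
      reachable_exchange (x := u) (y := v) (fun h' => hsep (h'.mono (level_le _ _ _)))
        (by rw [hFj]; exact hGj (hxy.reachable.mono (level_mono le_rfl c hjj))), hFj]
    exact hGj hab

end IsLevelForest

end Graph

/-! ## Determinism -/

/-- Reachable states are defined through arbitrary executions, whereas the correctness lemmas
exhibit one execution. Determinism identifies the two, and `Mem.Outputs.unique` does the same for
the lists of changes. -/
theorem Exec.det {W : ℕ} {c : Cmd} {s s₁ : Mem} {t₁ : ℕ} (h₁ : Exec W c s s₁ t₁) :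
    ∀ {s₂ : Mem} {t₂ : ℕ}, Exec W c s s₂ t₂ → s₁ = s₂ ∧ t₁ = t₂ := by
  induction h₁ with
  | skip s => intro _ _ h; cases h; exact ⟨rfl, rfl⟩
  | setInt ha he =>
    intro _ _ h
    cases h with
    | setInt ha' he' =>
      rw [ha] at ha'; rw [he] at he'
      cases ha'; cases he'; exact ⟨rfl, rfl⟩
  | setReal ha he =>
    intro _ _ h
    cases h with
    | setReal ha' he' =>
      rw [ha] at ha'; rw [he] at he'
      cases ha'; cases he'; exact ⟨rfl, rfl⟩
  | seq _ _ ih₁ ih₂ =>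
    intro _ _ h
    cases h with
    | seq h₁ h₂ =>
      obtain ⟨rfl, rfl⟩ := ih₁ h₁
      obtain ⟨rfl, rfl⟩ := ih₂ h₂
      exact ⟨rfl, rfl⟩
  | iteTrue hb _ ih =>
    intro _ _ h
    cases h with
    | iteTrue hb' h' => obtain ⟨rfl, rfl⟩ := ih h'; exact ⟨rfl, rfl⟩
    | iteFalse hb' h' => rw [hb] at hb'; cases hb'
  | iteFalse hb _ ih =>
    intro _ _ h
    cases h with
    | iteTrue hb' h' => rw [hb] at hb'; cases hb'
    | iteFalse hb' h' => obtain ⟨rfl, rfl⟩ := ih h'; exact ⟨rfl, rfl⟩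
  | loopStop hb =>
    intro _ _ h
    cases h with
    | loopStop hb' => exact ⟨rfl, rfl⟩
    | loopStep hb' _ _ => rw [hb] at hb'; cases hb'
  | loopStep hb _ _ ih₁ ih₂ =>
    intro _ _ h
    cases h with
    | loopStop hb' => rw [hb] at hb'; cases hb'
    | loopStep hb' h₁ h₂ =>
      obtain ⟨rfl, rfl⟩ := ih₁ h₁
      obtain ⟨rfl, rfl⟩ := ih₂ h₂
      exact ⟨rfl, rfl⟩

theorem Change.encode_injective {n : ℕ} : Function.Injective (Change.encode (n := n)) := by
  rintro (⟨u, v⟩ | ⟨u, v⟩) (⟨u', v'⟩ | ⟨u', v'⟩) h <;>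
    simp_all [Change.encode, Fin.ext_iff]

theorem Mem.Outputs.unique {n : ℕ} {s : Mem} {cs cs' : List (Change n)} (h : s.Outputs cs)
    (h' : s.Outputs cs') : cs = cs' := by
  refine List.ext_getElem (h.1.symm.trans h'.1) fun i hi hi' => ?_
  exact Change.encode_injective ((h.2 i hi).symm.trans (h'.2 i hi'))

/-! ## Bounds on the contents of the memory -/

namespace Mem

theorem setInt_le {V : ℕ} {s : Mem} (h : ∀ a, s.int a ≤ V) (i : ℕ) {v : ℕ} (hv : v ≤ V) (a : ℕ) :
    (s.setInt i v).int a ≤ V := by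
  by_cases ha : a = i
  · subst ha; simpa [setInt] using hv
  · simpa [setInt, ha] using h a

theorem withArgs_le {V : ℕ} {s : Mem} (h : ∀ a, s.int a ≤ V) {u v : ℕ} (hu : u ≤ V)
    (hv : v ≤ V) (a : ℕ) : (s.withArgs u v).int a ≤ V :=
  setInt_le (setInt_le h 0 hu) 1 hv a

end Mem

theorem word_le {W v i : ℕ} (h : word W v = some i) : i ≤ W ∧ v = i := by
  unfold word at h
  split_ifs at h with h'
  cases h
  exact ⟨h', rfl⟩

theorem word_eq {W v : ℕ} (h : v ≤ W) : word W v = some v := if_pos h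

/-- A load returns whatever the cell holds, and the arguments passed to a program, such as `n`, may
exceed `W`. Hence the separate bound `V` on contents. -/
theorem IExpr.eval_le {W V : ℕ} (hWV : W ≤ V) {s : Mem} (hs : ∀ a, s.int a ≤ V) {e : IExpr}
    {i : ℕ} (h : e.eval W s = some i) : i ≤ V := by
  cases e with
  | const k => exact (word_le h).1.trans hWV
  | load a =>
    simp only [IExpr.eval, Option.bind_eq_some_iff, Option.some.injEq] at h
    obtain ⟨j, -, rfl⟩ := h
    exact hs j
  | add a b | sub a b | mul a b | div a b | mod a b =>
    simp only [IExpr.eval, Option.bind_eq_some_iff] at h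
    obtain ⟨j, -, j', -, h⟩ := h
    exact (word_le h).1.trans hWV

theorem Exec.int_le {W V : ℕ} (hWV : W ≤ V) {c : Cmd} {s s' : Mem} {t : ℕ}
    (h : Exec W c s s' t) (hs : ∀ a, s.int a ≤ V) : ∀ a, s'.int a ≤ V := by
  induction h with
  | skip => exact hs
  | setInt ha he => exact Mem.setInt_le hs _ (IExpr.eval_le hWV hs he)
  | setReal ha he => exact hs
  | seq _ _ ih₁ ih₂ => exact ih₂ (ih₁ hs)
  | iteTrue _ _ ih => exact ih hs
  | iteFalse _ _ ih => exact ih hs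
  | loopStop => exact hs
  | loopStep _ _ _ ih₁ ih₂ => exact ih₂ (ih₁ hs)

theorem ConnAlg.start_le (n : ℕ) (a : ℕ) : (ConnAlg.start n).int a ≤ n :=
  Mem.setInt_le (fun _ => Nat.zero_le _) 0 le_rfl a

theorem ConnAlg.Reach.int_le {A : ConnAlg} {W n V : ℕ} (hWV : W ≤ V) (hn : n ≤ V)
    {G : SimpleGraph (Fin n)} {s : Mem} (h : A.Reach W n G s) : ∀ a, s.int a ≤ V := by
  induction h with
  | init h => exact h.int_le hWV fun a => (start_le n a).trans hn
  | insert _ _ _ h ih => exact h.int_le hWV (Mem.withArgs_le ih (by omega) (by omega))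
  | delete _ _ h ih => exact h.int_le hWV (Mem.withArgs_le ih (by omega) (by omega))
  | query _ h ih => exact h.int_le hWV (Mem.withArgs_le ih (by omega) (by omega))

/-! ## Interleaved memories

Cell `a` of the `k`-th virtual memory is cell `(a + 1) * S + k`, where `k < S`. The cells below `S`
belong to no virtual memory. -/

namespace Mem

/-- The `k`-th virtual memory. -/
def slot (S k : ℕ) (s : Mem) : Mem :=
  ⟨fun a => s.int ((a + 1) * S + k), fun a => s.real ((a + 1) * S + k)⟩

/-- Replace the `k`-th virtual memory by `m`. -/
def putSlot (S k : ℕ) (s m : Mem) : Mem :=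
  ⟨fun i => if S ≤ i ∧ i % S = k then m.int (i / S - 1) else s.int i,
   fun i => if S ≤ i ∧ i % S = k then m.real (i / S - 1) else s.real i⟩

variable {S k : ℕ}

/-- The truncated subtraction is harmless: for `i < S` the quotient is `0`, the right-hand address
is at least `S`, and both sides fail. -/
theorem slot_addr_iff {i : ℕ} (hk : k < S) : (S ≤ i ∧ i % S = k) ↔ i = (i / S - 1 + 1) * S + k := by
  constructor
  · rintro ⟨h1, h2⟩
    have h3 : 1 ≤ i / S := (Nat.one_le_div_iff (by omega)).2 h1
    rw [Nat.sub_add_cancel h3]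
    conv_lhs => rw [← Nat.div_add_mod i S, h2, mul_comm]
  · intro h
    have h4 : (i / S - 1 + 1) * S = S * (i / S - 1 + 1) := mul_comm _ _
    constructor
    · rw [h]; nlinarith
    · rw [h, h4, Nat.mul_add_mod, Nat.mod_eq_of_lt hk]

theorem slot_addr_div {a : ℕ} (hk : k < S) : ((a + 1) * S + k) / S = a + 1 := by
  rw [mul_comm, Nat.mul_add_div (by omega), Nat.div_eq_of_lt hk, add_zero]

theorem slot_addr_mod {a : ℕ} (hk : k < S) : ((a + 1) * S + k) % S = k := by
  rw [mul_comm, Nat.mul_add_mod, Nat.mod_eq_of_lt hk]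

theorem le_slot_addr (S k a : ℕ) : S ≤ (a + 1) * S + k := by nlinarith

theorem slot_putSlot (hk : k < S) (s m : Mem) : slot S k (putSlot S k s m) = m := by
  cases m
  simp [slot, putSlot, le_slot_addr, slot_addr_mod hk, slot_addr_div hk]

theorem slot_putSlot_of_ne {k' : ℕ} (hk : k' < S) (h : k' ≠ k) (s m : Mem) :
    slot S k' (putSlot S k s m) = slot S k' s := by
  simp [slot, putSlot, slot_addr_mod hk, h]

theorem putSlot_slot (hk : k < S) (s : Mem) : putSlot S k s (slot S k s) = s := by
  cases s with | _ f g
  simp only [putSlot, slot, Mem.mk.injEq]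
  constructor <;> funext i <;> split_ifs with h
  · exact congrArg f ((slot_addr_iff hk).1 h).symm
  · rfl
  · exact congrArg g ((slot_addr_iff hk).1 h).symm
  · rfl

theorem putSlot_putSlot (s m m' : Mem) : putSlot S k (putSlot S k s m') m = putSlot S k s m := by
  simp only [putSlot, Mem.mk.injEq]
  constructor <;> funext i <;> split_ifs <;> rfl

theorem putSlot_int_of_lt {i : ℕ} (hi : i < S) (s m : Mem) : (putSlot S k s m).int i = s.int i := by
  simp [putSlot, hi]

theorem putSlot_real_of_lt {i : ℕ} (hi : i < S) (s m : Mem) :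
    (putSlot S k s m).real i = s.real i := by
  simp [putSlot, hi]

theorem slot_setInt_of_lt {i : ℕ} (hi : i < S) (v : ℕ) (s : Mem) :
    slot S k (s.setInt i v) = slot S k s := by
  simp only [slot, setInt, Mem.mk.injEq, and_true]
  funext a
  have := le_slot_addr S k a
  rw [Function.update_of_ne (by omega)]

theorem slot_setReal_of_lt {i : ℕ} (hi : i < S) (x : ℝ) (s : Mem) :
    slot S k (s.setReal i x) = slot S k s := by
  simp only [slot, setReal, Mem.mk.injEq, true_and]
  funext a
  have := le_slot_addr S k a
  rw [Function.update_of_ne (by omega)]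

/-- Division with remainder by `S` recovers the virtual cell from the address, so no other cell is
touched. -/
theorem setInt_slot_addr (hk : k < S) (i v : ℕ) (s : Mem) :
    s.setInt ((i + 1) * S + k) v = putSlot S k s ((slot S k s).setInt i v) := by
  conv_lhs => rw [← putSlot_slot hk s]
  simp only [putSlot, setInt, slot, Mem.mk.injEq, and_true]
  funext j
  by_cases hj : j = (i + 1) * S + k
  · subst hj
    simp [le_slot_addr, slot_addr_mod hk, slot_addr_div hk]
  · rw [Function.update_of_ne hj]
    split_ifs with h
    · rw [slot_addr_iff hk] at h
      rw [Function.update_of_ne]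
      rintro h'
      rw [h'] at h
      exact hj h
    · rfl

theorem setReal_slot_addr (hk : k < S) (i : ℕ) (x : ℝ) (s : Mem) :
    s.setReal ((i + 1) * S + k) x = putSlot S k s ((slot S k s).setReal i x) := by
  conv_lhs => rw [← putSlot_slot hk s]
  simp only [putSlot, setReal, slot, Mem.mk.injEq, true_and]
  funext j
  by_cases hj : j = (i + 1) * S + k
  · subst hj
    simp [le_slot_addr, slot_addr_mod hk, slot_addr_div hk]
  · rw [Function.update_of_ne hj]
    split_ifs with h
    · rw [slot_addr_iff hk] at h
      rw [Function.update_of_ne]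
      rintro h'
      rw [h'] at h
      exact hj h
    · rfl

end Mem

/-! ## Relocated programs

The stride is kept in cell `8`, the number of the virtual memory in cell `11`. -/

/-- The content of the integer cell `i`. -/
def var (i : ℕ) : IExpr := .load (.const i)

/-- The address of the cell `a` of the current virtual memory. -/
def slotAddr (a : IExpr) : IExpr := .add (.mul (.add a (.const 1)) (var 8)) (var 11)

/-- The expression, evaluated in the current virtual memory. -/
def IExpr.reloc : IExpr → IExpr
  | .const k => .const k
  | .load a => .load (slotAddr a.reloc)
  | .add a b => .add a.reloc b.reloc
  | .sub a b => .sub a.reloc b.reloc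
  | .mul a b => .mul a.reloc b.reloc
  | .div a b => .div a.reloc b.reloc
  | .mod a b => .mod a.reloc b.reloc

/-- The expression, evaluated in the current virtual memory. -/
def RExpr.reloc : RExpr → RExpr
  | .cast a => .cast a.reloc
  | .load a => .load (slotAddr a.reloc)
  | .add a b => .add a.reloc b.reloc
  | .sub a b => .sub a.reloc b.reloc
  | .mul a b => .mul a.reloc b.reloc
  | .div a b => .div a.reloc b.reloc

/-- The test, evaluated in the current virtual memory. -/
def Cond.reloc : Cond → Cond
  | .le a b => .le a.reloc b.reloc
  | .rle a b => .rle a.reloc b.reloc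
  | .neg b => .neg b.reloc
  | .and b c => .and b.reloc c.reloc

/-- The program, run on the current virtual memory. -/
def Cmd.reloc : Cmd → Cmd
  | .skip => .skip
  | .setInt a e => .setInt (slotAddr a.reloc) e.reloc
  | .setReal a e => .setReal (slotAddr a.reloc) e.reloc
  | .seq c d => .seq c.reloc d.reloc
  | .ite b c d => .ite b.reloc c.reloc d.reloc
  | .loop b c => .loop b.reloc c.reloc

theorem size_slotAddr (a : IExpr) : (slotAddr a).size = a.size + 8 := by
  simp [slotAddr, var, IExpr.size]

/-- Only `load` grows: together with the address computation, its one symbol becomes nine. -/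
theorem IExpr.size_reloc (e : IExpr) : e.reloc.size ≤ 10 * e.size := by
  induction e <;> simp only [IExpr.reloc, IExpr.size, size_slotAddr] <;> omega

theorem RExpr.size_reloc (e : RExpr) : e.reloc.size ≤ 10 * e.size := by
  induction e with
  | cast a | load a =>
    have := a.size_reloc
    simp only [RExpr.reloc, RExpr.size, size_slotAddr]
    omega
  | _ => simp only [RExpr.reloc, RExpr.size]; omega

theorem Cond.size_reloc (e : Cond) : e.reloc.size ≤ 10 * e.size := by
  induction e with
  | le a b | rle a b =>
    have := a.size_reloc
    have := b.size_reloc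
    simp only [Cond.reloc, Cond.size]
    omega
  | _ => simp only [Cond.reloc, Cond.size]; omega

section Reloc

variable {W V W' S k : ℕ} {s : Mem}

theorem eval_var (i : ℕ) (hi : i ≤ W) : (var i).eval W s = some (s.int i) := by
  simp [var, IExpr.eval, word_eq hi]

theorem eval_slotAddr {a : IExpr} {i : ℕ} (ha : a.eval W s = some i) (h8 : s.int 8 = S)
    (h11 : s.int 11 = k) (hS : 32 ≤ S) (hb : (i + 1) * S + k ≤ W) :
    (slotAddr a).eval W s = some ((i + 1) * S + k) := by
  have h1 : i + 1 ≤ (i + 1) * S := Nat.le_mul_of_pos_right _ (by omega)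
  have h2 : S ≤ (i + 1) * S := Nat.le_mul_of_pos_left _ (by omega)
  unfold slotAddr
  rw [IExpr.eval, IExpr.eval, IExpr.eval, ha, eval_var 8 (by omega), eval_var 11 (by omega), h8,
    h11]
  simp only [IExpr.eval, Option.bind_some, word_eq (show 1 ≤ W by omega),
    word_eq (show i + 1 ≤ W by omega), word_eq (show (i + 1) * S ≤ W by omega), word_eq hb]

/-- The machine with word bound `W'` and memory `s` can simulate, in its `k`-th virtual memory, the
machine with word bound `W` on memories with words at most `V`. -/
structure Simulates (W V W' S k : ℕ) (s : Mem) : Prop where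
  word_le : W ≤ V
  addr_le : (V + 2) * S ≤ W'
  stride_ge : 32 ≤ S
  lt : k < S
  stride : s.int 8 = S
  current : s.int 11 = k

namespace Simulates

theorem addr_bound (h : Simulates W V W' S k s) {i : ℕ} (hi : i ≤ V) : (i + 1) * S + k ≤ W' := by
  have := h.addr_le
  have := h.lt
  have : (i + 1) * S ≤ (V + 1) * S := Nat.mul_le_mul_right _ (by omega)
  nlinarith

theorem word_le' (h : Simulates W V W' S k s) : V ≤ W' := by
  have := h.addr_le
  have := h.stride_ge
  nlinarith

theorem putSlot (h : Simulates W V W' S k s) (m : Mem) :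
    Simulates W V W' S k (s.putSlot S k m) where
  word_le := h.word_le
  addr_le := h.addr_le
  stride_ge := h.stride_ge
  lt := h.lt
  stride := by
    have := h.stride_ge
    rw [Mem.putSlot_int_of_lt (by omega), h.stride]
  current := by
    have := h.stride_ge
    rw [Mem.putSlot_int_of_lt (by omega), h.current]

end Simulates

theorem IExpr.eval_reloc (h : Simulates W V W' S k s) (hV : ∀ a, (s.slot S k).int a ≤ V)
    (e : IExpr) : ∀ {i : ℕ}, e.eval W (s.slot S k) = some i → e.reloc.eval W' s = some i := by
  have hword : ∀ {i j}, word W i = some j → word W' i = some j := fun h' => by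
    obtain ⟨h1, h2⟩ := _root_.DynGraph.word_le h'
    rw [h2]
    exact word_eq (h1.trans (h.word_le.trans h.word_le'))
  induction e with
  | const k => exact hword
  | load a ih =>
    intro i hi
    simp only [IExpr.eval, Option.bind_eq_some_iff, Option.some.injEq] at hi
    obtain ⟨j, hj, rfl⟩ := hi
    rw [IExpr.reloc, IExpr.eval, eval_slotAddr (ih hj) h.stride h.current h.stride_ge
      (h.addr_bound (IExpr.eval_le h.word_le hV hj))]
    rfl
  | add a b iha ihb | sub a b iha ihb | mul a b iha ihb | div a b iha ihb | mod a b iha ihb =>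
    intro i hi
    simp only [IExpr.eval, Option.bind_eq_some_iff] at hi
    obtain ⟨j, hj, j', hj', hw⟩ := hi
    simp only [IExpr.reloc, IExpr.eval, iha hj, ihb hj', Option.bind_some, hword hw]

theorem RExpr.eval_reloc (h : Simulates W V W' S k s) (hV : ∀ a, (s.slot S k).int a ≤ V)
    (e : RExpr) : ∀ {x : ℝ}, e.eval W (s.slot S k) = some x → e.reloc.eval W' s = some x := by
  induction e with
  | cast a =>
    intro x hx
    simp only [RExpr.eval, Option.bind_eq_some_iff] at hx
    obtain ⟨i, hi, hx⟩ := hx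
    rw [RExpr.reloc, RExpr.eval, IExpr.eval_reloc h hV a hi]
    exact hx
  | load a =>
    intro x hx
    simp only [RExpr.eval, Option.bind_eq_some_iff] at hx
    obtain ⟨i, hi, hx⟩ := hx
    rw [RExpr.reloc, RExpr.eval, eval_slotAddr (IExpr.eval_reloc h hV a hi) h.stride h.current
      h.stride_ge (h.addr_bound (IExpr.eval_le h.word_le hV hi))]
    exact hx
  | add a b iha ihb | sub a b iha ihb | mul a b iha ihb | div a b iha ihb =>
    intro i hi
    simp only [RExpr.eval, Option.bind_eq_some_iff] at hi
    obtain ⟨j, hj, j', hj', hw⟩ := hi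
    simp only [RExpr.reloc, RExpr.eval, iha hj, ihb hj', Option.bind_some, hw]

theorem Cond.eval_reloc (h : Simulates W V W' S k s) (hV : ∀ a, (s.slot S k).int a ≤ V)
    (e : Cond) : ∀ {x : Bool}, e.eval W (s.slot S k) = some x → e.reloc.eval W' s = some x := by
  induction e with
  | le a b =>
    intro x hx
    simp only [Cond.eval, Option.bind_eq_some_iff] at hx
    obtain ⟨i, hi, j, hj, hx⟩ := hx
    simp only [Cond.reloc, Cond.eval, IExpr.eval_reloc h hV a hi, IExpr.eval_reloc h hV b hj,
      Option.bind_some, hx]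
  | rle a b =>
    intro x hx
    simp only [Cond.eval, Option.bind_eq_some_iff] at hx
    obtain ⟨i, hi, j, hj, hx⟩ := hx
    simp only [Cond.reloc, Cond.eval, RExpr.eval_reloc h hV a hi, RExpr.eval_reloc h hV b hj,
      Option.bind_some, hx]
  | neg b ih =>
    intro x hx
    simp only [Cond.eval, Option.bind_eq_some_iff] at hx
    obtain ⟨i, hi, hx⟩ := hx
    simp only [Cond.reloc, Cond.eval, ih hi, Option.bind_some, hx]
  | and a b iha ihb =>
    intro x hx
    simp only [Cond.eval, Option.bind_eq_some_iff] at hx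
    obtain ⟨i, hi, j, hj, hx⟩ := hx
    simp only [Cond.reloc, Cond.eval, iha hi, ihb hj, Option.bind_some, hx]

/-- The simulation goes step by step. The ground memory `s` is general in the induction because each
later part of the run starts from a memory whose slot has been replaced. `Exec.int_le` keeps the
contents below `V`, so the computed addresses fit into words of size `W'`. -/
theorem Exec.reloc {c : Cmd} {m m' : Mem} {t : ℕ} (hc : Exec W c m m' t) :
    ∀ {s : Mem}, Simulates W V W' S k s → (∀ a, m.int a ≤ V) → s.slot S k = m →
      ∃ t' ≤ 10 * t, Exec W' c.reloc s (s.putSlot S k m') t' := by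
  induction hc with
  | skip m =>
    rintro s h - rfl
    exact ⟨1, by omega, by rw [Mem.putSlot_slot h.lt]; exact .skip s⟩
  | @setInt m a e i v ha he =>
    rintro s h hV rfl
    rw [← Mem.setInt_slot_addr h.lt]
    refine ⟨_, ?_, .setInt (eval_slotAddr
      (a.eval_reloc h hV ha) h.stride h.current h.stride_ge
        (h.addr_bound (a.eval_le h.word_le hV ha))) (e.eval_reloc h hV he)⟩
    have := a.size_reloc
    have := e.size_reloc
    rw [size_slotAddr]
    omega
  | @setReal m a e i v ha he =>
    rintro s h hV rfl
    rw [← Mem.setReal_slot_addr h.lt]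
    refine ⟨_, ?_, .setReal (eval_slotAddr
      (a.eval_reloc h hV ha) h.stride h.current h.stride_ge
        (h.addr_bound (a.eval_le h.word_le hV ha))) (e.eval_reloc h hV he)⟩
    have := a.size_reloc
    have := e.size_reloc
    rw [size_slotAddr]
    omega
  | seq h₁ h₂ ih₁ ih₂ =>
    intro s h hV hm
    obtain ⟨t₁, ht₁, e₁⟩ := ih₁ h hV hm
    obtain ⟨t₂, ht₂, e₂⟩ := ih₂ (h.putSlot _) (h₁.int_le h.word_le hV) (Mem.slot_putSlot h.lt _ _)
    rw [Mem.putSlot_putSlot] at e₂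
    exact ⟨_, by omega, .seq e₁ e₂⟩
  | @iteTrue b c d m m' t hb _ ih =>
    rintro s h hV rfl
    obtain ⟨t₁, ht₁, e₁⟩ := ih h hV rfl
    have := b.size_reloc
    exact ⟨_, by omega, .iteTrue (b.eval_reloc h hV hb) e₁⟩
  | @iteFalse b c d m m' t hb _ ih =>
    rintro s h hV rfl
    obtain ⟨t₁, ht₁, e₁⟩ := ih h hV rfl
    have := b.size_reloc
    exact ⟨_, by omega, .iteFalse (b.eval_reloc h hV hb) e₁⟩
  | @loopStop b c m hb =>
    rintro s h hV rfl
    have := b.size_reloc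
    refine ⟨1 + b.reloc.size, by omega, ?_⟩
    rw [Mem.putSlot_slot h.lt]
    exact .loopStop (b.eval_reloc h hV hb)
  | @loopStep b c m m' m'' t t' hb h₁ h₂ ih₁ ih₂ =>
    rintro s h hV rfl
    obtain ⟨t₁, ht₁, e₁⟩ := ih₁ h hV rfl
    obtain ⟨t₂, ht₂, e₂⟩ := ih₂ (h.putSlot _) (h₁.int_le h.word_le hV) (Mem.slot_putSlot h.lt _ _)
    rw [Mem.putSlot_putSlot] at e₂
    have := b.size_reloc
    exact ⟨_, by omega, .loopStep (b.eval_reloc h hV hb) e₁ e₂⟩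

end Reloc

/-! ## Total correctness with time bounds -/

/-- The program `c`, started on `s`, halts within `t` steps on a memory with the property `Q`. -/
def Runs (W : ℕ) (c : Cmd) (s : Mem) (t : ℕ) (Q : Mem → Prop) : Prop :=
  ∃ s' t', Exec W c s s' t' ∧ t' ≤ t ∧ Q s'

namespace Runs

variable {W : ℕ} {c d : Cmd} {s : Mem} {t t₁ t₂ : ℕ} {P Q : Mem → Prop}

theorem weaken (h : Runs W c s t₁ P) (ht : t₁ ≤ t) (hPQ : ∀ s', P s' → Q s') : Runs W c s t Q := by
  obtain ⟨s', t', he, ht', hP⟩ := h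
  exact ⟨s', t', he, ht'.trans ht, hPQ s' hP⟩

theorem mono_time (h : Runs W c s t₁ Q) (ht : t₁ ≤ t) : Runs W c s t Q := h.weaken ht fun _ h => h

theorem seq (h : Runs W c s t₁ P) (h' : ∀ s', P s' → Runs W d s' t₂ Q) :
    Runs W (.seq c d) s (t₁ + t₂) Q := by
  obtain ⟨s', t', he, ht', hP⟩ := h
  obtain ⟨s'', t'', he', ht'', hQ⟩ := h' s' hP
  exact ⟨s'', _, .seq he he', by omega, hQ⟩

theorem setInt {a e : IExpr} {i v : ℕ} (ha : a.eval W s = some i) (he : e.eval W s = some v)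
    (h : Q (s.setInt i v)) : Runs W (.setInt a e) s (1 + a.size + e.size) Q :=
  ⟨_, _, .setInt ha he, le_rfl, h⟩

theorem setReal {a : IExpr} {e : RExpr} {i : ℕ} {v : ℝ} (ha : a.eval W s = some i)
    (he : e.eval W s = some v) (h : Q (s.setReal i v)) :
    Runs W (.setReal a e) s (1 + a.size + e.size) Q :=
  ⟨_, _, .setReal ha he, le_rfl, h⟩

theorem iteTrue {b : Cond} (hb : b.eval W s = some true) (h : Runs W c s t Q) :
    Runs W (.ite b c d) s (1 + b.size + t) Q := by
  obtain ⟨s', t', he, ht', hQ⟩ := h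
  exact ⟨s', _, .iteTrue hb he, by omega, hQ⟩

theorem iteFalse {b : Cond} (hb : b.eval W s = some false) (h : Runs W d s t Q) :
    Runs W (.ite b c d) s (1 + b.size + t) Q := by
  obtain ⟨s', t', he, ht', hQ⟩ := h
  exact ⟨s', _, .iteFalse hb he, by omega, hQ⟩

/-- A loop with an invariant `I m` that mentions a bound `m` on the number of iterations left. -/
theorem loop {b : Cond} {I : ℕ → Mem → Prop}
    (h : ∀ m s, I m s → (b.eval W s = some false ∧ Q s) ∨
      ∃ m', m = m' + 1 ∧ b.eval W s = some true ∧ Runs W c s t (I m')) (m : ℕ) :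
    ∀ {s : Mem}, I m s → Runs W (.loop b c) s (m * (1 + b.size + t) + (1 + b.size)) Q := by
  induction m with
  | zero =>
    intro s hI
    rcases h 0 s hI with ⟨hb, hQ⟩ | ⟨m', hm, -⟩
    · exact ⟨s, _, .loopStop hb, by omega, hQ⟩
    · omega
  | succ m ih =>
    intro s hI
    rcases h _ s hI with ⟨hb, hQ⟩ | ⟨m', hm, hb, s', t', he, ht', hI'⟩
    · exact ⟨s, _, .loopStop hb, by omega, hQ⟩
    · obtain rfl : m = m' := by omega
      obtain ⟨s'', t'', he', ht'', hQ⟩ := ih hI'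
      refine ⟨s'', _, .loopStep hb he he', ?_, hQ⟩
      rw [Nat.succ_mul]
      omega

end Runs

/-! ### Evaluation rules for expressions and tests -/

section Eval

variable {W : ℕ} {s : Mem} {a b : IExpr} {i j : ℕ}

theorem eval_const (h : i ≤ W) : (IExpr.const i).eval W s = some i := word_eq h

theorem eval_var' (hi : i ≤ W) (h : s.int i = j) : (var i).eval W s = some j := by
  rw [eval_var i hi, h]

theorem eval_add (ha : a.eval W s = some i) (hb : b.eval W s = some j) (h : i + j ≤ W) :
    (IExpr.add a b).eval W s = some (i + j) := by
  simp [IExpr.eval, ha, hb, word_eq h]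

theorem eval_sub (ha : a.eval W s = some i) (hb : b.eval W s = some j) (h : i - j ≤ W) :
    (IExpr.sub a b).eval W s = some (i - j) := by
  simp [IExpr.eval, ha, hb, word_eq h]

theorem eval_mul (ha : a.eval W s = some i) (hb : b.eval W s = some j) (h : i * j ≤ W) :
    (IExpr.mul a b).eval W s = some (i * j) := by
  simp [IExpr.eval, ha, hb, word_eq h]

theorem eval_load (ha : a.eval W s = some i) : (IExpr.load a).eval W s = some (s.int i) := by
  simp [IExpr.eval, ha]

theorem eval_rload (ha : a.eval W s = some i) : (RExpr.load a).eval W s = some (s.real i) := by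
  simp [RExpr.eval, ha]

theorem eval_le (ha : a.eval W s = some i) (hb : b.eval W s = some j) :
    (Cond.le a b).eval W s = some (decide (i ≤ j)) := by
  simp [Cond.eval, ha, hb]

theorem eval_and {b c : Cond} {p q : Bool} (hb : b.eval W s = some p) (hc : c.eval W s = some q) :
    (Cond.and b c).eval W s = some (p && q) := by
  simp [Cond.eval, hb, hc]

theorem eval_neg {b : Cond} {p : Bool} (hb : b.eval W s = some p) :
    (Cond.neg b).eval W s = some (!p) := by
  simp [Cond.eval, hb]

end Eval

namespace Mem

theorem setInt_int (s : Mem) (i v j : ℕ) : (s.setInt i v).int j = if j = i then v else s.int j := by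
  simp [setInt, Function.update_apply]

theorem setInt_real (s : Mem) (i v j : ℕ) : (s.setInt i v).real j = s.real j := rfl

theorem setReal_int (s : Mem) (i : ℕ) (x : ℝ) (j : ℕ) : (s.setReal i x).int j = s.int j := rfl

theorem setReal_real (s : Mem) (i : ℕ) (x : ℝ) (j : ℕ) :
    (s.setReal i x).real j = if j = i then x else s.real j := by
  simp [setReal, Function.update_apply]

end Mem

/-- Assign `e` to the integer cell `i`. -/
def setVar (i : ℕ) (e : IExpr) : Cmd := .setInt (.const i) e

/-- Increment the integer cell `i`. -/
def incr (i : ℕ) : Cmd := setVar i (.add (var i) (.const 1))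

theorem Runs.setVar {W : ℕ} {s : Mem} {i v : ℕ} {e : IExpr} {Q : Mem → Prop} (hi : i ≤ W)
    (he : e.eval W s = some v) (h : Q (s.setInt i v)) : Runs W (setVar i e) s (2 + e.size) Q :=
  (Runs.setInt (eval_const hi) he h).weaken (by simp [IExpr.size]) fun _ h => h

theorem Runs.incr {W : ℕ} {s : Mem} {i v : ℕ} {Q : Mem → Prop} (hi : i ≤ W) (h1 : s.int i = v)
    (hv : v + 1 ≤ W) (h : Q (s.setInt i (v + 1))) : Runs W (incr i) s 6 Q :=
  Runs.setVar hi (eval_add (eval_var' hi h1) (eval_const (by omega)) hv) h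

/-- The content of the cell `a` is not the successor of the content of the cell `b`. -/
def neSucc (a b : ℕ) : Cond :=
  .neg (.and (.le (var a) (.add (var b) (.const 1))) (.le (.add (var b) (.const 1)) (var a)))

theorem eval_neSucc {W : ℕ} {s : Mem} {a b i j : ℕ} (ha : a ≤ W) (hb : b ≤ W) (hi : s.int a = i)
    (hj : s.int b = j) (hW : j + 1 ≤ W) :
    (neSucc a b).eval W s = some (decide (i ≠ j + 1)) := by
  have h1 := eval_add (eval_var' hb hj) (eval_const (by omega)) hW
  have h2 := eval_var' ha hi
  rw [neSucc, eval_neg (eval_and (eval_le h2 h1) (eval_le h1 h2))]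
  by_cases h : i = j + 1
  · simp [h]
  · simp only [ne_eq, h, not_false_eq_true, decide_true, Option.some.injEq, Bool.not_eq_true',
      Bool.and_eq_false_iff, decide_eq_false_iff_not]
    omega

/-! ## The ground memory -/

/-- Only the cells in `X` among the integer cells below `32` may change; the real cell `2` and the
virtual memory `0` do not change. -/
structure Frame (S : ℕ) (X : Finset ℕ) (s s' : Mem) : Prop where
  int : ∀ i < 32, i ∉ X → s'.int i = s.int i
  real : s'.real 2 = s.real 2
  table : s'.slot S 0 = s.slot S 0

namespace Frame

variable {S : ℕ} {X Y : Finset ℕ} {s s' s'' : Mem}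

theorem refl (S : ℕ) (X : Finset ℕ) (s : Mem) : Frame S X s s := ⟨fun _ _ _ => rfl, rfl, rfl⟩

theorem trans (h : Frame S X s s') (h' : Frame S X s' s'') : Frame S X s s'' :=
  ⟨fun i hi hX => (h'.int i hi hX).trans (h.int i hi hX), h'.real.trans h.real,
    h'.table.trans h.table⟩

theorem mono (h : Frame S X s s') (hXY : X ⊆ Y) : Frame S Y s s' :=
  ⟨fun i hi hY => h.int i hi fun hX => hY (hXY hX), h.real, h.table⟩

theorem setInt (h : Frame S X s s') (hS : 32 ≤ S) {i : ℕ} (hi : i < 32) (hX : i ∈ X) (v : ℕ) :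
    Frame S X s (s'.setInt i v) := by
  refine ⟨fun j hj hjX => ?_, h.real, ?_⟩
  · rw [Mem.setInt_int, if_neg (by rintro rfl; exact hjX hX), h.int j hj hjX]
  · rw [Mem.slot_setInt_of_lt (by omega), h.table]

theorem putSlot (h : Frame S X s s') (hS : 32 ≤ S) {k : ℕ} (hk : k ≠ 0) (m : Mem) :
    Frame S X s (s'.putSlot S k m) := by
  refine ⟨fun j hj hjX => ?_, ?_, ?_⟩
  · rw [Mem.putSlot_int_of_lt (by omega), h.int j hj hjX]
  · rw [Mem.putSlot_real_of_lt (by omega), h.real]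
  · rw [Mem.slot_putSlot_of_ne (by omega) hk.symm, h.table]

end Frame

/-! ## Answers to queries -/

section Answers

variable {n : ℕ} {G f : SimpleGraph (Fin n)}

theorem IsAnswer.eq_zero_iff (hf : IsMaximalSpanningForest G f) {u v : Fin n} {r : ℕ}
    (h : IsAnswer f u v r) : r = 0 ↔ ¬ G.Reachable u v := by
  rw [← hf.2.2]
  rcases h with ⟨h1, h2⟩ | ⟨p, -, h2⟩
  · simp [h1, h2]
  · simp [p.reachable, h2]

/-- The answer to a query between the ends of a path of length at most `2 ^ m` either exhibits an
edge or halves the path. -/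
theorem IsAnswer.cases (hf : f.IsAcyclic) {x y : Fin n} (hxy : x ≠ y) {a m : ℕ}
    (h : IsAnswer f x y a) {r : f.Walk x y} (hr : r.IsPath) (hm : r.length ≤ 2 ^ m) :
    (a = x + 1 ∧ f.Adj x y ∧ s(x, y) ∈ r.edges) ∨
    (a ≠ x + 1 ∧ ∃ m', m = m' + 1 ∧ ∃ z : Fin n, a = z + 1 ∧
      (∃ r₁ : f.Walk x z, r₁.IsPath ∧ r₁.length ≤ 2 ^ m' ∧ r₁.edges ⊆ r.edges) ∧
      (∃ r₂ : f.Walk z y, r₂.IsPath ∧ r₂.length ≤ 2 ^ m' ∧ r₂.edges ⊆ r.edges)) := by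
  rcases h with ⟨h1, -⟩ | ⟨p, hp, ha⟩
  · exact absurd r.reachable h1
  · have hpr : p = r := congrArg Subtype.val ((hf.subsingleton_path x y).elim ⟨p, hp⟩ ⟨r, hr⟩)
    subst hpr
    have h0 : p.length ≠ 0 := fun h0 => hxy (Walk.eq_of_length_eq_zero h0)
    by_cases h1 : p.length = 1
    · left
      obtain ⟨hadj, rfl⟩ : ∃ h : f.Adj x y, p = .cons h .nil := by
        cases p with
        | nil => simp at h0
        | cons h q =>
          cases q with
          | nil => exact ⟨h, rfl⟩
          | cons _ _ => simp at h1
      refine ⟨by simpa using ha, hadj, by simp⟩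
    · right
      -- On a path with at least two edges the midpoint has number at least `1`, so it is not the
      -- start. This is how an answer distinguishes an edge from a longer path.
      have hne : p.getVert (p.length / 2) ≠ x := by
        intro he
        have := (hp.getVert_eq_start_iff (by omega)).1 he
        omega
      refine ⟨fun h' => hne (Fin.ext (by omega)), ?_⟩
      -- Length at least `2` excludes `m = 0`. The two parts have `⌊ℓ / 2⌋` and `⌈ℓ / 2⌉` edges, and
      -- the larger number is still at most `2 ^ m'`.
      cases m with
      | zero => simp only [pow_zero] at hm; omega
      | succ m' =>
        rw [pow_succ] at hm
        refine ⟨m', rfl, _, ha, ⟨p.take (p.length / 2), hp.take _, ?_, ?_⟩,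
          ⟨p.drop (p.length / 2), hp.drop _, ?_, ?_⟩⟩
        · rw [← Walk.length_edges, Walk.edges_take, List.length_take]; omega
        · exact fun e he => (Walk.isSubwalk_take p _).edges_subset he
        · rw [← Walk.length_edges, Walk.edges_drop, List.length_drop, Walk.length_edges]; omega
        · exact fun e he => (Walk.isSubwalk_drop p _).edges_subset he

/-- The midpoint of a single edge is its first vertex. Thus one query to the copy that holds `F`
decides whether a deleted edge belongs to `F`. -/
theorem IsAnswer.eq_succ_iff (hf : f.IsAcyclic) {x y : Fin n} (hxy : x ≠ y) {a : ℕ}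
    (h : IsAnswer f x y a) : a = x + 1 ↔ f.Adj x y := by
  rcases h with ⟨h1, rfl⟩ | ⟨p, hp, ha⟩
  · simpa using fun h => h1 (Adj.reachable h)
  · rcases IsAnswer.cases hf hxy (.inr ⟨p, hp, ha⟩) hp Nat.lt_two_pow_self.le with
      ⟨h1, h2, -⟩ | ⟨h1, -⟩
    · exact iff_of_true h1 h2
    · refine iff_of_false h1 fun hadj => h1 ?_
      have : p = .cons hadj .nil := congrArg Subtype.val
        ((hf.subsingleton_path x y).elim ⟨p, hp⟩ (Path.singleton hadj))
      rw [ha, this]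
      simp

end Answers

/-! ## Operations on the copies of the connectivity data structure -/

/-- The operation `c` of a connectivity data structure, called with the arguments `u` and `v`, takes
the graph `G` to the graph `G'` within `τ` steps. -/
def ConnAlg.Updates (A : ConnAlg) (W n τ : ℕ) (c : Cmd) (u v : Fin n)
    (G G' : SimpleGraph (Fin n)) : Prop :=
  ∀ m, A.Reach W n G m → ∃ m' t, Exec W c (m.withArgs u v) m' t ∧ t ≤ τ ∧ A.Reach W n G' m'

/-- `A` is a connectivity data structure for graphs with `n` vertices and words at most `W`. A
machine with words at most `W'` has room for `K + 32` copies of its memory. -/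
structure ConnAlg.Fits (A : ConnAlg) (n W V K W' τ : ℕ) (forest : Mem → SimpleGraph (Fin n)) :
    Prop where
  word_le : W ≤ V
  card_le : n ≤ V
  addr_le : (V + 3) * (K + 32) ≤ W'
  table_le : n * n * (K + 32) ≤ W'
  spanning : ∀ G m, A.Reach W n G m → IsMaximalSpanningForest G (forest m)
  insert : ∀ G u v, u ≠ v → ¬ G.Adj u v → A.Updates W n τ A.insert u v G (G ⊔ edge u v)
  delete : ∀ G u v, G.Adj u v → A.Updates W n τ A.delete u v G (G.deleteEdges {s(u, v)})
  query : ∀ G m (u v : Fin n), A.Reach W n G m →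
    ∃ m' t, Exec W A.query (m.withArgs u v) m' t ∧ t ≤ τ ∧
    A.Reach W n G m' ∧ IsAnswer (forest m) u v (m'.int 0) ∧ forest m' = forest m

/-- The `k`-th virtual memory holds a copy of `A` for the graph `H k`, for `1 ≤ k ≤ K + 2`. -/
def ConnAlg.Copies (A : ConnAlg) {n : ℕ} (W K : ℕ) (H : ℕ → SimpleGraph (Fin n)) (s : Mem) : Prop :=
  ∀ k, 1 ≤ k → k ≤ K + 2 → A.Reach W n (H k) (s.slot (K + 32) k)

/-- The cells that hold the parameters. -/
structure HasParams (n K : ℕ) (ε : ℝ) (s : Mem) : Prop where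
  stride : s.int 8 = K + 32
  card : s.int 9 = n
  classes : s.int 10 = K
  ratio : s.real 2 = 1 + ε

/-- Call the operation `c` of the copy with the number `e`, with the arguments in the cells `a` and
`b`. -/
def callAt (e : IExpr) (c : Cmd) (a b : ℕ) : Cmd :=
  .seq (setVar 11 e) (.seq (.setInt (slotAddr (.const 0)) (var a))
    (.seq (.setInt (slotAddr (.const 1)) (var b)) c.reloc))

/-- Query the copy with the number `e` about the vertices in the cells `a` and `b`; write the answer
into the cell `r`. -/
def queryAt (A : ConnAlg) (e : IExpr) (a b r : ℕ) : Cmd :=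
  .seq (callAt e A.query a b) (setVar r (.load (slotAddr (.const 0))))

theorem HasParams.frame {n K : ℕ} {ε : ℝ} {s s' : Mem} (h : HasParams n K ε s) {X : Finset ℕ}
    (hf : Frame (K + 32) X s s') (h8 : 8 ∉ X) (h9 : 9 ∉ X) (h10 : 10 ∉ X) : HasParams n K ε s' :=
  ⟨(hf.int 8 (by norm_num) h8).trans h.stride, (hf.int 9 (by norm_num) h9).trans h.card,
    (hf.int 10 (by norm_num) h10).trans h.classes, hf.real.trans h.ratio⟩

namespace ConnAlg

variable {A : ConnAlg} {n W V K W' τ : ℕ} {forest : Mem → SimpleGraph (Fin n)} {s : Mem}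
  {H : ℕ → SimpleGraph (Fin n)} {ε : ℝ}

theorem Copies.congr {H' : ℕ → SimpleGraph (Fin n)} (h : A.Copies W K H s)
    (hH : ∀ k, 1 ≤ k → k ≤ K + 2 → H k = H' k) : A.Copies W K H' s :=
  fun k h1 h2 => hH k h1 h2 ▸ h k h1 h2

theorem Copies.setInt (h : A.Copies W K H s) {i : ℕ} (hi : i < 32) (v : ℕ) :
    A.Copies W K H (s.setInt i v) :=
  fun k h1 h2 => by rw [Mem.slot_setInt_of_lt (by omega)]; exact h k h1 h2

theorem Copies.putSlot (h : A.Copies W K H s) {k : ℕ} {m : Mem} {G : SimpleGraph (Fin n)}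
    (hm : A.Reach W n G m) : A.Copies W K (Function.update H k G) (s.putSlot (K + 32) k m) := by
  intro k' h1 h2
  by_cases hk : k' = k
  · subst hk
    rw [Mem.slot_putSlot (by omega), Function.update_self]
    exact hm
  · rw [Mem.slot_putSlot_of_ne (by omega) hk, Function.update_of_ne hk]
    exact h k' h1 h2

namespace Fits

/-- The factor `3` makes room for the argument cell `1` of a copy, whose address is `2 * (K + 32) +
k` with `k < K + 32`. This is why `addr_le` asks for `V + 3` rather than the `V + 2` that a
simulation needs. -/
theorem small_le (h : A.Fits n W V K W' τ forest) : 3 * (K + 32) ≤ W' ∧ 32 * (n + 2) ≤ W' := by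
  have h1 := h.addr_le
  have h2 := h.card_le
  constructor <;> nlinarith

theorem addr_le' (h : A.Fits n W V K W' τ forest) : (V + 2) * (K + 32) ≤ W' :=
  (Nat.mul_le_mul_right _ (Nat.le_succ _)).trans h.addr_le

/-- The arguments are written into the cells `0` and `1` of the virtual memory, where the relocated
program expects them. Neither may come from cell `11`, which is overwritten by the number of the
copy before they are read. -/
theorem runs_callAt (hA : A.Fits n W V K W' τ forest) (hs : HasParams n K ε s) {e : IExpr} {c : Cmd}
    {a b k u v : ℕ} (he : e.eval W' s = some k) (hk : k ≤ K + 2) (ha : a < 32) (hb : b < 32)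
    (ha' : a ≠ 11) (hb' : b ≠ 11) (hu : s.int a = u) (hv : s.int b = v) (huV : u ≤ V) (hvV : v ≤ V)
    (hV : ∀ i, (s.slot (K + 32) k).int i ≤ V) {m' : Mem} {t : ℕ}
    (hc : Exec W c ((s.slot (K + 32) k).withArgs u v) m' t) {Q : Mem → Prop}
    (hQ : Q ((s.setInt 11 k).putSlot (K + 32) k m')) :
    Runs W' (callAt e c a b) s (10 * t + 26 + e.size) Q := by
  obtain ⟨hK, -⟩ := hA.small_le
  have hsim : Simulates W V W' (K + 32) k (s.setInt 11 k) :=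
    ⟨hA.word_le, hA.addr_le', by omega, by omega, by rw [Mem.setInt_int, if_neg (by omega), hs.stride],
      by rw [Mem.setInt_int, if_pos rfl]⟩
  have hslot : (s.setInt 11 k).slot (K + 32) k = s.slot (K + 32) k :=
    Mem.slot_setInt_of_lt (by omega) _ _
  have hword : V ≤ W' := hsim.word_le'
  have h0 := hsim.addr_bound (i := 0) (by omega)
  have h1 : (1 + 1) * (K + 32) + k ≤ W' := by omega
  unfold callAt
  set s₁ := s.setInt 11 k with hs₁
  set s₂ := s₁.putSlot (K + 32) k ((s₁.slot (K + 32) k).setInt 0 u) with hs₂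
  have hsim₂ : Simulates W V W' (K + 32) k s₂ := hsim.putSlot _
  have hs₃ : s₂.putSlot (K + 32) k ((s₂.slot (K + 32) k).setInt 1 v) =
      s₁.putSlot (K + 32) k ((s.slot (K + 32) k).withArgs u v) := by
    rw [hs₂, Mem.slot_putSlot hsim.lt, Mem.putSlot_putSlot, hslot]
    rfl
  have hua : s₁.int a = u := by rw [hs₁, Mem.setInt_int, if_neg ha', hu]
  have hvb : s₂.int b = v := by
    rw [hs₂, Mem.putSlot_int_of_lt (by omega), hs₁, Mem.setInt_int, if_neg hb', hv]
  refine Runs.weaken (Runs.seq (P := fun x => x = s₁) (Runs.setVar (by omega) he rfl) ?_)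
    (t₁ := 2 + e.size + (12 + (12 + 10 * t))) (by omega) fun _ h => h
  rintro _ rfl
  refine Runs.seq (P := fun x => x = s₂) (Runs.setInt (eval_slotAddr (eval_const (by omega))
    hsim.stride hsim.current hsim.stride_ge h0) (eval_var' (by omega) hua)
    (Mem.setInt_slot_addr hsim.lt _ _ _)) ?_
  rintro _ rfl
  refine Runs.seq (P := fun x => x = s₁.putSlot (K + 32) k ((s.slot (K + 32) k).withArgs u v))
    (Runs.setInt (eval_slotAddr (eval_const (by omega))
    hsim₂.stride hsim₂.current hsim₂.stride_ge h1) (eval_var' (by omega) hvb)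
    ((Mem.setInt_slot_addr hsim.lt _ _ _).trans hs₃)) ?_
  rintro _ rfl
  obtain ⟨t', ht', hx⟩ := hc.reloc (hsim.putSlot _) (Mem.withArgs_le hV huV hvV)
    (Mem.slot_putSlot hsim.lt _ _)
  rw [Mem.putSlot_putSlot] at hx
  exact ⟨_, t', hx, ht', hQ⟩

theorem runs_update (hA : A.Fits n W V K W' τ forest) (hs : HasParams n K ε s)
    (hH : A.Copies W K H s) {e : IExpr} {c : Cmd} {a b k : ℕ} {u v : Fin n}
    {G' : SimpleGraph (Fin n)} (he : e.eval W' s = some k) (hes : e.size ≤ 4) (hk1 : 1 ≤ k)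
    (hk : k ≤ K + 2) (ha : a < 32) (hb : b < 32) (ha' : a ≠ 11) (hb' : b ≠ 11) (hu : s.int a = u)
    (hv : s.int b = v) (hc : A.Updates W n τ c u v (H k) G') :
    Runs W' (callAt e c a b) s (10 * τ + 30) fun s' =>
      Frame (K + 32) {11} s s' ∧ A.Copies W K (Function.update H k G') s' := by
  obtain ⟨m', t, hx, ht, hr⟩ := hc _ (hH k hk1 hk)
  have := hA.card_le
  refine (hA.runs_callAt hs he hk ha hb ha' hb' hu hv (by omega) (by omega)
    ((hH k hk1 hk).int_le hA.word_le hA.card_le) hx ⟨?_, ?_⟩).weaken (by omega) fun _ h => h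
  · exact ((Frame.refl _ _ s).setInt (by omega) (by norm_num) (by simp) _).putSlot (by omega)
      (by omega) _
  · exact (hH.setInt (by norm_num) _).putSlot hr

theorem runs_query (hA : A.Fits n W V K W' τ forest) (hs : HasParams n K ε s)
    (hH : A.Copies W K H s) {e : IExpr} {a b k r : ℕ} {u v : Fin n}
    (he : e.eval W' s = some k) (hes : e.size ≤ 4) (hk1 : 1 ≤ k)
    (hk : k ≤ K + 2) (ha : a < 32) (hb : b < 32) (ha' : a ≠ 11) (hb' : b ≠ 11) (hu : s.int a = u)
    (hv : s.int b = v) (hr : r < 32) :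
    Runs W' (queryAt A e a b r) s (10 * τ + 42) fun s' =>
      Frame (K + 32) {11, r} s s' ∧ A.Copies W K H s' ∧
      (∀ k', 1 ≤ k' → k' ≤ K + 2 →
        forest (s'.slot (K + 32) k') = forest (s.slot (K + 32) k')) ∧
      IsAnswer (forest (s.slot (K + 32) k)) u v (s'.int r) := by
  obtain ⟨m', t, hx, ht, hreach, hans, hfor⟩ := hA.query _ _ u v (hH k hk1 hk)
  have hn := hA.card_le
  obtain ⟨hK, -⟩ := hA.small_le
  refine (Runs.seq (P := fun x => x = (s.setInt 11 k).putSlot (K + 32) k m')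
    (hA.runs_callAt hs he hk ha hb ha' hb' hu hv (by omega) (by omega)
    ((hH k hk1 hk).int_le hA.word_le hA.card_le) hx rfl) ?_).weaken
    (t₁ := 10 * t + 26 + e.size + 12) (by omega) fun _ h => h
  rintro _ rfl
  have hf : Frame (K + 32) {11, r} s ((s.setInt 11 k).putSlot (K + 32) k m') :=
    ((Frame.refl _ _ s).setInt (by omega) (by norm_num) (by simp) _).putSlot (by omega)
      (by omega) _
  have hslot : ((s.setInt 11 k).putSlot (K + 32) k m').slot (K + 32) k = m' :=
    Mem.slot_putSlot (by omega) _ _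
  refine Runs.setVar (by omega) (eval_load (eval_slotAddr (eval_const (by omega)) ?_ ?_ (by omega)
    (i := 0) (S := K + 32) (k := k) (by omega))) ⟨?_, ?_, fun k' h1 h2 => ?_, ?_⟩
  · rw [Mem.putSlot_int_of_lt (by omega), Mem.setInt_int, if_neg (by omega), hs.stride]
  · rw [Mem.putSlot_int_of_lt (by omega), Mem.setInt_int, if_pos rfl]
  · exact hf.setInt (by omega) hr (by simp) _
  -- A query may change the memory of its copy but not the graph, so the family `H` is updated at
  -- `k` by its own value.
  · refine Copies.setInt (Copies.congr ((hH.setInt (by norm_num) _).putSlot hreach) ?_) hr _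
    intro k' _ _
    by_cases h : k' = k
    · subst h; simp
    · simp [h]
  · rw [Mem.slot_setInt_of_lt (by omega)]
    by_cases h : k' = k
    · rw [h, hslot, hfor]
    · rw [Mem.slot_putSlot_of_ne (by omega) h, Mem.slot_setInt_of_lt (by omega)]
  · rw [Mem.setInt_int, if_pos rfl]
    have : ((s.setInt 11 k).putSlot (K + 32) k m').int ((0 + 1) * (K + 32) + k) = m'.int 0 := by
      conv_rhs => rw [← hslot]
      rfl
    rw [this]
    exact hans

end Fits

end ConnAlg

/-! ## The search for the lowest level -/

/-- Find the lowest level at which the vertices in the cells `12` and `13` are connected. If there is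
one, then its successor is left in the cell `15`, and otherwise the cell `22` contains `0`. -/
def lowest (A : ConnAlg) : Cmd :=
  .seq (setVar 22 (.const 0)) (.seq (setVar 15 (.const 0))
    (.loop (.and (.le (var 15) (var 10)) (.le (var 22) (.const 0)))
      (.seq (queryAt A (.add (var 15) (.const 2)) 12 13 22) (incr 15))))

/-- Apply the operation `c` with the arguments in the cells `12` and `13` to the copies for the
levels from the one in the cell `14` upwards. -/
def forLevels (c : Cmd) : Cmd :=
  .seq (setVar 15 (var 14)) (.loop (.le (var 15) (var 10))
    (.seq (callAt (.add (var 15) (.const 2)) c 12 13) (incr 15)))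

/-- Binary search: find an edge of the path between the vertices in the cells `12` and `13` in the
forest of the copy with the number in the cell `19` whose ends are not connected in the graph of the
copy with the number in the cell `20`. Its ends are left in the cells `16` and `17`. -/
def search (A : ConnAlg) : Cmd :=
  .seq (setVar 16 (var 12)) (.seq (setVar 17 (var 13)) (.seq (queryAt A (var 19) 16 17 18)
    (.loop (neSucc 18 16)
      (.seq (setVar 18 (.sub (var 18) (.const 1))) (.seq (queryAt A (var 20) 16 18 21)
        (.seq (.ite (.le (var 21) (.const 0)) (setVar 17 (var 18)) (setVar 16 (var 18)))
          (queryAt A (var 19) 16 17 18)))))))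

namespace ConnAlg.Fits

variable {A : ConnAlg} {n W V K W' τ : ℕ} {forest : Mem → SimpleGraph (Fin n)} {s : Mem}
  {H : ℕ → SimpleGraph (Fin n)} {ε : ℝ} {u v : Fin n}

/-- Cell `15` is incremented after the successful query too, so it ends at `j₀ + 1`. Failure is
recorded as `j₀ = K + 1`, which lets one statement cover all levels that do not connect `u` and `v`.
-/
theorem runs_lowest (hA : A.Fits n W V K W' τ forest) (hs : HasParams n K ε s)
    (hH : A.Copies W K H s) (hu : s.int 12 = u) (hv : s.int 13 = v) :
    Runs W' (lowest A) s ((K + 2) * (10 * τ + 60)) fun s' =>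
      Frame (K + 32) {11, 15, 22} s s' ∧ A.Copies W K H s' ∧
      ∃ j₀ ≤ K + 1, (∀ j < j₀, ¬ (H (j + 2)).Reachable u v) ∧
        ((s'.int 22 = 0 ∧ j₀ = K + 1) ∨
          (s'.int 22 ≠ 0 ∧ s'.int 15 = j₀ + 1 ∧ j₀ ≤ K ∧ (H (j₀ + 2)).Reachable u v)) := by
  obtain ⟨hK, -⟩ := hA.small_le
  -- The number `m` counts the levels not yet queried; a success ends the loop through cell `22`,
  -- whatever `m` is.
  let I : ℕ → Mem → Prop := fun m s' =>
    Frame (K + 32) {11, 15, 22} s s' ∧ A.Copies W K H s' ∧ ∃ i, s'.int 15 = i ∧ i + m = K + 1 ∧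
      ((s'.int 22 = 0 ∧ ∀ j < i, ¬ (H (j + 2)).Reachable u v) ∨
        (s'.int 22 ≠ 0 ∧ ∃ j₀, i = j₀ + 1 ∧ (∀ j < j₀, ¬ (H (j + 2)).Reachable u v) ∧
          (H (j₀ + 2)).Reachable u v))
  refine (Runs.seq (P := fun x => x = s.setInt 22 0) (Runs.setVar (by omega) (eval_const (by omega))
    rfl) fun s₁ h₁ => Runs.seq (P := I (K + 1)) (Runs.setVar (by omega) (eval_const (i := 0)
    (by omega)) ?_) fun s₂ h₂ => Runs.loop (I := I) (t := 10 * τ + 48) ?_ _ h₂).weaken ?_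
    fun _ h => h
  · subst h₁
    refine ⟨((Frame.refl _ _ s).setInt (by omega) (by norm_num) (by simp) _).setInt (by omega)
      (by norm_num) (by simp) _, (hH.setInt (by norm_num) _).setInt (by norm_num) _, 0, ?_, by omega,
      Or.inl ⟨?_, fun j hj => absurd hj (by omega)⟩⟩ <;> simp [Mem.setInt_int]
  · rintro m s' ⟨hF, hC, i, h15, him, hcase⟩
    have hp := hs.frame hF (by simp) (by simp) (by simp)
    have h22 : (Cond.le (var 22) (.const 0)).eval W' s' = some (decide (s'.int 22 ≤ 0)) :=
      DynGraph.eval_le (eval_var _ (by omega)) (eval_const (by omega))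
    have hle : (Cond.le (var 15) (var 10)).eval W' s' = some (decide (i ≤ K)) :=
      DynGraph.eval_le (eval_var' (by omega) h15) (eval_var' (by omega) hp.classes)
    rcases hcase with ⟨h0, hlow⟩ | ⟨h0, j₀, hi, hlow, hr⟩
    · cases m with
      | zero =>
        left
        refine ⟨by rw [DynGraph.eval_and hle h22]; simp; omega, hF, hC, K + 1, by omega, ?_, Or.inl ⟨h0, rfl⟩⟩
        intro j hj
        exact hlow j (by omega)
      | succ m =>
        right
        refine ⟨m, rfl, by rw [DynGraph.eval_and hle h22]; simp; omega, ?_⟩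
        refine (Runs.seq (hA.runs_query hp hC (r := 22) (k := i + 2) (u := u) (v := v)
          (eval_add (eval_var' (by omega) h15) (eval_const (by omega)) (by omega)) (by
            simp [IExpr.size, var]) (by omega) (by omega) (by norm_num) (by norm_num) (by norm_num)
            (by norm_num) ?_ ?_ (by norm_num)) ?_).weaken (t₁ := 10 * τ + 42 + 6) (by omega)
            fun _ h => h
        · rw [hF.int 12 (by norm_num) (by simp), hu]
        · rw [hF.int 13 (by norm_num) (by simp), hv]
        · rintro s'' ⟨hF', hC', -, hans⟩
          have h15' : s''.int 15 = i := by rw [hF'.int 15 (by norm_num) (by simp), h15]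
          refine Runs.incr (by omega) h15' (by omega) ⟨?_, hC'.setInt (by norm_num) _, i + 1,
            by simp [Mem.setInt_int], by omega, ?_⟩
          · exact (hF.trans (hF'.mono (by simp [Finset.insert_subset_iff]))).setInt (by omega)
              (by norm_num) (by simp) _
          · have hz := hans.eq_zero_iff (hA.spanning _ _ (hC (i + 2) (by omega) (by omega)))
            rw [Mem.setInt_int, if_neg (by norm_num)]
            by_cases hr : (H (i + 2)).Reachable u v
            · exact Or.inr ⟨fun h => hz.1 h hr, i, rfl, hlow, hr⟩
            · refine Or.inl ⟨hz.2 hr, fun j hj => ?_⟩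
              rcases Nat.lt_succ_iff_lt_or_eq.1 hj with hj | rfl
              exacts [hlow j hj, hr]
    · left
      refine ⟨by rw [DynGraph.eval_and hle h22]; simp; omega, hF, hC, j₀, by omega, hlow, Or.inr
        ⟨h0, by omega, by omega, hr⟩⟩
  · simp only [Cond.size, IExpr.size, var]
    ring_nf
    omega

theorem runs_forLevels (hA : A.Fits n W V K W' τ forest) (hs : HasParams n K ε s)
    (hH : A.Copies W K H s) (hu : s.int 12 = u) (hv : s.int 13 = v) {i : ℕ} (hi : s.int 14 = i)
    (hiK : i ≤ K) {c : Cmd} {H' : ℕ → SimpleGraph (Fin n)}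
    (hc : ∀ j, i ≤ j → j ≤ K → A.Updates W n τ c u v (H (j + 2)) (H' (j + 2))) :
    Runs W' (forLevels c) s ((K + 2) * (10 * τ + 60)) fun s' =>
      Frame (K + 32) {11, 15} s s' ∧
      A.Copies W K (fun k => if i + 2 ≤ k then H' k else H k) s' := by
  obtain ⟨hK, -⟩ := hA.small_le
  let I : ℕ → Mem → Prop := fun m s' =>
    Frame (K + 32) {11, 15} s s' ∧ ∃ j, i ≤ j ∧ s'.int 15 = j ∧ j + m = K + 1 ∧
      A.Copies W K (fun k => if i + 2 ≤ k ∧ k < j + 2 then H' k else H k) s'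
  refine (Runs.seq (P := I (K + 1 - i)) (Runs.setVar (by omega) (eval_var' (by omega) hi)
    ?_) fun s₂ h₂ => Runs.loop (I := I) (t := 10 * τ + 36) ?_ _ h₂).weaken ?_
    fun _ h => h
  · refine ⟨(Frame.refl _ _ s).setInt (by omega) (by norm_num) (by simp) _, i, le_rfl,
      by simp [Mem.setInt_int], by omega, (hH.setInt (by norm_num) _).congr fun k _ _ => ?_⟩
    rw [if_neg (by omega)]
  · rintro m s' ⟨hF, j, hij, h15, hjm, hC⟩
    have hp := hs.frame hF (by simp) (by simp) (by simp)
    have hle : (Cond.le (var 15) (var 10)).eval W' s' = some (decide (j ≤ K)) :=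
      DynGraph.eval_le (eval_var' (by omega) h15) (eval_var' (by omega) hp.classes)
    cases m with
    | zero =>
      left
      refine ⟨by rw [hle]; simp; omega, hF, hC.congr fun k _ hk => ?_⟩
      by_cases h : i + 2 ≤ k
      · rw [if_pos ⟨h, by omega⟩, if_pos h]
      · rw [if_neg (by tauto), if_neg h]
    | succ m =>
      right
      refine ⟨m, rfl, by rw [hle]; simp; omega, ?_⟩
      refine (Runs.seq (hA.runs_update hp hC (k := j + 2) (u := u) (v := v) (G' := H' (j + 2))
        (eval_add (eval_var' (by omega) h15) (eval_const (by omega)) (by omega)) (by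
          simp [IExpr.size, var]) (by omega) (by omega) (by norm_num) (by norm_num) (by norm_num)
          (by norm_num) ?_ ?_ ?_) ?_).weaken (t₁ := 10 * τ + 30 + 6) (by omega) fun _ h => h
      · rw [hF.int 12 (by norm_num) (by simp), hu]
      · rw [hF.int 13 (by norm_num) (by simp), hv]
      · rw [if_neg (by omega)]
        exact hc j hij (by omega)
      · rintro s'' ⟨hF', hC'⟩
        have h15' : s''.int 15 = j := by rw [hF'.int 15 (by norm_num) (by simp), h15]
        refine Runs.incr (by omega) h15' (by omega) ⟨?_, j + 1, by omega,
          by simp [Mem.setInt_int], by omega, (hC'.setInt (by norm_num) _).congr fun k _ _ => ?_⟩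
        · exact (hF.trans (hF'.mono (by simp))).setInt (by omega) (by norm_num) (by simp) _
        · by_cases hk : k = j + 2
          · subst hk
            rw [Function.update_self, if_pos (by omega)]
          · rw [Function.update_of_ne hk]
            congr 1
            apply propext
            omega
  · have hm : K + 1 - i ≤ K + 1 := by omega
    have := Nat.mul_le_mul_right (1 + (Cond.le (var 15) (var 10)).size + (10 * τ + 36)) hm
    refine (add_le_add_right (add_le_add_left this _) _).trans ?_
    simp only [Cond.size, IExpr.size, var]
    ring_nf
    omega

/-- If `x` and `y` are not connected in `H q`, then the midpoint `z` is not connected there to one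
of them, so one half of the path inherits the property. After at most `m₀` halvings a single edge is
left. It lies on the original path of the forest, so its removal separates `u` from `v` there. -/
theorem runs_search (hA : A.Fits n W V K W' τ forest) (hs : HasParams n K ε s)
    (hH : A.Copies W K H s) (hu : s.int 12 = u) (hv : s.int 13 = v) {p q : ℕ}
    (hp : s.int 19 = p) (hq : s.int 20 = q) (hp1 : 1 ≤ p) (hpK : p ≤ K + 2) (hq1 : 1 ≤ q)
    (hqK : q ≤ K + 2) (hpr : (H p).Reachable u v) (hqr : ¬ (H q).Reachable u v) {m₀ : ℕ}
    (hm₀ : n ≤ 2 ^ m₀) :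
    Runs W' (search A) s ((m₀ + 1) * (20 * τ + 130)) fun s' =>
      Frame (K + 32) {11, 16, 17, 18, 21} s s' ∧ A.Copies W K H s' ∧
      ∃ x y : Fin n, s'.int 16 = x ∧ s'.int 17 = y ∧ ¬ (H q).Reachable x y ∧
        ∃ f, IsMaximalSpanningForest (H p) f ∧ f.Adj x y ∧
          ¬ (f.deleteEdges {s(x, y)}).Reachable u v := by
  obtain ⟨hK, hN⟩ := hA.small_le
  set f := forest (s.slot (K + 32) p) with hf
  have hfsp : IsMaximalSpanningForest (H p) f := hA.spanning _ _ (hH p hp1 hpK)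
  obtain ⟨p₀, hp₀⟩ := ((hfsp.2.2 u v).2 hpr).exists_isPath
  -- Queries rewrite the memories of the copies during the search; that the forest of copy `p`
  -- remains `f` is what makes the successive midpoints belong to one and the same path.
  let J : ℕ → Mem → Prop := fun m s' =>
    Frame (K + 32) {11, 16, 17, 18, 21} s s' ∧ A.Copies W K H s' ∧
      forest (s'.slot (K + 32) p) = f ∧
      ∃ x y : Fin n, s'.int 16 = x ∧ s'.int 17 = y ∧ ¬ (H q).Reachable x y ∧
        ∃ r : f.Walk x y, r.IsPath ∧ r.length ≤ 2 ^ m ∧ r.edges ⊆ p₀.edges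
  -- At the loop test, cell `18` must also hold the answer for the current ends.
  let I : ℕ → Mem → Prop := fun m s' => J m s' ∧
    ∀ x y : Fin n, s'.int 16 = x → s'.int 17 = y → IsAnswer f x y (s'.int 18)
  have hquery : ∀ m s', J m s' → Runs W' (queryAt A (var 19) 16 17 18) s' (10 * τ + 42) (I m) := by
    rintro m s' ⟨hF, hC, hfor, x, y, h16, h17, hxy, r, hr⟩
    refine (hA.runs_query (hs.frame hF (by simp) (by simp) (by simp)) hC (r := 18) (k := p)
      (u := x) (v := y) (eval_var' (by omega) ?_) (by simp [IExpr.size, var]) hp1 hpK (by norm_num)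
      (by norm_num) (by norm_num) (by norm_num) h16 h17 (by norm_num)).weaken le_rfl ?_
    · rw [hF.int 19 (by norm_num) (by simp), hp]
    · rintro s'' ⟨hF', hC', hfor', hans⟩
      have h16' := hF'.int 16 (by norm_num) (by simp)
      have h17' := hF'.int 17 (by norm_num) (by simp)
      refine ⟨⟨hF.trans (hF'.mono (by simp [Finset.insert_subset_iff])), hC',
        (hfor' p hp1 hpK).trans hfor, x, y, by rw [h16', h16], by rw [h17', h17], hxy, r, hr⟩, ?_⟩
      intro x' y' hx' hy'
      obtain rfl : x = x' := Fin.ext (by omega)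
      obtain rfl : y = y' := Fin.ext (by omega)
      rwa [hfor] at hans
  refine (Runs.seq (P := fun x => x = s.setInt 16 u) (Runs.setVar (by omega) (eval_var' (by omega)
    hu) rfl) fun s₁ h₁ => Runs.seq (P := J m₀) (Runs.setVar (v := v) (by omega)
    (eval_var' (by omega) ?_) ?_) fun s₂ h₂ => Runs.seq (hquery m₀ s₂ h₂) fun s₃ h₃ =>
    Runs.loop (I := I) (t := 20 * τ + 99) ?_ _ h₃).weaken ?_ fun _ h => h
  · subst h₁
    rw [Mem.setInt_int, if_neg (by norm_num), hv]
  · subst h₁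
    refine ⟨((Frame.refl _ _ s).setInt (by omega) (by norm_num) (by simp) _).setInt (by omega)
      (by norm_num) (by simp) _, (hH.setInt (by norm_num) _).setInt (by norm_num) _, ?_, u, v, ?_, ?_,
      hqr, p₀, hp₀, ?_, List.Subset.refl _⟩
    · rw [Mem.slot_setInt_of_lt (by omega), Mem.slot_setInt_of_lt (by omega)]
    · simp [Mem.setInt_int]
    · simp [Mem.setInt_int]
    · have := hp₀.length_lt
      rw [Fintype.card_fin] at this
      omega
  · rintro m s' ⟨⟨hF, hC, hfor, x, y, h16, h17, hxy, r, hrp, hrl, hre⟩, hans⟩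
    have hne : x ≠ y := by rintro rfl; exact hxy (Reachable.refl _)
    have hp' := hs.frame hF (by simp) (by simp) (by simp)
    have hb := eval_neSucc (W := W') (a := 18) (by omega) (by omega) rfl h16 (by omega)
    rcases (hans x y h16 h17).cases hfsp.2.1 hne hrp hrl with
      ⟨h18, hadj, hmem⟩ | ⟨h18, m', rfl, z, hz, ⟨r₁, hr₁⟩, ⟨r₂, hr₂⟩⟩
    · left
      refine ⟨by rw [hb, h18]; simp, hF, hC, x, y, h16, h17, hxy, f, hfsp, hadj, ?_⟩
      exact IsAcyclic.not_reachable_deleteEdges_of_mem hfsp.2.1 hp₀ (hre hmem)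
    · right
      refine ⟨m', rfl, by rw [hb]; simpa using h18, ?_⟩
      have hC₁ : A.Copies W K H (s'.setInt 18 z) := hC.setInt (by norm_num) _
      have hF₁ : Frame (K + 32) {11, 16, 17, 18, 21} s (s'.setInt 18 z) :=
        hF.setInt (by omega) (by norm_num) (by simp) _
      have hsub : (IExpr.sub (var 18) (.const 1)).eval W' s' = some (z : ℕ) := by
        have := eval_sub (eval_var' (W := W') (s := s') (i := 18) (by omega) hz)
          (eval_const (i := 1) (by omega)) (by omega)
        rwa [Nat.add_sub_cancel] at this
      refine (Runs.seq (P := fun x => x = s'.setInt 18 z) (Runs.setVar (by omega) hsub rfl) ?_).weaken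
        (t₁ := 6 + ((10 * τ + 42) + (9 + (10 * τ + 42)))) (by omega) fun _ h => h
      rintro _ rfl
      refine Runs.seq (hA.runs_query (hs.frame hF₁ (by simp) (by simp) (by simp)) hC₁ (r := 21)
        (k := q) (u := x) (v := z) (eval_var' (by omega) ?_) (by simp [IExpr.size, var]) hq1 hqK
        (by norm_num) (by norm_num) (by norm_num) (by norm_num) ?_ ?_ (by norm_num)) ?_
      · rw [hF₁.int 20 (by norm_num) (by simp), hq]
      · simp [Mem.setInt_int, h16]
      · simp [Mem.setInt_int]
      rintro s₄ ⟨hF₄, hC₄, hfor₄, hans₄⟩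
      have hF₅ : Frame (K + 32) {11, 16, 17, 18, 21} s s₄ :=
        hF₁.trans (hF₄.mono (by simp [Finset.insert_subset_iff]))
      have h16₄ : s₄.int 16 = x := by
        rw [hF₄.int 16 (by norm_num) (by simp)]; simp [Mem.setInt_int, h16]
      have h17₄ : s₄.int 17 = y := by
        rw [hF₄.int 17 (by norm_num) (by simp)]; simp [Mem.setInt_int, h17]
      have h18₄ : s₄.int 18 = z := by
        rw [hF₄.int 18 (by norm_num) (by simp)]; simp [Mem.setInt_int]
      have hf₄ : forest (s₄.slot (K + 32) p) = f := by
        rw [hfor₄ p hp1 hpK, Mem.slot_setInt_of_lt (by omega), hfor]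
      have hz := hans₄.eq_zero_iff (hA.spanning _ _ (hC₁ q hq1 hqK))
      have hle : (Cond.le (var 21) (.const 0)).eval W' s₄ = some (decide (s₄.int 21 ≤ 0)) :=
        DynGraph.eval_le (eval_var _ (by omega)) (eval_const (by omega))
      refine Runs.seq (P := J m') ?_ (hquery m')
      by_cases hr : (H q).Reachable x z
      · have h21 : s₄.int 21 ≠ 0 := fun h => hz.1 h hr
        refine Runs.iteFalse (by rw [hle]; simp; omega) (Runs.setVar (by omega)
          (eval_var' (by omega) h18₄) ⟨?_, hC₄.setInt (by norm_num) _, ?_, z, y, ?_, ?_, ?_, r₂,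
            hr₂.1, hr₂.2.1, List.Subset.trans hr₂.2.2 hre⟩)
        · exact hF₅.setInt (by omega) (by norm_num) (by simp) _
        · rw [Mem.slot_setInt_of_lt (by omega), hf₄]
        · simp [Mem.setInt_int]
        · simp [Mem.setInt_int, h17₄]
        · exact fun h => hxy (hr.trans h)
      · have h21 : s₄.int 21 = 0 := hz.2 hr
        refine Runs.iteTrue (by rw [hle]; simp; omega) (Runs.setVar (by omega)
          (eval_var' (by omega) h18₄) ⟨?_, hC₄.setInt (by norm_num) _, ?_, x, z, ?_, ?_, hr, r₁,
            hr₁.1, hr₁.2.1, List.Subset.trans hr₁.2.2 hre⟩)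
        · exact hF₅.setInt (by omega) (by norm_num) (by simp) _
        · rw [Mem.slot_setInt_of_lt (by omega), hf₄]
        · simp [Mem.setInt_int, h16₄]
        · simp [Mem.setInt_int]
  · simp only [neSucc, Cond.size, IExpr.size, var]
    ring_nf
    omega

end ConnAlg.Fits

/-! ## Classes of weights -/

/-- The least `i` with `x ≤ (1 + ε) ^ i`. -/
noncomputable def weightClass (ε x : ℝ) : ℕ := ⌈Real.log x / Real.log (1 + ε)⌉₊

theorem weightClass_le_iff {ε x : ℝ} (hε : 0 < ε) (hx : 0 < x) {i : ℕ} :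
    weightClass ε x ≤ i ↔ x ≤ (1 + ε) ^ i := by
  have hl : 0 < Real.log (1 + ε) := Real.log_pos (by linarith)
  rw [weightClass, Nat.ceil_le, div_le_iff₀ hl, ← Real.log_pow,
    Real.log_le_log_iff hx (by positivity)]

theorem weightClass_mono {ε x y : ℝ} (hε : 0 < ε) (hx : 0 < x) (hxy : x ≤ y) :
    weightClass ε x ≤ weightClass ε y :=
  (weightClass_le_iff hε hx).2
    (hxy.trans ((weightClass_le_iff hε (hx.trans_le hxy)).1 le_rfl))

/-- For a positive class, minimality puts `x` above the preceding power. Class `0` has no preceding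
power, and there `1 ≤ x` is needed. -/
theorem pow_weightClass_le {ε x : ℝ} (hε : 0 < ε) (hx : 1 ≤ x) :
    (1 + ε) ^ weightClass ε x ≤ (1 + ε) * x := by
  cases h : weightClass ε x with
  | zero => nlinarith [pow_zero (1 + ε)]
  | succ i =>
    have h1 : ¬ weightClass ε x ≤ i := by omega
    rw [weightClass_le_iff hε (by linarith), not_le] at h1
    rw [pow_succ]
    nlinarith

/-- Compute the class of the weight in the real cell `r`, into the integer cell `14`. -/
def classOf (r : ℕ) : Cmd :=
  .seq (.setReal (.const 3) (.cast (.const 1))) (.seq (setVar 14 (.const 0))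
    (.loop (.neg (.rle (.load (.const r)) (.load (.const 3))))
      (.seq (.setReal (.const 3) (.mul (.load (.const 3)) (.load (.const 2)))) (incr 14))))

/-- There is no logarithm on the machine: real cell `3` runs through the powers of `1 + ε` until the
weight is reached. By `weightClass_le_iff` the loop test compares the counter with the class, so
there are at most `K` rounds. -/
theorem runs_classOf {W K r : ℕ} {ε : ℝ} {s : Mem} (hε : 0 < ε) (h2 : s.real 2 = 1 + ε)
    (hr3 : r ≠ 3) (hr : r < 32) (hx : 0 < s.real r) (hK : weightClass ε (s.real r) ≤ K)
    (hW : K + 32 ≤ W) :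
    Runs W (classOf r) s (20 * K + 20) fun s' => s' =
      (s.setReal 3 ((1 + ε) ^ weightClass ε (s.real r))).setInt 14 (weightClass ε (s.real r)) := by
  set k := weightClass ε (s.real r) with hk
  have hset : ∀ (p q : ℝ) (i j : ℕ),
      (((s.setReal 3 p).setInt 14 i).setReal 3 q).setInt 14 j = (s.setReal 3 q).setInt 14 j := by
    intro p q i j
    simp [Mem.setInt, Mem.setReal]
  let I : ℕ → Mem → Prop := fun m s' =>
    ∃ i, i + m = k ∧ s' = (s.setReal 3 ((1 + ε) ^ i)).setInt 14 i
  refine (Runs.seq (P := fun x => x = s.setReal 3 1) (Runs.setReal (eval_const (by omega))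
    (v := 1) (e := .cast (.const 1)) ?_ rfl) fun s₁ h₁ => Runs.seq (P := I k) (Runs.setVar (by omega)
    (eval_const (i := 0) (by omega)) ?_) fun s₂ h₂ => Runs.loop (I := I) (t := 13) ?_ _ h₂).weaken ?_
    fun _ h => h
  · simp [RExpr.eval, eval_const (show 1 ≤ W by omega)]
  · exact ⟨0, by omega, by rw [h₁, pow_zero]⟩
  · rintro m s' ⟨i, him, rfl⟩
    have h3 : (RExpr.load (.const 3)).eval W ((s.setReal 3 ((1 + ε) ^ i)).setInt 14 i) =
        some ((1 + ε) ^ i) := by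
      rw [eval_rload (eval_const (by omega)), Mem.setInt_real, Mem.setReal_real, if_pos rfl]
    have hb : (Cond.neg (.rle (.load (.const r)) (.load (.const 3)))).eval W
        ((s.setReal 3 ((1 + ε) ^ i)).setInt 14 i) = some (!decide (k ≤ i)) := by
      have hr' : (RExpr.load (.const r)).eval W ((s.setReal 3 ((1 + ε) ^ i)).setInt 14 i) =
          some (s.real r) := by
        rw [eval_rload (eval_const (by omega)), Mem.setInt_real, Mem.setReal_real, if_neg hr3]
      have hiff : k ≤ i ↔ s.real r ≤ (1 + ε) ^ i := weightClass_le_iff hε hx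
      by_cases hle : k ≤ i
      · simp [Cond.eval, h3, hr', hle, hiff.1 hle]
      · simp only [Cond.eval, h3, hr', hle, mt hiff.2 hle, Option.bind_some, decide_false,
          Bool.not_false]
    cases m with
    | zero =>
      obtain rfl : i = k := by omega
      exact Or.inl ⟨by rw [hb]; simp, rfl⟩
    | succ m =>
      refine Or.inr ⟨m, rfl, by rw [hb]; simp; omega, ?_⟩
      refine Runs.mono_time (t₁ := 7 + 6) ?_ le_rfl
      refine Runs.seq (P := fun x => x = ((s.setReal 3 ((1 + ε) ^ i)).setInt 14 i).setReal 3
        ((1 + ε) ^ (i + 1))) (Runs.setReal (eval_const (by omega)) ?_ rfl) ?_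
      · simp only [RExpr.eval] at h3 ⊢
        rw [h3]
        simp [eval_const (show 2 ≤ W by omega), Mem.setInt_real, Mem.setReal_real, h2, pow_succ]
      · rintro _ rfl
        exact Runs.incr (v := i) (by omega) (by simp [Mem.setInt_int, Mem.setReal_int])
          (by omega) ⟨i + 1, by omega, hset _ _ _ _⟩
  · simp only [Cond.size, IExpr.size, RExpr.size]
    omega

/-! ## Output -/

/-- Write one change of the forest: the kind `b` and the ends in the cells `x` and `y`. -/
def outputOne (b x y : ℕ) : Cmd :=
  .seq (setVar 0 (.const 1)) (.seq (setVar 1 (.const b)) (.seq (setVar 2 (var x))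
    (setVar 3 (var y))))

/-- Write two changes of the forest: the removal of the edge with the ends in the cells `x` and `y`,
and the addition of the edge with the ends in the cells `x'` and `y'`. -/
def outputExchange (x y x' y' : ℕ) : Cmd :=
  .seq (setVar 0 (.const 2)) (.seq (setVar 1 (.const 0)) (.seq (setVar 2 (var x))
    (.seq (setVar 3 (var y)) (.seq (setVar 4 (.const 1)) (.seq (setVar 5 (var x'))
      (setVar 6 (var y')))))))

section Output

variable {A : ConnAlg} {n W K W' : ℕ} {s : Mem} {H : ℕ → SimpleGraph (Fin n)} {ε : ℝ}

theorem Mem.outputs_nil (h : s.int 0 = 0) : s.Outputs ([] : List (Change n)) :=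
  ⟨h, fun i hi => by simp at hi⟩

/-- Two changes occupy the cells `0` to `6`. An insertion still updates the level copies after
writing its output, and this leaves those cells alone. -/
theorem Mem.Outputs.congr {s' : Mem} {cs : List (Change n)} (h : s.Outputs cs)
    (hcs : cs.length ≤ 2) (hs : ∀ i < 7, s'.int i = s.int i) : s'.Outputs cs := by
  refine ⟨(hs 0 (by norm_num)).trans h.1, fun i hi => ?_⟩
  rw [← h.2 i hi, hs _ (by omega), hs _ (by omega), hs _ (by omega)]

theorem runs_outputOne (hW : 32 ≤ W') (hH : A.Copies W K H s) {b x y : ℕ} {u v : Fin n}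
    {c : Change n} (hc : c.encode = (b, (u : ℕ), (v : ℕ))) (hb : b ≤ 1) (hx : 7 ≤ x)
    (hx' : x < 32) (hy : 7 ≤ y) (hy' : y < 32) (hu : s.int x = u) (hv : s.int y = v) :
    Runs W' (outputOne b x y) s 14 fun s' =>
      Frame (K + 32) {0, 1, 2, 3, 4, 5, 6} s s' ∧ A.Copies W K H s' ∧ s'.Outputs [c] := by
  refine (Runs.seq (P := fun t => t = s.setInt 0 1) (Runs.setVar (by omega) (eval_const (by omega))
    rfl) ?_).weaken (t₁ := 3 + (3 + (4 + 4))) le_rfl fun _ h => h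
  rintro _ rfl
  refine Runs.seq (P := fun t => t = (s.setInt 0 1).setInt 1 b) (Runs.setVar (by omega)
    (eval_const (by omega)) rfl) ?_
  rintro _ rfl
  refine Runs.seq (P := fun t => t = ((s.setInt 0 1).setInt 1 b).setInt 2 u) (Runs.setVar (by omega)
    (eval_var' (by omega) ?_) rfl) ?_
  · simp only [Mem.setInt_int]
    rw [if_neg (by omega), if_neg (by omega), hu]
  rintro _ rfl
  refine Runs.setVar (v := v) (by omega) (eval_var' (by omega) ?_) ⟨?_, ?_, ?_, ?_⟩
  · simp only [Mem.setInt_int]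
    rw [if_neg (by omega), if_neg (by omega), if_neg (by omega), hv]
  · refine ((((Frame.refl _ _ s).setInt ?_ ?_ ?_ _).setInt ?_ ?_ ?_ _).setInt ?_ ?_ ?_ _).setInt
      ?_ ?_ ?_ _ <;> first | omega | simp
  · exact (((hH.setInt (by norm_num) _).setInt (by norm_num) _).setInt (by norm_num) _).setInt
      (by norm_num) _
  · simp [Mem.setInt_int]
  · intro i hi
    obtain rfl : i = 0 := by simpa using hi
    simp [Mem.setInt_int, hc]

theorem runs_outputExchange (hW : 32 ≤ W') (hH : A.Copies W K H s) {a b a' b' : ℕ}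
    {x y x' y' : Fin n} (ha : 7 ≤ a ∧ a < 32) (hb : 7 ≤ b ∧ b < 32) (ha' : 7 ≤ a' ∧ a' < 32)
    (hb' : 7 ≤ b' ∧ b' < 32) (hx : s.int a = x) (hy : s.int b = y) (hx' : s.int a' = x')
    (hy' : s.int b' = y') :
    Runs W' (outputExchange a b a' b') s 25 fun s' =>
      Frame (K + 32) {0, 1, 2, 3, 4, 5, 6} s s' ∧ A.Copies W K H s' ∧
      s'.Outputs [.remove x y, .add x' y'] := by
  refine (Runs.seq (P := fun t => t = s.setInt 0 2) (Runs.setVar (by omega) (eval_const (by omega))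
    rfl) ?_).weaken (t₁ := 3 + (3 + (4 + (4 + (3 + (4 + 4)))))) le_rfl fun _ h => h
  rintro _ rfl
  refine Runs.seq (P := fun t => t = (s.setInt 0 2).setInt 1 0) (Runs.setVar (by omega)
    (eval_const (by omega)) rfl) ?_
  rintro _ rfl
  refine Runs.seq (P := fun t => t = ((s.setInt 0 2).setInt 1 0).setInt 2 x) (Runs.setVar (by omega)
    (eval_var' (by omega) ?_) rfl) ?_
  · simp only [Mem.setInt_int]
    rw [if_neg (by omega), if_neg (by omega), hx]
  rintro _ rfl
  refine Runs.seq (P := fun t => t = (((s.setInt 0 2).setInt 1 0).setInt 2 x).setInt 3 y)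
    (Runs.setVar (by omega) (eval_var' (by omega) ?_) rfl) ?_
  · simp only [Mem.setInt_int]
    rw [if_neg (by omega), if_neg (by omega), if_neg (by omega), hy]
  rintro _ rfl
  refine Runs.seq (P := fun t => t = ((((s.setInt 0 2).setInt 1 0).setInt 2 x).setInt 3 y).setInt 4 1)
    (Runs.setVar (by omega) (eval_const (by omega)) rfl) ?_
  rintro _ rfl
  refine Runs.seq (P := fun t => t =
    (((((s.setInt 0 2).setInt 1 0).setInt 2 x).setInt 3 y).setInt 4 1).setInt 5 x')
    (Runs.setVar (by omega) (eval_var' (by omega) ?_) rfl) ?_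
  · simp only [Mem.setInt_int]
    rw [if_neg (by omega), if_neg (by omega), if_neg (by omega), if_neg (by omega),
      if_neg (by omega), hx']
  rintro _ rfl
  refine Runs.setVar (v := y') (by omega) (eval_var' (by omega) ?_) ⟨?_, ?_, ?_, ?_⟩
  · simp only [Mem.setInt_int]
    rw [if_neg (by omega), if_neg (by omega), if_neg (by omega), if_neg (by omega),
      if_neg (by omega), if_neg (by omega), hy']
  · refine (((((((Frame.refl _ _ s).setInt ?_ ?_ ?_ _).setInt ?_ ?_ ?_ _).setInt ?_ ?_ ?_ _).setInt
      ?_ ?_ ?_ _).setInt ?_ ?_ ?_ _).setInt ?_ ?_ ?_ _).setInt ?_ ?_ ?_ _ <;> first | omega | simp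
  · exact ((((((hH.setInt (by norm_num) _).setInt (by norm_num) _).setInt (by norm_num) _).setInt
      (by norm_num) _).setInt (by norm_num) _).setInt (by norm_num) _).setInt (by norm_num) _
  · simp [Mem.setInt_int]
  · intro i hi
    have : i = 0 ∨ i = 1 := by
      simp only [List.length_cons, List.length_nil] at hi
      omega
    rcases this with rfl | rfl <;> simp [Mem.setInt_int, Change.encode]

end Output

/-! ## Changing the forest -/

/-- The graphs in the virtual memories: the forest and the levels of the graph. -/
def forestAndLevels {V : Type*} (c : Sym2 V → ℕ) (G F : SimpleGraph V) : ℕ → SimpleGraph V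
  | 0 => ⊥
  | 1 => F
  | j + 2 => level G c j

/-- Change the forest when the edge between the vertices in the cells `12` and `13`, whose class is in
the cell `14`, is inserted, given the result of `lowest`. -/
def insertForest (A : ConnAlg) : Cmd :=
  .ite (.le (var 22) (.const 0))
    (.seq (callAt (.const 1) A.insert 12 13) (outputOne 1 12 13))
    (.ite (.le (var 15) (.add (var 14) (.const 1))) (setVar 0 (.const 0))
      (.seq (setVar 19 (.const 1)) (.seq (setVar 20 (var 15)) (.seq (search A)
        (.seq (callAt (.const 1) A.delete 16 17) (.seq (callAt (.const 1) A.insert 12 13)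
          (outputExchange 16 17 12 13)))))))

/-- Change the forest when its edge between the vertices in the cells `12` and `13` is deleted. -/
def deleteForest (A : ConnAlg) : Cmd :=
  .seq (callAt (.const 1) A.delete 12 13) (.seq (lowest A)
    (.ite (.le (var 22) (.const 0)) (outputOne 0 12 13)
      (.seq (setVar 19 (.add (var 15) (.const 1))) (.seq (setVar 20 (.const 1)) (.seq (search A)
        (.seq (callAt (.const 1) A.insert 16 17) (outputExchange 12 13 16 17)))))))

namespace ConnAlg

variable {A : ConnAlg} {n W V K W' τ : ℕ} {forest : Mem → SimpleGraph (Fin n)} {s : Mem}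
  {G F : SimpleGraph (Fin n)} {c : Sym2 (Fin n) → ℕ} {ε : ℝ} {u v : Fin n}

theorem Copies.update_one {F' : SimpleGraph (Fin n)}
    (h : A.Copies W K (Function.update (forestAndLevels c G F) 1 F') s) :
    A.Copies W K (forestAndLevels c G F') s := by
  refine h.congr fun k h1 _ => ?_
  match k with
  | 0 => omega
  | 1 => rfl
  | k + 2 => rfl

namespace Fits

/-- The level copies still hold the old graph `G` here, so `j₀` describes how `u` and `v` are
connected without the new edge. -/
theorem runs_insertForest (hA : A.Fits n W V K W' τ forest) (hs : HasParams n K ε s)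
    (hH : A.Copies W K (forestAndLevels c G F) s) (hF : IsLevelForest c G F)
    (hu : s.int 12 = u) (hv : s.int 13 = v) (hi : s.int 14 = c s(u, v)) (huv : u ≠ v)
    (hadj : ¬ G.Adj u v) (hcK : c s(u, v) ≤ K) (hGK : ∀ a b, G.Adj a b → c s(a, b) ≤ K)
    {j₀ : ℕ} (hlow : ∀ j < j₀, ¬ (level G c j).Reachable u v)
    (hj₀ : (s.int 22 = 0 ∧ j₀ = K + 1) ∨
      (s.int 22 ≠ 0 ∧ s.int 15 = j₀ + 1 ∧ j₀ ≤ K ∧ (level G c j₀).Reachable u v))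
    {m₀ : ℕ} (hm₀ : n ≤ 2 ^ m₀) :
    Runs W' (insertForest A) s ((m₀ + 1) * (20 * τ + 130) + (20 * τ + 120)) fun s' =>
      Frame (K + 32) {0, 1, 2, 3, 4, 5, 6, 11, 16, 17, 18, 19, 20, 21} s s' ∧
      ∃ cs : List (Change n), s'.Outputs cs ∧ cs.length ≤ 2 ∧
        A.Copies W K (forestAndLevels c G (cs.foldl Change.apply F)) s' ∧
        IsLevelForest c (G ⊔ edge u v) (cs.foldl Change.apply F) := by
  obtain ⟨hK, hN⟩ := hA.small_le
  have h22 : (Cond.le (var 22) (.const 0)).eval W' s = some (decide (s.int 22 ≤ 0)) :=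
    DynGraph.eval_le (eval_var _ (by omega)) (eval_const (by omega))
  rcases hj₀ with ⟨h0, rfl⟩ | ⟨h0, h15, hj₀K, hreach⟩
  · have hn : ¬ F.Reachable u v := fun h => by
      have := hlow K (by omega)
      rw [level_eq_self hGK] at this
      exact this (h.mono hF.le)
    refine Runs.weaken (t₁ := 1 + 4 + ((10 * τ + 30) + 14)) (Runs.iteTrue (by rw [h22, h0]; rfl)
      (Runs.seq (hA.runs_update hs hH
      (eval_const (by omega)) (by simp [IExpr.size]) le_rfl (by omega) (by norm_num) (by norm_num)
      (by norm_num) (by norm_num) hu hv (hA.insert F u v huv fun h => hadj (hF.le h))) ?_))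
      (by omega) fun _ h => h
    rintro s₁ ⟨hf₁, hC₁⟩
    refine (runs_outputOne (by omega) hC₁ (u := u) (v := v) (c := .add u v) rfl le_rfl
      (by norm_num) (by norm_num) (by norm_num) (by norm_num) ?_ ?_).weaken le_rfl
      fun s₂ h₂ => ⟨?_, [.add u v], h₂.2.2, by simp, h₂.2.1.update_one,
        hF.sup_edge_of_not_reachable hn⟩
    · rw [hf₁.int 12 (by norm_num) (by simp), hu]
    · rw [hf₁.int 13 (by norm_num) (by simp), hv]
    · exact (hf₁.mono (by simp)).trans (h₂.1.mono (by simp [Finset.insert_subset_iff]))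
  · have hb : (Cond.le (var 15) (.add (var 14) (.const 1))).eval W' s =
        some (decide (j₀ + 1 ≤ c s(u, v) + 1)) :=
      DynGraph.eval_le (eval_var' (by omega) h15)
        (eval_add (eval_var' (by omega) hi) (eval_const (by omega)) (by omega))
    -- In this case `u` and `v` are already joined by edges of no larger class, and the forest
    -- stays.
    by_cases hle : j₀ ≤ c s(u, v)
    · refine Runs.mono_time (t₁ := 1 + 4 + (1 + 7 + 3)) ?_ (by omega)
      refine Runs.iteFalse (by rw [h22]; simp; omega) ?_
      refine Runs.iteTrue (by rw [hb]; simp; omega) ?_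
      refine Runs.setVar (v := 0) (by omega) (eval_const (by omega)) ⟨?_, [], Mem.outputs_nil ?_,
        by simp, hH.setInt (by norm_num) _, hF.sup_edge_of_reachable
          (hreach.mono (level_mono le_rfl c hle))⟩
      · exact (Frame.refl _ _ s).setInt (by omega) (by norm_num) (by simp) _
      · simp [Mem.setInt_int]
    · obtain ⟨j, rfl⟩ : ∃ j, j₀ = j + 1 := ⟨j₀ - 1, by omega⟩
      have hF₂ : Frame (K + 32) {0, 1, 2, 3, 4, 5, 6, 11, 16, 17, 18, 19, 20, 21} s
          ((s.setInt 19 1).setInt 20 (j + 2)) :=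
        ((Frame.refl _ _ s).setInt (by omega) (by norm_num) (by simp) _).setInt (by omega)
          (by norm_num) (by simp) _
      have hFr : F.Reachable u v := (hF.span _ _ _ hreach).mono (level_le _ _ _)
      refine Runs.mono_time (t₁ := 1 + 4 + (1 + 7 + (3 + (4 + ((m₀ + 1) * (20 * τ + 130) +
        ((10 * τ + 30) + ((10 * τ + 30) + 25))))))) ?_ (by ring_nf; omega)
      refine Runs.iteFalse (by rw [h22]; simp; omega) ?_
      refine Runs.iteFalse (by rw [hb]; simp; omega) ?_
      refine Runs.seq (P := fun t => t = s.setInt 19 1) (Runs.setVar (by omega)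
        (eval_const (by omega)) rfl) ?_
      rintro _ rfl
      -- Cell `15` holds `j₀ + 1 = j + 2`, which is the number of the copy for level `j`, the one
      -- just below the lowest connecting level.
      refine Runs.seq (P := fun t => t = (s.setInt 19 1).setInt 20 (j + 2))
        (Runs.setVar (by omega) (eval_var' (by omega) ?_) rfl) ?_
      · rw [Mem.setInt_int, if_neg (by norm_num), h15]
      rintro _ rfl
      refine Runs.seq (hA.runs_search (hs.frame hF₂ (by simp) (by simp) (by simp))
        ((hH.setInt (by norm_num) _).setInt (by norm_num) _) (p := 1) (q := j + 2) (u := u) (v := v)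
        ?_ ?_ ?_ ?_ le_rfl (by omega) (by omega) (by omega) hFr (hlow j (by omega)) hm₀) ?_
      · rw [hF₂.int 12 (by norm_num) (by simp), hu]
      · rw [hF₂.int 13 (by norm_num) (by simp), hv]
      · simp [Mem.setInt_int]
      · simp [Mem.setInt_int]
      · rintro s₃ ⟨hF₃, hC₃, x, y, h16, h17, hxy, f, hf, hfadj, hsep⟩
        have hfF : f = F := eq_of_le_of_isAcyclic hf.1 hF.acyclic fun a b => (hf.2.2 a b).2
        subst hfF
        replace hF₃ := hF₂.trans (hF₃.mono (by simp [Finset.insert_subset_iff]))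
        have hn : ¬ (f.deleteEdges {s(x, y)}).Adj u v := fun h => hsep h.reachable
        refine Runs.seq (hA.runs_update (hs.frame hF₃ (by simp) (by simp) (by simp)) hC₃
          (eval_const (by omega)) (by simp [IExpr.size]) le_rfl (by omega) (by norm_num)
          (by norm_num) (by norm_num) (by norm_num) h16 h17 (hA.delete f x y hfadj)) ?_
        rintro s₄ ⟨hF₄', hC₄⟩
        have hF₄ := hF₃.trans (hF₄'.mono (by simp))
        refine Runs.seq (hA.runs_update (hs.frame hF₄ (by simp) (by simp) (by simp))
          hC₄.update_one (eval_const (by omega)) (by simp [IExpr.size]) le_rfl (by omega)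
          (by norm_num) (by norm_num) (by norm_num) (by norm_num) ?_ ?_
          (hA.insert (f.deleteEdges {s(x, y)}) u v huv hn)) ?_
        · rw [hF₄.int 12 (by norm_num) (by simp), hu]
        · rw [hF₄.int 13 (by norm_num) (by simp), hv]
        rintro s₅ ⟨hF₅', hC₅⟩
        have hF₅ := hF₄.trans (hF₅'.mono (by simp))
        refine (runs_outputExchange (by omega) hC₅.update_one (x := x) (y := y) (x' := u) (y' := v)
          (by norm_num) (by norm_num) (by norm_num) (by norm_num) ?_ ?_ ?_ ?_).weaken le_rfl
          fun s₆ h₆ => ⟨hF₅.trans (h₆.1.mono (by simp [Finset.insert_subset_iff])), _, h₆.2.2, ?_,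
            h₆.2.1, ?_⟩
        · rw [hF₅'.int 16 (by norm_num) (by simp), hF₄'.int 16 (by norm_num) (by simp), h16]
        · rw [hF₅'.int 17 (by norm_num) (by simp), hF₄'.int 17 (by norm_num) (by simp), h17]
        · rw [hF₅.int 12 (by norm_num) (by simp), hu]
        · rw [hF₅.int 13 (by norm_num) (by simp), hv]
        · simp
        · refine hF.sup_edge_exchange (j₀ := j) hfadj hsep ?_ hreach (by omega)
          -- An edge `xy` of class at most `j` would connect its ends at level `j`.
          by_contra hc
          exact hxy (Adj.reachable ⟨hF.le hfadj, not_lt.1 hc⟩)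

/-- The levels have lost `uv` already, and the search runs with the roles of the copies reversed:
the path belongs to the implicit forest of level `j₀`, and the connections tested are those of `F -
uv`. The edge found has class at most `j₀`, while no lower level reconnects `u` and `v`, so no
replacement of smaller class exists. -/
theorem runs_deleteForest (hA : A.Fits n W V K W' τ forest) (hs : HasParams n K ε s)
    (hH : A.Copies W K (forestAndLevels c (G.deleteEdges {s(u, v)}) F) s)
    (hF : IsLevelForest c G F) (hu : s.int 12 = u) (hv : s.int 13 = v) (hadj : F.Adj u v)
    (hGK : ∀ a b, G.Adj a b → c s(a, b) ≤ K) {m₀ : ℕ} (hm₀ : n ≤ 2 ^ m₀) :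
    Runs W' (deleteForest A) s
      ((K + 2) * (10 * τ + 60) + (m₀ + 1) * (20 * τ + 130) + (20 * τ + 120)) fun s' =>
      ∃ X : Finset ℕ, 8 ∉ X ∧ 9 ∉ X ∧ 10 ∉ X ∧ Frame (K + 32) X s s' ∧
      ∃ cs : List (Change n), s'.Outputs cs ∧ cs.length ≤ 2 ∧
        A.Copies W K (forestAndLevels c (G.deleteEdges {s(u, v)})
          (cs.foldl Change.apply F)) s' ∧
        IsLevelForest c (G.deleteEdges {s(u, v)}) (cs.foldl Change.apply F) := by
  obtain ⟨hK, hN⟩ := hA.small_le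
  let X : Finset ℕ := {0, 1, 2, 3, 4, 5, 6, 11, 15, 16, 17, 18, 19, 20, 21, 22}
  have hX8 : 8 ∉ X := by decide
  have hX9 : 9 ∉ X := by decide
  have hX10 : 10 ∉ X := by decide
  have hX12 : 12 ∉ X := by decide
  have hX13 : 13 ∉ X := by decide
  refine Runs.weaken (P := fun s' => Frame (K + 32) X s s' ∧
    ∃ cs : List (Change n), s'.Outputs cs ∧ cs.length ≤ 2 ∧
      A.Copies W K (forestAndLevels c (G.deleteEdges {s(u, v)}) (cs.foldl Change.apply F)) s' ∧
      IsLevelForest c (G.deleteEdges {s(u, v)}) (cs.foldl Change.apply F))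
    (t₁ := (10 * τ + 30) + ((K + 2) * (10 * τ + 60) + (1 + 4 + (6 + (3 +
      ((m₀ + 1) * (20 * τ + 130) + ((10 * τ + 30) + 25))))))) ?_ ?_
    (fun s' h => ⟨X, hX8, hX9, hX10, h⟩)
  · set F₁ := F.deleteEdges {s(u, v)} with hF₁
    refine Runs.seq (hA.runs_update hs hH (eval_const (by omega)) (by simp [IExpr.size]) le_rfl
      (by omega) (by norm_num) (by norm_num) (by norm_num) (by norm_num) hu hv
      (hA.delete F u v hadj)) ?_
    rintro s₁ ⟨hf₁, hC₁⟩
    replace hf₁ : Frame (K + 32) X s s₁ := hf₁.mono (by decide)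
    refine Runs.seq (hA.runs_lowest (hs.frame hf₁ hX8 hX9 hX10) hC₁.update_one (u := u) (v := v)
      (by rw [hf₁.int 12 (by norm_num) hX12, hu]) (by rw [hf₁.int 13 (by norm_num) hX13, hv])) ?_
    rintro s₂ ⟨hf₂, hC₂, j₀, hj₀, hlow, hcase⟩
    replace hf₂ := hf₁.trans (hf₂.mono (show {11, 15, 22} ⊆ X by decide))
    replace hlow : ∀ j < j₀, ¬ (level (G.deleteEdges {s(u, v)}) c j).Reachable u v := hlow
    have h22 : (Cond.le (var 22) (.const 0)).eval W' s₂ = some (decide (s₂.int 22 ≤ 0)) :=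
      DynGraph.eval_le (eval_var _ (by omega)) (eval_const (by omega))
    have hu₂ : s₂.int 12 = u := by rw [hf₂.int 12 (by norm_num) hX12, hu]
    have hv₂ : s₂.int 13 = v := by rw [hf₂.int 13 (by norm_num) hX13, hv]
    rcases hcase with ⟨h0, rfl⟩ | ⟨h0, h15, hj₀K, hreach⟩
    · refine (Runs.iteTrue (by rw [h22, h0]; rfl) (runs_outputOne (by omega) hC₂ (u := u) (v := v)
        (c := .remove u v) rfl (by norm_num) (by norm_num) (by norm_num) (by norm_num) (by norm_num)
        hu₂ hv₂)).weaken (by simp only [Cond.size, IExpr.size, var]; omega)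
        fun s₃ h₃ => ⟨hf₂.trans (h₃.1.mono (by decide)), _, h₃.2.2, by simp, h₃.2.1, ?_⟩
      refine hF.deleteEdges_of_not_reachable hadj fun h => hlow K (by omega) ?_
      rwa [level_eq_self]
      exact fun a b hab => hGK a b (deleteEdges_le _ hab)
    · have hf₄ : Frame (K + 32) X s ((s₂.setInt 19 (j₀ + 2)).setInt 20 1) :=
        (hf₂.setInt (by omega) (by norm_num) (by decide) _).setInt (by omega)
          (by norm_num) (by decide) _
      refine Runs.iteFalse (by rw [h22]; simp; omega) ?_
      -- Cell `15` holds `j₀ + 1`, and the copy for level `j₀` has number `j₀ + 2`.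
      refine Runs.seq (P := fun t => t = s₂.setInt 19 (j₀ + 2)) (Runs.setVar (by omega)
        (eval_add (eval_var' (by omega) h15) (eval_const (by omega)) (by omega)) rfl) ?_
      rintro _ rfl
      refine Runs.seq (P := fun t => t = (s₂.setInt 19 (j₀ + 2)).setInt 20 1)
        (Runs.setVar (by omega) (eval_const (by omega)) rfl) ?_
      rintro _ rfl
      refine Runs.seq (hA.runs_search (hs.frame hf₄ hX8 hX9 hX10)
        ((hC₂.setInt (by norm_num) _).setInt (by norm_num) _) (p := j₀ + 2) (q := 1)
        (u := u) (v := v) ?_ ?_ ?_ ?_ (by omega) (by omega) le_rfl (by omega) hreach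
        (IsAcyclic.not_reachable_deleteEdges hF.acyclic hadj) hm₀) ?_
      · rw [hf₄.int 12 (by norm_num) hX12, hu]
      · rw [hf₄.int 13 (by norm_num) hX13, hv]
      · simp [Mem.setInt_int]
      · simp [Mem.setInt_int]
      · rintro s₅ ⟨hf₅, hC₅, x, y, h16, h17, hxy, f, hf, hfadj, -⟩
        replace hf₅ := hf₄.trans (hf₅.mono (show {11, 16, 17, 18, 21} ⊆ X by decide))
        have hxyn : x ≠ y := by rintro rfl; exact hxy (Reachable.refl _)
        have hlev : (level (G.deleteEdges {s(u, v)}) c j₀).Adj x y := hf.1 hfadj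
        replace hxy : ¬ F₁.Reachable x y := hxy
        refine Runs.seq (hA.runs_update (hs.frame hf₅ hX8 hX9 hX10) hC₅
          (eval_const (by omega)) (by simp [IExpr.size]) le_rfl (by omega) (by norm_num)
          (by norm_num) (by norm_num) (by norm_num) h16 h17
          (hA.insert F₁ x y hxyn fun h => hxy h.reachable)) ?_
        rintro s₆ ⟨hf₆', hC₆⟩
        have hf₆ := hf₅.trans (hf₆'.mono (show {11} ⊆ X by decide))
        refine (runs_outputExchange (by omega) hC₆.update_one (x := u) (y := v) (x' := x) (y' := y)
          (by norm_num) (by norm_num) (by norm_num) (by norm_num) ?_ ?_ ?_ ?_).weaken le_rfl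
          fun s₇ h₇ => ⟨hf₆.trans (h₇.1.mono (by decide)), _, h₇.2.2, by simp, h₇.2.1, ?_⟩
        · rw [hf₆.int 12 (by norm_num) hX12, hu]
        · rw [hf₆.int 13 (by norm_num) hX13, hv]
        · rw [hf₆'.int 16 (by norm_num) (by simp), h16]
        · rw [hf₆'.int 17 (by norm_num) (by simp), h17]
        · exact hF.deleteEdges_exchange hadj hlow hlev hxy
  · ring_nf
    omega

end Fits

end ConnAlg

/-! ## The class table -/

/-- The address of the entry of the class table for the vertices in the cells `a` and `b`. -/
def tableAddr (a b : ℕ) : IExpr :=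
  .mul (.add (.add (.mul (var a) (var 9)) (var b)) (.const 1)) (var 8)

theorem mul_add_eq_iff {n a b u v : ℕ} (hb : b < n) (hv : v < n) :
    a * n + b = u * n + v ↔ a = u ∧ b = v := by
  constructor
  · intro h
    have h1 := congrArg (· / n) h
    have h2 := congrArg (· % n) h
    simp only [mul_comm _ n, Nat.mul_add_div (show 0 < n by omega), Nat.div_eq_of_lt hb,
      Nat.div_eq_of_lt hv, Nat.mul_add_mod, Nat.mod_eq_of_lt hb, Nat.mod_eq_of_lt hv] at h1 h2
    omega
  · rintro ⟨rfl, rfl⟩; rfl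

theorem Mem.slot_zero_int (S : ℕ) (s : Mem) (j : ℕ) : (s.slot S 0).int j = s.int ((j + 1) * S) :=
  rfl

/-- Copy the arguments from the cells `0` and `1` to the cells `12` and `13`. -/
def copyArgs : Cmd := .seq (setVar 12 (var 0)) (setVar 13 (var 1))

/-- The initialization. -/
def initMSF (A : ConnAlg) : Cmd :=
  .seq (setVar 9 (var 0)) (.seq (.setReal (.const 2) (.add (.cast (.const 1)) (.load (.const 0))))
    (.seq (classOf 1) (.seq (setVar 10 (var 14)) (.seq (setVar 8 (.add (var 14) (.const 32)))
      (.seq (setVar 15 (.const 1)) (.loop (.le (var 15) (.add (var 10) (.const 2)))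
        (.seq (callAt (var 15) A.init 9 1) (incr 15))))))))

/-- The insertion of an edge. -/
def insertMSF (A : ConnAlg) : Cmd :=
  .seq copyArgs (.seq (classOf 0) (.seq (.setInt (tableAddr 12 13) (var 14))
    (.seq (.setInt (tableAddr 13 12) (var 14)) (.seq (lowest A) (.seq (insertForest A)
      (forLevels A.insert))))))

/-- The deletion of an edge. -/
def deleteMSF (A : ConnAlg) : Cmd :=
  .seq copyArgs (.seq (setVar 14 (.load (tableAddr 12 13))) (.seq (forLevels A.delete)
    (.seq (queryAt A (.const 1) 12 13 21) (.ite (neSucc 21 12) (setVar 0 (.const 0))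
      (deleteForest A)))))

/-- The classes of the edges of a weighted graph. -/
noncomputable def WGraph.edgeClass {n : ℕ} (G : WGraph n) (ε : ℝ) (e : Sym2 (Fin n)) : ℕ :=
  weightClass ε (G.weight e)

/-- The memory `s` represents the weighted graph `G` and its forest `F`. -/
structure ConnAlg.Represents (A : ConnAlg) {n : ℕ} (W K : ℕ) (ε U : ℝ) (G : WGraph n)
    (F : SimpleGraph (Fin n)) (s : Mem) : Prop where
  params : HasParams n K ε s
  copies : A.Copies W K (forestAndLevels (G.edgeClass ε) G.graph F) s
  forest : IsLevelForest (G.edgeClass ε) G.graph F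
  weight : ∀ a b, G.graph.Adj a b → 1 ≤ G.weight s(a, b) ∧ G.weight s(a, b) ≤ U
  table : ∀ a b : Fin n, G.graph.Adj a b →
    (s.slot (K + 32) 0).int (a * n + b) = G.edgeClass ε s(a, b)

/-! ### Correctness of initialization, insertion and deletion -/

namespace ConnAlg

variable {A : ConnAlg} {n W V K W' τ : ℕ} {forest : Mem → SimpleGraph (Fin n)} {s : Mem}
  {G F : SimpleGraph (Fin n)} {c : Sym2 (Fin n) → ℕ} {ε U : ℝ} {u v : Fin n}

theorem Copies.congr_slot {H : ℕ → SimpleGraph (Fin n)} {s' : Mem} (h : A.Copies W K H s)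
    (hs : ∀ k, 1 ≤ k → k ≤ K + 2 → s'.slot (K + 32) k = s.slot (K + 32) k) :
    A.Copies W K H s' :=
  fun k h1 h2 => by rw [hs k h1 h2]; exact h k h1 h2

theorem forestAndLevels_congr {c' : Sym2 (Fin n) → ℕ}
    (h : ∀ a b, G.Adj a b → c s(a, b) = c' s(a, b)) :
    forestAndLevels c G F = forestAndLevels c' G F := by
  funext k
  match k with
  | 0 | 1 => rfl
  | j + 2 => exact level_congr h j

namespace Represents

variable {G : WGraph n}

theorem edgeClass_le (h : A.Represents W K ε U G F s) (hε : 0 < ε) (hK : K = weightClass ε U)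
    (a b : Fin n) (hab : G.graph.Adj a b) : G.edgeClass ε s(a, b) ≤ K := by
  rw [hK]
  obtain ⟨h1, h2⟩ := h.weight a b hab
  exact weightClass_mono hε (by linarith) h2

/-- Summing `w ≤ (1 + ε) ^ class ≤ (1 + ε) * w` over edges, and comparing the middle sums of `F` and
`F'` by `IsLevelForest.sum_le`, gives the factor `1 + ε`. -/
theorem isApproxMSF (h : A.Represents W K ε U G F s) (hε : 0 < ε) : G.IsApproxMSF ε F := by
  refine ⟨h.forest.isMaximalSpanningForest, fun F' hF' => ?_⟩
  have hmono : Monotone fun i : ℕ => (1 + ε) ^ i := pow_right_mono₀ (by linarith)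
  have hsum := h.forest.sum_le hmono hF'
  classical
  have h1 : G.totalWeight F ≤ ∑ e ∈ F.edgeFinset, (1 + ε) ^ G.edgeClass ε e := by
    unfold WGraph.totalWeight
    refine le_trans (le_of_eq ?_) (Finset.sum_le_sum (f := G.weight) fun e he => ?_)
    · congr!
    induction e with | _ a b
    rw [mem_edgeFinset, mem_edgeSet] at he
    have := (h.weight a b (h.forest.le he)).1
    exact (weightClass_le_iff hε (by linarith)).1 le_rfl
  have h2 : ∑ e ∈ F'.edgeFinset, (1 + ε) ^ G.edgeClass ε e ≤ (1 + ε) * G.totalWeight F' := by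
    unfold WGraph.totalWeight
    rw [Finset.mul_sum]
    refine le_trans (Finset.sum_le_sum (g := fun e => (1 + ε) * G.weight e) fun e he => ?_)
      (le_of_eq ?_)
    swap
    · congr!
    induction e with | _ a b
    rw [mem_edgeFinset, mem_edgeSet] at he
    exact pow_weightClass_le hε (h.weight a b (hF'.1 he)).1
  refine h1.trans (le_trans ?_ h2)
  convert hsum

end Represents

namespace Fits

/-- Virtual memory `0` holds no copy of `A` and serves as the class table. Its indices `u * n + v`
are below `n * n`, which is what `table_le` provides for. -/
theorem eval_tableAddr (hA : A.Fits n W V K W' τ forest) (hs : HasParams n K ε s) {a b : ℕ}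
    (ha : a < 32) (hb : b < 32) (hu : s.int a = u) (hv : s.int b = v) :
    (tableAddr a b).eval W' s = some ((u * n + v + 1) * (K + 32)) := by
  obtain ⟨hK, hN⟩ := hA.small_le
  have h1 : (u : ℕ) * n + v + 1 ≤ n * n := by
    have : ((u : ℕ) + 1) * n ≤ n * n := Nat.mul_le_mul_right _ u.2
    have := v.2
    nlinarith
  have h2 : ((u : ℕ) * n + v + 1) * (K + 32) ≤ W' :=
    (Nat.mul_le_mul_right _ h1).trans hA.table_le
  have h3 : (u : ℕ) * n + v + 1 ≤ W' := (Nat.le_mul_of_pos_right _ (by omega)).trans h2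
  exact eval_mul (eval_add (eval_add (eval_mul (eval_var' (by omega) hu) (eval_var' (by omega)
    hs.card) (by omega)) (eval_var' (by omega) hv) (by omega)) (eval_const (by omega)) h3)
    (eval_var' (by omega) hs.stride) h2

theorem runs_writeTable (hA : A.Fits n W V K W' τ forest) (hs : HasParams n K ε s)
    {H : ℕ → SimpleGraph (Fin n)} (hH : A.Copies W K H s) {a b i : ℕ}
    (ha : a < 32) (hb : b < 32) (hu : s.int a = u) (hv : s.int b = v) (hi : s.int 14 = i) :
    Runs W' (.setInt (tableAddr a b) (var 14)) s 16 fun s' =>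
      HasParams n K ε s' ∧ A.Copies W K H s' ∧ (∀ j < 32, s'.int j = s.int j) ∧
      ∀ j, (s'.slot (K + 32) 0).int j =
        if j = u * n + v then i else (s.slot (K + 32) 0).int j := by
  obtain ⟨hK, hN⟩ := hA.small_le
  have he : s.setInt ((u * n + v + 1) * (K + 32)) i =
      s.putSlot (K + 32) 0 ((s.slot (K + 32) 0).setInt (u * n + v) i) := by
    rw [← Mem.setInt_slot_addr (by omega), add_zero]
  have hint : ∀ j < 32,
      (s.putSlot (K + 32) 0 ((s.slot (K + 32) 0).setInt (u * n + v) i)).int j = s.int j :=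
    fun j hj => Mem.putSlot_int_of_lt (by omega) _ _
  refine Runs.setInt (hA.eval_tableAddr hs ha hb hu hv) (eval_var' (by omega) hi) ?_
  rw [he]
  refine ⟨⟨?_, ?_, ?_, ?_⟩, hH.congr_slot fun k h1 h2 => ?_, hint, fun j => ?_⟩
  · rw [hint 8 (by norm_num), hs.stride]
  · rw [hint 9 (by norm_num), hs.card]
  · rw [hint 10 (by norm_num), hs.classes]
  · rw [Mem.putSlot_real_of_lt (by omega), hs.ratio]
  · rw [Mem.slot_putSlot_of_ne (by omega) (by omega)]
  · rw [Mem.slot_putSlot (by omega), Mem.setInt_int]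

theorem runs_copyArgs (hA : A.Fits n W V K W' τ forest)
    {H : ℕ → SimpleGraph (Fin n)} (hH : A.Copies W K H s) (hu : s.int 0 = u) (hv : s.int 1 = v) :
    Runs W' copyArgs s 8 fun s' => Frame (K + 32) {12, 13} s s' ∧ A.Copies W K H s' ∧
      s'.int 12 = u ∧ s'.int 13 = v ∧ s'.real 0 = s.real 0 := by
  obtain ⟨hK, hN⟩ := hA.small_le
  refine Runs.mono_time (t₁ := 4 + 4) ?_ le_rfl
  refine Runs.seq (P := fun t => t = s.setInt 12 u) (Runs.setVar (by omega)
    (eval_var' (by omega) hu) rfl) ?_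
  rintro _ rfl
  refine Runs.setVar (v := v) (by omega) (eval_var' (by omega) ?_) ⟨?_, ?_, ?_, ?_, rfl⟩
  · simp [Mem.setInt_int, hv]
  · exact ((Frame.refl _ _ s).setInt (by omega) (by norm_num) (by simp) _).setInt (by omega)
      (by norm_num) (by simp) _
  · exact (hH.setInt (by norm_num) _).setInt (by norm_num) _
  · simp [Mem.setInt_int]
  · simp [Mem.setInt_int]

theorem runs_insertMSF (hA : A.Fits n W V K W' τ forest) (hε : 0 < ε) (hKU : K = weightClass ε U)
    {G : WGraph n} (h : A.Represents W K ε U G F s) (huv : u ≠ v) (hadj : ¬ G.graph.Adj u v) {x : ℝ}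
    (hx1 : 1 ≤ x) (hxU : x ≤ U) {m₀ : ℕ} (hm₀ : n ≤ 2 ^ m₀) :
    Runs W' (insertMSF A) ((s.withArgs u v).setReal 0 x) (300 * (K + m₀ + 3) * (τ + 1)) fun s' =>
      ∃ cs : List (Change n), s'.Outputs cs ∧ cs.length ≤ 2 ∧
        A.Represents W K ε U (G.insertEdge u v x) (cs.foldl Change.apply F) s' := by
  obtain ⟨hK, hN⟩ := hA.small_le
  set G' := G.insertEdge u v x with hG'
  -- The classes of the new weights are used for the old graph as well: they differ at most on `uv`,
  -- which is not yet an edge.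
  set c := G'.edgeClass ε with hc
  have hne : ∀ a b, G.graph.Adj a b → s(a, b) ≠ s(u, v) := by
    rintro a b hab he
    rw [← mem_edgeSet, he] at hab
    exact hadj hab
  have hcc : ∀ a b, G.graph.Adj a b → G.edgeClass ε s(a, b) = c s(a, b) := by
    intro a b hab
    simp only [hc, hG', WGraph.edgeClass, WGraph.insertEdge]
    rw [Function.update_of_ne (hne a b hab)]
  have hcx : c s(u, v) = weightClass ε x := by
    simp [hc, hG', WGraph.edgeClass, WGraph.insertEdge]
  have hcK : c s(u, v) ≤ K := by
    rw [hcx, hKU]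
    exact weightClass_mono hε (by linarith) hxU
  have hGK : ∀ a b, G.graph.Adj a b → c s(a, b) ≤ K := fun a b hab => by
    rw [← hcc a b hab]
    exact h.edgeClass_le hε hKU a b hab
  have hF := h.forest.congr hcc
  have hf₀ : Frame (K + 32) {0, 1} s ((s.withArgs u v).setReal 0 x) := by
    have h1 : Frame (K + 32) {0, 1} s (s.withArgs u v) :=
      ((Frame.refl _ _ s).setInt (by omega) (by norm_num) (by simp) _).setInt (by omega)
        (by norm_num) (by simp) _
    refine ⟨h1.int, ?_, ?_⟩
    · rw [Mem.setReal_real, if_neg (by norm_num)]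
      rfl
    · rw [Mem.slot_setReal_of_lt (by omega), h1.table]
  have hC₀ : A.Copies W K (forestAndLevels c G.graph F) ((s.withArgs u v).setReal 0 x) := by
    have h1 : A.Copies W K (forestAndLevels (G.edgeClass ε) G.graph F) (s.withArgs u v) :=
      (h.copies.setInt (by norm_num) _).setInt (by norm_num) _
    rw [← forestAndLevels_congr hcc]
    exact h1.congr_slot fun k _ _ => Mem.slot_setReal_of_lt (by omega) _ _
  refine Runs.mono_time (t₁ := 8 + ((20 * K + 20) + (16 + (16 + ((K + 2) * (10 * τ + 60) +
    (((m₀ + 1) * (20 * τ + 130) + (20 * τ + 120)) + (K + 2) * (10 * τ + 60))))))) ?_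
    (by ring_nf; omega)
  refine Runs.seq (hA.runs_copyArgs hC₀ (u := u) (v := v) ?_ ?_) ?_
  · simp [Mem.setReal_int, Mem.withArgs, Mem.setInt_int]
  · simp [Mem.setReal_int, Mem.withArgs, Mem.setInt_int]
  rintro s₁ ⟨hf₁, hC₁, hu₁, hv₁, hx₁⟩
  rw [Mem.setReal_real, if_pos rfl] at hx₁
  replace hf₁ : Frame (K + 32) {0, 1, 12, 13, 14} s s₁ :=
    (hf₀.mono (by simp [Finset.insert_subset_iff])).trans
      (hf₁.mono (by simp [Finset.insert_subset_iff]))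
  have hp₁ := h.params.frame hf₁ (by simp) (by simp) (by simp)
  refine Runs.seq (runs_classOf (K := K) hε hp₁.ratio (by norm_num) (by norm_num)
    (by rw [hx₁]; linarith) (by rw [hx₁, ← hcx]; exact hcK) (by omega)) ?_
  rw [hx₁, ← hcx]
  set s₂ := (s₁.setReal 3 ((1 + ε) ^ c s(u, v))).setInt 14 (c s(u, v)) with hs₂
  rintro _ rfl
  have hslot : ∀ k, s₂.slot (K + 32) k = s₁.slot (K + 32) k := fun k => by
    rw [hs₂, Mem.slot_setInt_of_lt (by omega), Mem.slot_setReal_of_lt (by omega)]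
  have hf₂ : Frame (K + 32) {0, 1, 12, 13, 14} s s₂ := by
    have h' : Frame (K + 32) {0, 1, 12, 13, 14} s (s₁.setReal 3 ((1 + ε) ^ c s(u, v))) := by
      refine ⟨hf₁.int, ?_, ?_⟩
      · rw [Mem.setReal_real, if_neg (by norm_num), hf₁.real]
      · rw [Mem.slot_setReal_of_lt (by omega), hf₁.table]
    exact h'.setInt (by omega) (by norm_num) (by simp) _
  have hC₂ : A.Copies W K (forestAndLevels c G.graph F) s₂ := hC₁.congr_slot fun k _ _ => hslot k
  have hu₂ : s₂.int 12 = u := by simp [hs₂, Mem.setInt_int, Mem.setReal_int, hu₁]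
  have hv₂ : s₂.int 13 = v := by simp [hs₂, Mem.setInt_int, Mem.setReal_int, hv₁]
  have hi₂ : s₂.int 14 = c s(u, v) := by simp [hs₂, Mem.setInt_int]
  clear_value s₂
  refine Runs.seq (hA.runs_writeTable (h.params.frame hf₂ (by simp) (by simp) (by simp)) hC₂
    (by norm_num) (by norm_num) hu₂ hv₂ hi₂) ?_
  rintro s₃ ⟨hp₃, hC₃, hint₃, htab₃⟩
  -- Both orders of the ends are entered, since a deletion may name them in either order.
  refine Runs.seq (hA.runs_writeTable hp₃ hC₃ (u := v) (v := u) (i := c s(u, v)) (by norm_num)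
    (by norm_num) ?_ ?_ ?_) ?_
  · rw [hint₃ 13 (by norm_num), hv₂]
  · rw [hint₃ 12 (by norm_num), hu₂]
  · rw [hint₃ 14 (by norm_num), hi₂]
  rintro s₄ ⟨hp₄, hC₄, hint₄, htab₄⟩
  have hu₄ : s₄.int 12 = u := by rw [hint₄ 12 (by norm_num), hint₃ 12 (by norm_num), hu₂]
  have hv₄ : s₄.int 13 = v := by rw [hint₄ 13 (by norm_num), hint₃ 13 (by norm_num), hv₂]
  have hi₄ : s₄.int 14 = c s(u, v) := by rw [hint₄ 14 (by norm_num), hint₃ 14 (by norm_num), hi₂]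
  refine Runs.seq (hA.runs_lowest hp₄ hC₄ hu₄ hv₄) ?_
  rintro s₅ ⟨hf₅, hC₅, j₀, hj₀, hlow, hcase⟩
  have hp₅ := hp₄.frame hf₅ (by simp) (by simp) (by simp)
  refine Runs.seq (hA.runs_insertForest hp₅ hC₅ hF ?_ ?_ ?_ huv hadj hcK hGK hlow hcase hm₀) ?_
  · rw [hf₅.int 12 (by norm_num) (by simp), hu₄]
  · rw [hf₅.int 13 (by norm_num) (by simp), hv₄]
  · rw [hf₅.int 14 (by norm_num) (by simp), hi₄]
  rintro s₆ ⟨hf₆, cs, hout, hlen, hC₆, hF₆⟩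
  have hp₆ := hp₅.frame hf₆ (by simp) (by simp) (by simp)
  refine (hA.runs_forLevels hp₆ hC₆ (u := u) (v := v) (i := c s(u, v))
    (H' := fun k => forestAndLevels c G.graph (cs.foldl Change.apply F) k ⊔ edge u v) ?_ ?_ ?_ hcK
    ?_).weaken le_rfl ?_
  · rw [hf₆.int 12 (by norm_num) (by simp), hf₅.int 12 (by norm_num) (by simp), hu₄]
  · rw [hf₆.int 13 (by norm_num) (by simp), hf₅.int 13 (by norm_num) (by simp), hv₄]
  · rw [hf₆.int 14 (by norm_num) (by simp), hf₅.int 14 (by norm_num) (by simp), hi₄]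
  · exact fun j _ _ => hA.insert _ u v huv fun h' => hadj h'.1
  rintro s₇ ⟨hf₇, hC₇⟩
  refine ⟨cs, hout.congr hlen fun i hi => hf₇.int i (by omega) ?_, hlen,
    hp₆.frame hf₇ (by simp) (by simp) (by simp), hC₇.congr fun k h1 h2 => ?_, hF₆, ?_, ?_⟩
  · simp only [Finset.mem_insert, Finset.mem_singleton]
    omega
  · match k with
    | 0 => omega
    | 1 => exact if_neg (by omega)
    | j + 2 =>
      simp only [forestAndLevels]
      rw [show G'.graph = G.graph ⊔ edge u v from rfl, level_sup_edge]
      simp only [Nat.add_le_add_iff_right]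
      rfl
  · intro a b hab
    by_cases he : s(a, b) = s(u, v)
    · simp [hG', WGraph.insertEdge, he, hx1, hxU]
    · have : G.graph.Adj a b := by
        rcases hab with hab | hab
        · exact hab
        · rw [edge_adj, ← Sym2.eq_iff] at hab
          exact absurd hab.1 he
      simp only [hG', WGraph.insertEdge]
      rw [Function.update_of_ne he]
      exact h.weight a b this
  · intro a b hab
    rw [hf₇.table, hf₆.table, hf₅.table, htab₄, htab₃, hf₂.table]
    simp only [mul_add_eq_iff b.2 u.2, mul_add_eq_iff b.2 v.2, ← Fin.ext_iff]
    split_ifs with h1 h2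
    · rw [h1.1, h1.2, Sym2.eq_swap]
    · rw [h2.1, h2.2]
    · have : G.graph.Adj a b := by
        rcases hab with hab | hab
        · exact hab
        · rw [edge_adj] at hab
          tauto
      rw [h.table a b this, hcc a b this]

/-- A deletion does not come with a weight, so the class is read from the table. The entry is not
erased: the invariant concerns only the entries of present edges. -/
theorem runs_deleteMSF (hA : A.Fits n W V K W' τ forest) (hε : 0 < ε) (hKU : K = weightClass ε U)
    {G : WGraph n} (h : A.Represents W K ε U G F s) (hadj : G.graph.Adj u v)
    {m₀ : ℕ} (hm₀ : n ≤ 2 ^ m₀) :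
    Runs W' (deleteMSF A) (s.withArgs u v) (300 * (K + m₀ + 3) * (τ + 1)) fun s' =>
      ∃ cs : List (Change n), s'.Outputs cs ∧ cs.length ≤ 2 ∧
        A.Represents W K ε U (G.deleteEdge u v) (cs.foldl Change.apply F) s' := by
  obtain ⟨hK, hN⟩ := hA.small_le
  set c := G.edgeClass ε with hc
  have hcK : c s(u, v) ≤ K := h.edgeClass_le hε hKU u v hadj
  have hf₀ : Frame (K + 32) {0, 1} s (s.withArgs u v) :=
    ((Frame.refl _ _ s).setInt (by omega) (by norm_num) (by simp) _).setInt (by omega)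
      (by norm_num) (by simp) _
  have hC₀ : A.Copies W K (forestAndLevels c G.graph F) (s.withArgs u v) :=
    (h.copies.setInt (by norm_num) _).setInt (by norm_num) _
  refine Runs.mono_time (t₁ := 8 + (16 + ((K + 2) * (10 * τ + 60) + ((10 * τ + 42) + (1 + 16 +
    ((K + 2) * (10 * τ + 60) + (m₀ + 1) * (20 * τ + 130) + (20 * τ + 120))))))) ?_
    (by ring_nf; omega)
  refine Runs.seq (hA.runs_copyArgs hC₀ (u := u) (v := v) ?_ ?_) ?_
  · simp [Mem.withArgs, Mem.setInt_int]
  · simp [Mem.withArgs, Mem.setInt_int]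
  rintro s₁ ⟨hf₁, hC₁, hu₁, hv₁, -⟩
  replace hf₁ : Frame (K + 32) {0, 1, 12, 13, 14} s s₁ :=
    (hf₀.mono (by simp [Finset.insert_subset_iff])).trans
      (hf₁.mono (by simp [Finset.insert_subset_iff]))
  have hp₁ := h.params.frame hf₁ (by simp) (by simp) (by simp)
  have heval : (IExpr.load (tableAddr 12 13)).eval W' s₁ = some (c s(u, v)) := by
    rw [eval_load (hA.eval_tableAddr hp₁ (by norm_num) (by norm_num) hu₁ hv₁), hc,
      ← h.table u v hadj, ← hf₁.table]
    rw [Mem.slot_zero_int]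
  refine Runs.seq (P := fun t => t = s₁.setInt 14 (c s(u, v)))
    (Runs.setVar (by omega) heval rfl) ?_
  rintro _ rfl
  have hf₂ : Frame (K + 32) {0, 1, 12, 13, 14} s (s₁.setInt 14 (c s(u, v))) :=
    hf₁.setInt (by omega) (by norm_num) (by simp) _
  have hp₂ := h.params.frame hf₂ (by simp) (by simp) (by simp)
  refine Runs.seq (hA.runs_forLevels hp₂ (hC₁.setInt (by norm_num) _) (u := u) (v := v)
    (i := c s(u, v)) (H' := fun k => (forestAndLevels c G.graph F k).deleteEdges {s(u, v)})
    ?_ ?_ ?_ hcK ?_) ?_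
  · simp [Mem.setInt_int, hu₁]
  · simp [Mem.setInt_int, hv₁]
  · simp [Mem.setInt_int]
  · exact fun j hj _ => hA.delete _ u v ⟨hadj, hj⟩
  rintro s₃ ⟨hf₃, hC₃⟩
  have hu₃ : s₃.int 12 = u := by
    rw [hf₃.int 12 (by norm_num) (by simp)]; simp [Mem.setInt_int, hu₁]
  have hv₃ : s₃.int 13 = v := by
    rw [hf₃.int 13 (by norm_num) (by simp)]; simp [Mem.setInt_int, hv₁]
  have hp₃ := hp₂.frame hf₃ (by simp) (by simp) (by simp)
  replace hC₃ : A.Copies W K (forestAndLevels c (G.graph.deleteEdges {s(u, v)}) F) s₃ := by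
    refine hC₃.congr fun k h1 h2 => ?_
    match k with
    | 0 => omega
    | 1 => exact if_neg (by omega)
    | j + 2 =>
      simp only [forestAndLevels, Nat.add_le_add_iff_right]
      split_ifs with hj
      · exact (level_deleteEdges _ _ _ _).symm
      · exact (level_deleteEdges_of_lt (by omega)).symm
  have hrep : ∀ {s' : Mem} {F' : SimpleGraph (Fin n)}, HasParams n K ε s' →
      A.Copies W K (forestAndLevels c (G.graph.deleteEdges {s(u, v)}) F') s' →
      IsLevelForest c (G.graph.deleteEdges {s(u, v)}) F' →
      s'.slot (K + 32) 0 = s.slot (K + 32) 0 →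
      A.Represents W K ε U (G.deleteEdge u v) F' s' := by
    intro s' F' h1 h2 h3 h4
    refine ⟨h1, h2, h3, fun a b hab => h.weight a b (deleteEdges_le _ hab), fun a b hab => ?_⟩
    rw [h4]
    exact h.table a b (deleteEdges_le _ hab)
  have hslot₃ : s₃.slot (K + 32) 0 = s.slot (K + 32) 0 := hf₃.table.trans hf₂.table
  refine Runs.seq (hA.runs_query hp₃ hC₃ (r := 21) (k := 1) (eval_const (by omega))
    (by simp [IExpr.size]) le_rfl (by omega) (by norm_num) (by norm_num) (by norm_num)
    (by norm_num) hu₃ hv₃ (by norm_num)) ?_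
  rintro s₄ ⟨hf₄, hC₄, -, hans⟩
  have hu₄ : s₄.int 12 = u := by rw [hf₄.int 12 (by norm_num) (by simp), hu₃]
  have hv₄ : s₄.int 13 = v := by rw [hf₄.int 13 (by norm_num) (by simp), hv₃]
  have hp₄ := hp₃.frame hf₄ (by simp) (by simp) (by simp)
  have hsp := hA.spanning _ _ (hC₃ 1 le_rfl (by omega))
  -- Copy `1` holds the acyclic graph `F`, whose only maximal spanning forest is `F`; so the answer
  -- refers to paths of `F`.
  have hfor : forest (s₃.slot (K + 32) 1) = F :=
    eq_of_le_of_isAcyclic hsp.1 h.forest.acyclic fun a b => (hsp.2.2 a b).2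
  rw [hfor] at hans
  have hiff := hans.eq_succ_iff h.forest.acyclic hadj.ne
  have hb := eval_neSucc (W := W') (a := 21) (by omega) (by omega) rfl hu₄ (by omega)
  by_cases hFuv : F.Adj u v
  · refine Runs.iteFalse (by rw [hb]; simpa using hiff.2 hFuv)
      ((hA.runs_deleteForest hp₄ hC₄ h.forest hu₄ hv₄ hFuv (h.edgeClass_le hε hKU)
        hm₀).weaken le_rfl ?_)
    rintro s₅ ⟨X, hX8, hX9, hX10, hf₅, cs, hout, hlen, hC₅, hF₅⟩
    exact ⟨cs, hout, hlen, hrep (hp₄.frame hf₅ hX8 hX9 hX10) hC₅ hF₅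
      (hf₅.table.trans (hf₄.table.trans hslot₃))⟩
  · refine Runs.mono_time (t₁ := 1 + 16 + 3) (Runs.iteTrue (by rw [hb]; simpa using mt hiff.1 hFuv)
      (Runs.setVar (v := 0) (by omega) (eval_const (by omega)) ?_)) (by omega)
    have hf₅ : Frame (K + 32) {0, 11, 21} s₃ (s₄.setInt 0 0) :=
      (hf₄.mono (by simp)).setInt (by omega) (by norm_num) (by simp) _
    refine ⟨[], Mem.outputs_nil (by simp [Mem.setInt_int]), by simp,
      hrep (hp₃.frame hf₅ (by simp) (by simp) (by simp)) (hC₄.setInt (by norm_num) _)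
        (h.forest.deleteEdges_of_not_adj hFuv) (hf₅.table.trans hslot₃)⟩

theorem runs_initMSF (hA : A.Fits n W V K W' τ forest) (hε : 0 < ε) (hU : 1 ≤ U)
    (hKU : K = weightClass ε U) {m : Mem} {t : ℕ} (hinit : Exec W A.init (start n) m t) :
    ∃ T, Runs W' (initMSF A) (MSFAlg.start n ε U) T
      (A.Represents W K ε U (WGraph.empty n) ⊥) := by
  obtain ⟨hK, hN⟩ := hA.small_le
  set s := MSFAlg.start n ε U with hs
  let I : ℕ → Mem → Prop := fun l s' => HasParams n K ε s' ∧ s'.int 1 = 0 ∧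
    ∃ j, 1 ≤ j ∧ s'.int 15 = j ∧ j + l = K + 3 ∧
      (∀ k, 1 ≤ k → k < j → s'.slot (K + 32) k = m) ∧
      ∀ k, j ≤ k → k ≤ K + 2 → s'.slot (K + 32) k = Mem.zero
  have hslot : ∀ k, s.slot (K + 32) k = Mem.zero := fun k => by
    rw [hs, MSFAlg.start, Mem.slot_setReal_of_lt (by omega), Mem.slot_setReal_of_lt (by omega),
      Mem.slot_setInt_of_lt (by omega)]
    rfl
  refine ⟨4 + (7 + ((20 * K + 20) + (4 + (6 + (3 + ((K + 2) * (1 + 7 + (10 * t + 34)) +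
    (1 + 7))))))), ?_⟩
  refine Runs.seq (P := fun x => x = s.setInt 9 n) (Runs.setVar (by omega)
    (eval_var' (by omega) ?_) rfl) ?_
  · simp [hs, MSFAlg.start, Mem.setInt_int, Mem.setReal_int]
  rintro _ rfl
  refine Runs.seq (P := fun x => x = (s.setInt 9 n).setReal 2 (1 + ε)) (Runs.setReal
    (eval_const (by omega)) ?_ rfl) ?_
  · simp [RExpr.eval, eval_const (show 1 ≤ W' by omega), eval_const (show 0 ≤ W' by omega),
      hs, MSFAlg.start, Mem.setInt_real, Mem.setReal_real]
  rintro _ rfl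
  have hr : ((s.setInt 9 n).setReal 2 (1 + ε)).real 1 = U := by
    simp [hs, MSFAlg.start, Mem.setInt_real, Mem.setReal_real]
  refine Runs.seq (runs_classOf (K := K) hε (by simp [Mem.setReal_real]) (by norm_num) (by norm_num)
    (by rw [hr]; linarith) (by rw [hr, hKU]) (by omega)) ?_
  rw [hr, ← hKU]
  set s₁ := (((s.setInt 9 n).setReal 2 (1 + ε)).setReal 3 ((1 + ε) ^ K)).setInt 14 K with hs₁
  rintro _ rfl
  have hslot₁ : ∀ k, s₁.slot (K + 32) k = Mem.zero := fun k => by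
    rw [hs₁, Mem.slot_setInt_of_lt (by omega), Mem.slot_setReal_of_lt (by omega),
      Mem.slot_setReal_of_lt (by omega), Mem.slot_setInt_of_lt (by omega), hslot]
  have h14 : s₁.int 14 = K := by simp [hs₁, Mem.setInt_int]
  have h9 : s₁.int 9 = n := by simp [hs₁, Mem.setInt_int, Mem.setReal_int]
  have h1 : s₁.int 1 = 0 := by
    simp [hs₁, hs, MSFAlg.start, Mem.setInt_int, Mem.setReal_int, Mem.zero]
  have h2 : s₁.real 2 = 1 + ε := by simp [hs₁, Mem.setInt_real, Mem.setReal_real]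
  clear_value s₁
  refine Runs.seq (P := fun x => x = s₁.setInt 10 K) (Runs.setVar (by omega)
    (eval_var' (by omega) h14) rfl) ?_
  rintro _ rfl
  refine Runs.seq (P := fun x => x = (s₁.setInt 10 K).setInt 8 (K + 32)) (Runs.setVar (by omega)
    (eval_add (eval_var' (by omega) (by simp [Mem.setInt_int, h14])) (eval_const (by omega))
      (by omega)) rfl) ?_
  rintro _ rfl
  refine Runs.seq (P := I (K + 2)) (Runs.setVar (v := 1) (by omega) (eval_const (by omega)) ?_) ?_
  · refine ⟨⟨?_, ?_, ?_, ?_⟩, ?_, 1, le_rfl, ?_, by omega, fun k _ _ => by omega, fun k _ _ => ?_⟩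
    · simp [Mem.setInt_int]
    · simp [Mem.setInt_int, h9]
    · simp [Mem.setInt_int]
    · simp [Mem.setInt_real, h2]
    · simp [Mem.setInt_int, h1]
    · simp [Mem.setInt_int]
    · rw [Mem.slot_setInt_of_lt (by omega), Mem.slot_setInt_of_lt (by omega),
        Mem.slot_setInt_of_lt (by omega), hslot₁]
  intro s₂ h₂
  refine Runs.loop (I := I) (t := 10 * t + 34) ?_ _ h₂
  rintro l s' ⟨hp, hz, j, hj, h15, hjl, hdone, htodo⟩
  have hb : (Cond.le (var 15) (.add (var 10) (.const 2))).eval W' s' =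
      some (decide (j ≤ K + 2)) :=
    DynGraph.eval_le (eval_var' (by omega) h15)
      (eval_add (eval_var' (by omega) hp.classes) (eval_const (by omega)) (by omega))
  cases l with
  | zero =>
    refine Or.inl ⟨by rw [hb]; simp; omega, hp, fun k h1 h2 => ?_, IsLevelForest.bot _,
      fun a b hab => hab.elim, fun a b hab => hab.elim⟩
    rw [hdone k h1 (by omega)]
    have : forestAndLevels ((WGraph.empty n).edgeClass ε) (WGraph.empty n).graph ⊥ k = ⊥ := by
      match k with
      | 0 | 1 => rfl
      | k + 2 => exact le_bot_iff.1 (level_le _ _ _)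
    rw [this]
    exact .init hinit
  | succ l =>
    refine Or.inr ⟨l, rfl, by rw [hb]; simp; omega, ?_⟩
    have hzero := htodo j le_rfl (by omega)
    -- Ground cell `1` still contains `0`, so passing the cells `9` and `1` as arguments recreates
    -- exactly the memory on which `A.init` is specified to start.
    have harg : (s'.slot (K + 32) j).withArgs n 0 = start n := by
      rw [hzero]
      simp only [Mem.withArgs, start, Mem.setInt, Mem.zero, Mem.mk.injEq, and_true]
      exact Function.update_eq_self_iff.2 (by simp)
    refine Runs.mono_time (t₁ := 10 * t + 26 + 2 + 6) ?_ (by omega)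
    refine Runs.seq (P := fun x => x = (s'.setInt 11 j).putSlot (K + 32) j m)
      (hA.runs_callAt hp (eval_var' (by omega) h15) (by omega) (by norm_num)
      (by norm_num) (by norm_num) (by norm_num) hp.card hz hA.card_le (Nat.zero_le _)
      (fun i => by rw [hzero]; exact Nat.zero_le _) (harg ▸ hinit) rfl) ?_
    rintro _ rfl
    have hf : Frame (K + 32) {11, 15} s'
        (((s'.setInt 11 j).putSlot (K + 32) j m).setInt 15 (j + 1)) :=
      (((Frame.refl _ _ s').setInt (by omega) (by norm_num) (by simp) _).putSlot (by omega)
        (by omega) _).setInt (by omega) (by norm_num) (by simp) _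
    refine Runs.incr (v := j) (by omega) ?_ (by omega) ⟨hp.frame hf (by simp) (by simp) (by simp),
      ?_, j + 1, by omega, ?_, by omega, fun k h1 h2 => ?_, fun k h1 h2 => ?_⟩
    · rw [Mem.putSlot_int_of_lt (by omega), Mem.setInt_int, if_neg (by norm_num), h15]
    · rw [hf.int 1 (by norm_num) (by simp), hz]
    · simp [Mem.setInt_int]
    · rw [Mem.slot_setInt_of_lt (by omega)]
      by_cases hk : k = j
      · rw [hk, Mem.slot_putSlot (by omega)]
      · rw [Mem.slot_putSlot_of_ne (by omega) hk, Mem.slot_setInt_of_lt (by omega),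
          hdone k h1 (by omega)]
    · rw [Mem.slot_setInt_of_lt (by omega), Mem.slot_putSlot_of_ne (by omega) (by omega),
        Mem.slot_setInt_of_lt (by omega), htodo k (by omega) h2]

end Fits

end ConnAlg

/-! ## Parameters -/

theorem Exec.one_le {W : ℕ} {c : Cmd} {s s' : Mem} {t : ℕ} (h : Exec W c s s' t) : 1 ≤ t := by
  induction h <;> omega

/-- This makes the number of classes linear in `log U / ε`; it is where `ε ≤ 1` enters. -/
theorem div_two_le_log_one_add {ε : ℝ} (hε : 0 < ε) (hε1 : ε ≤ 1) : ε / 2 ≤ Real.log (1 + ε) := by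
  refine le_trans ?_ (Real.le_log_one_add_of_nonneg hε.le)
  rw [div_le_div_iff₀ (by norm_num) (by linarith)]
  nlinarith

theorem weightClass_lt {ε U : ℝ} (hε : 0 < ε) (hε1 : ε ≤ 1) (hU : 1 ≤ U) :
    (weightClass ε U : ℝ) < 2 * (Real.log U / ε) + 1 := by
  have h0 := Real.log_nonneg hU
  have hl := div_two_le_log_one_add hε hε1
  have hpos : 0 < Real.log (1 + ε) := by linarith
  refine (Nat.ceil_lt_add_one (div_nonneg h0 hpos.le)).trans_le ?_
  have : Real.log U / Real.log (1 + ε) ≤ Real.log U / (ε / 2) :=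
    div_le_div_of_nonneg_left h0 (by linarith) hl
  have h2 : Real.log U / (ε / 2) = 2 * (Real.log U / ε) := by field_simp
  linarith

theorem weightClass_le_ceil {ε U : ℝ} (hε : 0 < ε) (hε1 : ε ≤ 1) (hU : 1 ≤ U) :
    weightClass ε U ≤ 2 * ⌈Real.log U / ε⌉₊ := by
  have h1 := weightClass_lt hε hε1 hU
  have h2 := Nat.le_ceil (Real.log U / ε)
  have h3 : (weightClass ε U : ℝ) < (2 * ⌈Real.log U / ε⌉₊ + 1 : ℕ) := by push_cast; linarith
  have := Nat.cast_lt.1 h3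
  omega

/-- The word bound suffices for the virtual memories and for the class table. -/
theorem word_bound {n k M w : ℕ} (hk : k ≤ 2 * M) :
    ((n + 2) ^ (w + 1) + 3) * (k + 32) ≤ ((n + 2) * (M + 2)) ^ (w + 6) ∧
      n * n * (k + 32) ≤ ((n + 2) * (M + 2)) ^ (w + 6) := by
  have hM : k + 32 ≤ (M + 2) ^ (w + 6) :=
    calc k + 32 ≤ 16 * (M + 2) := by omega
      _ ≤ (M + 2) ^ 4 * (M + 2) :=
        Nat.mul_le_mul_right _ (by simpa using Nat.pow_le_pow_left (show 2 ≤ M + 2 by omega) 4)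
      _ = (M + 2) ^ 5 := by ring
      _ ≤ (M + 2) ^ (w + 6) := Nat.pow_le_pow_right (by omega) (by omega)
  have h1 : (n + 2) ^ (w + 1) + 3 ≤ (n + 2) ^ (w + 6) := by
    have h2 : 2 ≤ (n + 2) ^ (w + 1) :=
      (show 2 ≤ n + 2 by omega).trans (Nat.le_self_pow (by omega) _)
    calc (n + 2) ^ (w + 1) + 3 ≤ (n + 2) ^ (w + 1) * 2 ^ 5 := by omega
      _ ≤ (n + 2) ^ (w + 1) * (n + 2) ^ 5 :=
        Nat.mul_le_mul_left _ (Nat.pow_le_pow_left (by omega) 5)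
      _ = (n + 2) ^ (w + 6) := by ring
  have h2 : n * n ≤ (n + 2) ^ (w + 6) :=
    calc n * n ≤ (n + 2) ^ 2 := by nlinarith
      _ ≤ (n + 2) ^ (w + 6) := Nat.pow_le_pow_right (by omega) (by omega)
  rw [mul_pow]
  exact ⟨Nat.mul_le_mul h1 hM, Nat.mul_le_mul h2 hM⟩

theorem time_bound {n : ℕ} {T ε U : ℝ} (hT : 1 ≤ T) (hε : 0 < ε) (hε1 : ε ≤ 1) (hU : 1 ≤ U) :
    ((300 * (weightClass ε U + (Nat.log 2 n + 1) + 3) * (⌊T⌋₊ + 1) : ℕ) : ℝ) ≤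
      8400 * Real.log (n + 2) ^ 1 * T * (1 + Real.log U / ε) := by
  have hK := weightClass_lt hε hε1 hU
  have hR : 0 ≤ Real.log U / ε := div_nonneg (Real.log_nonneg hU) hε.le
  have hτ := Nat.floor_le (show 0 ≤ T by linarith)
  have hl2 : 1 / 2 ≤ Real.log 2 := by linarith [Real.log_two_gt_d9]
  have hL : Real.log 2 ≤ Real.log (n + 2) :=
    Real.log_le_log (by norm_num) (by linarith [Nat.cast_nonneg (α := ℝ) n])
  have hm : (Nat.log 2 n : ℝ) ≤ 2 * Real.log (n + 2) := by
    have h1 : ((2 : ℕ) : ℝ) ^ Nat.log 2 n ≤ n + 2 := by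
      have : 2 ^ Nat.log 2 n ≤ n + 2 := by
        rcases Nat.eq_zero_or_pos n with rfl | hn
        · simp
        · exact (Nat.pow_log_le_self 2 hn.ne').trans (by omega)
      exact_mod_cast this
    have h2 := Real.log_le_log (by positivity) h1
    rw [Real.log_pow] at h2
    push_cast at h2
    nlinarith [Nat.cast_nonneg (α := ℝ) (Nat.log 2 n)]
  set L := Real.log (n + 2)
  set R := Real.log U / ε
  push_cast
  -- The left side is at most `2 R + 2 L + 5`, and `L ≥ 1 / 2` absorbs the terms without `L`. The
  -- constant of the bound is `8400 = 300 * 14 * 2`.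
  have h1 : (weightClass ε U : ℝ) + (Nat.log 2 n + 1) + 3 ≤ 14 * (L * (1 + R)) := by nlinarith
  have h2 : (⌊T⌋₊ : ℝ) + 1 ≤ 2 * T := by linarith
  have hL0 : 0 ≤ L := by linarith
  have h3 : 0 ≤ 300 * (14 * (L * (1 + R))) := by positivity
  calc 300 * ((weightClass ε U : ℝ) + (Nat.log 2 n + 1) + 3) * (⌊T⌋₊ + 1)
      ≤ 300 * (14 * (L * (1 + R))) * (2 * T) := by gcongr
    _ = 8400 * L ^ 1 * T * (1 + R) := by ring

namespace ConnAlg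

/-- The bound `V` on contents has exponent `w + 1` so that it is at least `n` even for `w = 0`. The
real time bound becomes its floor, as running times are integers. -/
theorem Maintains.exists_fits {A : ConnAlg} {n w k M : ℕ} {τ : ℝ}
    (h : A.Maintains ((n + 2) ^ w) n τ) (hk : k ≤ 2 * M) :
    ∃ forest : Mem → SimpleGraph (Fin n), A.Fits n ((n + 2) ^ w) ((n + 2) ^ (w + 1)) k
      (((n + 2) * (M + 2)) ^ (w + 6)) ⌊τ⌋₊ forest := by
  obtain ⟨-, forest, hf⟩ := h
  refine ⟨forest, Nat.pow_le_pow_right (by omega) (by omega), ?_, (word_bound hk).1,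
    (word_bound hk).2, fun G m hm => (hf G m hm).1, fun G u v huv hadj m hm => ?_,
    fun G u v hadj m hm => ?_, fun G m u v hm => ?_⟩
  · exact (show n ≤ n + 2 by omega).trans (Nat.le_self_pow (by omega) _)
  · obtain ⟨m', t, he, ht⟩ := (hf G m hm).2.1 u v huv hadj
    exact ⟨m', t, he, Nat.le_floor ht, hm.insert huv hadj he⟩
  · obtain ⟨m', t, he, ht⟩ := (hf G m hm).2.2.1 u v hadj
    exact ⟨m', t, he, Nat.le_floor ht, hm.delete hadj he⟩
  · obtain ⟨m', t, he, ht, ha⟩ := (hf G m hm).2.2.2 u v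
    exact ⟨m', t, he, Nat.le_floor ht, hm.query he, ha⟩

/-- Any query takes at least one step, but there must be a vertex to ask about. For `n = 0` nothing
is known about `τ`, and there are no updates to bound. -/
theorem Maintains.one_le {A : ConnAlg} {W n : ℕ} {τ : ℝ} (h : A.Maintains W n τ) (u : Fin n) :
    1 ≤ τ := by
  obtain ⟨⟨s, t, he⟩, forest, hf⟩ := h
  obtain ⟨s', t', he', ht', -⟩ := (hf _ _ (.init he)).2.2.2 u u
  exact le_trans (by exact_mod_cast he'.one_le) ht'

/-- The data structure that maintains an approximate minimum spanning forest. -/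
def toMSFAlg (A : ConnAlg) : MSFAlg := ⟨initMSF A, insertMSF A, deleteMSF A⟩

theorem Fits.represents {A : ConnAlg} {n W V W' τ : ℕ} {forest : Mem → SimpleGraph (Fin n)}
    {ε U : ℝ} (hA : A.Fits n W V (weightClass ε U) W' τ forest) (hε : 0 < ε) (hU : 1 ≤ U)
    {m : Mem} {t : ℕ} (hinit : Exec W A.init (start n) m t) {G : WGraph n}
    {F : SimpleGraph (Fin n)} {s : Mem} (h : A.toMSFAlg.Reach W' n ε U G F s) :
    A.Represents W (weightClass ε U) ε U G F s := by
  -- Only the resulting state matters here, not the time, so this crude bound on the number of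
  -- halvings is enough.
  have hm₀ : n ≤ 2 ^ n := Nat.lt_two_pow_self.le
  induction h with
  | init he =>
    obtain ⟨_, s', t', he', -, h'⟩ := hA.runs_initMSF hε hU rfl hinit
    rwa [(he.det he').1]
  | insert _ huv hadj hx1 hxU he hout ih =>
    obtain ⟨s', t', he', -, cs, hout', -, h'⟩ :=
      hA.runs_insertMSF hε rfl ih huv hadj hx1 hxU hm₀
    obtain ⟨rfl, -⟩ := he.det he'
    rwa [hout.unique hout']
  | delete _ hadj he hout ih =>
    obtain ⟨s', t', he', -, cs, hout', -, h'⟩ := hA.runs_deleteMSF hε rfl ih hadj hm₀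
    obtain ⟨rfl, -⟩ := he.det he'
    rwa [hout.unique hout']

end ConnAlg

end DynGraph

/-! ### The approximate minimum spanning forest algorithm -/

open DynGraph in
theorem corollary3p10 (A : ConnAlg) (T : ℕ → ℝ) (hA : A.IsDynamicConnectivity T) :
    ∃ (B : MSFAlg) (C : ℝ) (c w : ℕ), ∀ (n : ℕ) (ε U : ℝ), 0 < ε → ε ≤ 1 → 1 ≤ U →
      B.Maintains (((n + 2) * (⌈Real.log U / ε⌉₊ + 2)) ^ w) n ε U
        (C * Real.log (n + 2) ^ c * T n * (1 + Real.log U / ε)) := by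
  obtain ⟨w, hw⟩ := hA
  refine ⟨A.toMSFAlg, 8400, 1, w + 6, fun n ε U hε hε1 hU => ?_⟩
  obtain ⟨forest, hfits⟩ := (hw n).exists_fits (weightClass_le_ceil hε hε1 hU)
  obtain ⟨m, t, hinit⟩ := (hw n).1
  -- For the running time, the number of halvings in a search is taken logarithmic in `n`.
  have hm₀ : n ≤ 2 ^ (Nat.log 2 n + 1) := (Nat.lt_pow_succ_log_self (by norm_num) n).le
  refine ⟨?_, fun G F s hs => ?_⟩
  · obtain ⟨_, s, t', he, -⟩ := hfits.runs_initMSF hε hU rfl hinit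
    exact ⟨s, t', he⟩
  have hrep := hfits.represents hε hU hinit hs
  refine ⟨hrep.isApproxMSF hε, fun u v x huv hadj hx1 hxU => ?_, fun u v hadj => ?_⟩
  · obtain ⟨s', t', he, ht, cs, hout, hlen, -⟩ :=
      hfits.runs_insertMSF hε rfl hrep huv hadj hx1 hxU hm₀
    exact ⟨s', t', he, (Nat.cast_le.2 ht).trans (time_bound ((hw n).one_le u) hε hε1 hU),
      cs, hout, hlen⟩
  · obtain ⟨s', t', he, ht, cs, hout, hlen, -⟩ := hfits.runs_deleteMSF hε rfl hrep hadj hm₀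
    exact ⟨s', t', he, (Nat.cast_le.2 ht).trans (time_bound ((hw n).one_le u) hε hε1 hU),
      cs, hout, hlen⟩
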